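/- **Conventions.** $K$ is a field of characteristic zero, all gradings are $\mathbb Z$-gradings, $\bar v$ is the degree of a homogeneous element $v$ (an overbar is omitted in exponents of signs), and $\alpha(\sigma,\boldsymbol v)$ is the Koszul sign, $v_{\sigma(1)}\odot\cdots\odot v_{\sigma(n)}=\alpha(\sigma,\boldsymbol v)\,v_1\odot\cdots\odot v_n$ in the graded symmetric algebra. $S_{i,j}$ is the set of $(i,j)$-unshuffles, $i,j\ge 0$. All formulas are for homogeneous arguments, and $[\,,]$ of operators is the graded commutator. $A$ is a graded commutative unital $K$-algebra and $L$, $P$ are graded $A$-modules. **$LR_\infty[1]$ algebras.** An $LR_\infty[1]$ structure on $(A,L)$ consists of graded symmetric $K$-multilinear brackets $X_k:L^{\times k}\to L$ ($k\ge 1$, and $X_0=0$) and graded symmetric, graded $A$-multilinear anchors $\sigma_k:L^{\times(k-1)}\to\mathrm{Der}\,A$ ($k\ge1$), all of degree $1$, with $$X_k(\xi_1,\dots,\xi_{k-1},a\xi_k)=\sigma_k(\xi_1,\dots,\xi_{k-1}|a)\,\xi_k+(-)^{(1+\xi_1+\cdots+\xi_{k-1})a}\,a\,X_k(\xi_1,\dots,\xi_k),$$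 such that, for all $k\ge 1$ (indices of components omitted), $$\sum_{i+j=k}\sum_{\sigma\in S_{i,j}}\alpha(\sigma,\boldsymbol\xi)\,X(X(\xi_{\sigma(1)},\dots,\xi_{\sigma(i)}),\xi_{\sigma(i+1)},\dots,\xi_{\sigma(k)})=0,$$ $$\sum_{i+j=k}\sum_{\sigma\in S_{i,j-1}}\alpha(\sigma,\boldsymbol\xi)\Big[(-)^{\xi_{\sigma(1)}+\cdots+\xi_{\sigma(i)}}\sigma(\xi_{\sigma(1)},\dots,\xi_{\sigma(i)}|\sigma(\xi_{\sigma(i+1)},\dots,\xi_{\sigma(k-1)}|a))+\sigma(X(\xi_{\sigma(1)},\dots,\xi_{\sigma(i)}),\xi_{\sigma(i+1)},\dots,\xi_{\sigma(k-1)}|a)\Big]=0.$$ A $P_\infty[1]$ structure on a graded commutative algebra $S$ consists of graded symmetric $K$-multilinear maps $\Lambda_k:S^{\times k}\to S$, $k\ge1$, of degree $1$, that are graded derivations in each entry and satisfy the first of these identities (with $\Lambda$ in place of $X$); one writes $\{u_1,\dots,u_k\}=\Lambda_k(u_1,\dots,u_k)$. Then $(K,S)$ is an $LR_\infty[1]$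 algebra with zero anchors. **Connections.** A left $(A,L)$-connection $\nabla$ in $P$ consists of graded symmetric, graded $A$-multilinear maps $\nabla_k:L^{\times(k-1)}\to\mathrm{End}_KP$, $k\ge1$, of degree $1$ with $\nabla_k(\xi_1,\dots,\xi_{k-1}|ap)=(-)^{(1+\xi_1+\cdots+\xi_{k-1})a}a\nabla_k(\xi_1,\dots,\xi_{k-1}|p)+\sigma_k(\xi_1,\dots,\xi_{k-1}|a)p$. Its curvature is $$J(\nabla)(\xi_1,\dots,\xi_{k-1}|p)=\sum_{i+j=k}\sum_{\sigma\in S_{i,j-1}}\alpha(\sigma,\boldsymbol\xi)\Big[\nabla(X(\xi_{\sigma(1)},\dots,\xi_{\sigma(i)}),\xi_{\sigma(i+1)},\dots,\xi_{\sigma(k-1)}|p)+(-)^{\xi_{\sigma(1)}+\cdots+\xi_{\sigma(i)}}\nabla(\xi_{\sigma(1)},\dots,\xi_{\sigma(i)}|\nabla(\xi_{\sigma(i+1)},\dots,\xi_{\sigma(k-1)}|p))\Big].$$ **Forms and tensors.** $\mathrm{Sym}_A(L,P)$ is the direct sum over $\ell\ge0$ and over all degrees of the spaces of homogeneous, graded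 symmetric, graded $A$-multilinear maps $\Omega:L^{\times\ell}\to P$ ($\ell$-forms), and $S_A^\bullet L$ is the graded symmetric algebra of $L$ over $A$; both are graded by the degrees inherited from $A$, $L$, $P$. The algebra $S_A^\bullet L$ acts on $\mathrm{Sym}_A(L,P)$ by insertions $i_u$: $i_{uv}=i_ui_v$, $i_a\Omega=a\Omega$ for $a\in A$, and $(i_\xi\Omega)(\xi_1,\dots,\xi_{\ell-1})=(-)^{\xi\Omega}\Omega(\xi,\xi_1,\dots,\xi_{\ell-1})$ for $\xi\in L$. For an $\ell$-form $\Omega$ and $k\ge1$ put $$(D_k^\nabla\Omega)(\xi_1,\dots,\xi_{\ell+k-1})=\sum_{\sigma\in S_{k-1,\ell}}(-)^{\Omega(\xi_{\sigma(1)}+\cdots+\xi_{\sigma(k-1)})}\alpha(\sigma,\boldsymbol\xi)\nabla(\xi_{\sigma(1)},\dots,\xi_{\sigma(k-1)}|\Omega(\xi_{\sigma(k)},\dots,\xi_{\sigma(\ell+k-1)}))-\sum_{\tau\in S_{k,\ell-1}}(-)^{\Omega}\alpha(\tau,\boldsymbol\xi)\Omega(X(\xi_{\tau(1)},\dots,\xi_{\tau(k)}),\xi_{\tau(k+1)},\dots,\xi_{\tau(\ell+k-1)})$$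 (the second sum is absent for $\ell=0$), and let $\mathcal J_k^\nabla=\tfrac12\sum_{i+j=k+1,\ i,j\ge1}[D_i^\nabla,D_j^\nabla]$ be the components of $\mathcal J^\nabla=\tfrac12[D^\nabla,D^\nabla]$. **Theorem.** Let $(A,L)$ be an $LR_\infty[1]$ algebra and $\nabla$ a left $(A,L)$-connection in $P$. There is exactly one $P_\infty[1]$ structure $\Lambda$ on $S_A^\bullet L$ with $\{\xi_1,\dots,\xi_k\}=X_k(\xi_1,\dots,\xi_k)$ and $\{\xi_1,\dots,\xi_{k-1},a\}=\sigma_k(\xi_1,\dots,\xi_{k-1}|a)$ for $\xi_i\in L$, $a\in A$, that vanishes if two of its entries are in $A$. The operators $D_k^\nabla$ map $\mathrm{Sym}_A(L,P)$ to itself. With $$L_k^\nabla(u_1,\dots,u_{k-1}|\Omega):=-(-)^k[\cdots[[D_k^\nabla,i_{u_1}],i_{u_2}]\cdots,i_{u_{k-1}}]\Omega,\qquad u_1,\dots,u_{k-1}\in S_A^\bullet L,\ \Omega\in\mathrm{Sym}_A(L,P),$$ the sum $L^\nabla=L_1^\nabla+L_2^\nabla+\cdots$ is a left $(K,S_A^\bullet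 L)$-connection in $\mathrm{Sym}_A(L,P)$, where $(K,S_A^\bullet L)$ is the $LR_\infty[1]$ algebra given by $\Lambda$. Its curvature is $$J(L^\nabla)(u_1,\dots,u_{k-1}|\Omega)=-(-)^k[\cdots[[\mathcal J_k^\nabla,i_{u_1}],i_{u_2}]\cdots,i_{u_{k-1}}]\Omega .$$ Moreover, for all tensors $u,u_1,\dots,u_{k-1}$ and all $P$-valued forms $\Omega$, $$L^\nabla(u_1,\dots,u_{k-1}|i_u\Omega)=i_{\{u_1,\dots,u_{k-1},u\}}\Omega+(-)^{\chi}i_uL^\nabla(u_1,\dots,u_{k-1}|\Omega),\qquad \chi=\bar u(\bar u_1+\cdots+\bar u_{k-1}+1),\quad k\ge1,$$ $$L^\nabla(uu_1,u_2,\dots,u_{k-1}|\Omega)=(-)^{u}i_uL^\nabla(u_1,\dots,u_{k-1}|\Omega)+(-)^{\chi'}L^\nabla(u,u_2,\dots,u_{k-1}|i_{u_1}\Omega),\qquad \chi'=\bar u_1(\bar u_2+\cdots+\bar u_{k-1}),\quad k\ge2 .$$ -/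

import Mathlib

set_option linter.unusedSectionVars false

namespace SHLR

open DirectSum

section Signs

/-- The sign by which a permutation `σ` acts on a graded symmetric product of homogeneous elements
`v 0, …, v (n - 1)` of degrees `d 0, …, d (n - 1)`:
`v (σ 0) ⋯ v (σ (n - 1)) = permSign d σ • v 0 ⋯ v (n - 1)`. -/
def permSign {n : ℕ} (d : Fin n → ℤ) (σ : Equiv.Perm (Fin n)) : ℤˣ :=
  ∏ i : Fin n, ∏ j : Fin n, if i < j ∧ σ j < σ i then (d (σ i) * d (σ j)).negOnePow else 1

/-- The `(|I|, n - |I|)`-unshuffles of `n` elements correspond to the subsets `I` of `Fin n`: the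
unshuffle lists `I` increasingly and then the complement of `I` increasingly. This is its sign
`permSign` on elements of degrees `d`. -/
def unshuffleSign {n : ℕ} (d : Fin n → ℤ) (I : Finset (Fin n)) : ℤˣ :=
  ∏ i ∈ I, ∏ j ∈ Iᶜ, if j < i then (d i * d j).negOnePow else 1

/-- The entries of `v` at the places in `I`, in increasing order. -/
def sub {n : ℕ} {V : Type*} (v : Fin n → V) (I : Finset (Fin n)) : Fin I.card → V :=
  fun a => v (I.orderEmbOfFin rfl a)

end Signs

section Maps

variable {K A V W : Type*} [Field K] [Ring A] [Algebra K A]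
  [AddCommGroup V] [Module K V] [AddCommGroup W] [Module K W]

/-- A multilinear map is of degree `e`. -/
def HasDegree (𝒱 : ℤ → Submodule K V) (𝒲 : ℤ → Submodule K W) (e : ℤ) {n : ℕ}
    (f : MultilinearMap K (fun _ : Fin n => V) W) : Prop :=
  ∀ (d : Fin n → ℤ) (v : Fin n → V), (∀ i, v i ∈ 𝒱 (d i)) → f v ∈ 𝒲 (e + ∑ i, d i)

/-- A multilinear map is graded symmetric. -/
def GradedSymm (𝒱 : ℤ → Submodule K V) {n : ℕ}
    (f : MultilinearMap K (fun _ : Fin n => V) W) : Prop :=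
  ∀ (d : Fin n → ℤ) (v : Fin n → V), (∀ i, v i ∈ 𝒱 (d i)) → ∀ σ : Equiv.Perm (Fin n),
    f (fun i => v (σ i)) = permSign d σ • f v

/-- A multilinear map of degree `e` is graded `A`-multilinear: scalars from `A` can be moved out
of every entry, with the Koszul sign for passing the map and the preceding entries. -/
def GradedALinear [Module A V] [Module A W] (𝒜 : ℤ → Submodule K A) (𝒱 : ℤ → Submodule K V)
    (e : ℤ) {n : ℕ} (f : MultilinearMap K (fun _ : Fin n => V) W) : Prop :=
  ∀ (d : Fin n → ℤ) (v : Fin n → V), (∀ i, v i ∈ 𝒱 (d i)) →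
    ∀ (i : Fin n) (b : ℤ), ∀ a ∈ 𝒜 b,
      f (Function.update v i (a • v i)) =
        ((e + ∑ j ∈ Finset.Iio i, d j) * b).negOnePow • a • f v

/-- The endomorphisms of degree `e` of a graded vector space. -/
def endDeg (𝒲 : ℤ → Submodule K W) (e : ℤ) : Submodule K (Module.End K W) where
  carrier := {T | ∀ (c : ℤ), ∀ w ∈ 𝒲 c, T w ∈ 𝒲 (e + c)}
  add_mem' hS hT c w hw := by
    rw [LinearMap.add_apply]
    exact Submodule.add_mem _ (hS c w hw) (hT c w hw)
  zero_mem' c w _ := by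
    rw [LinearMap.zero_apply]
    exact Submodule.zero_mem _
  smul_mem' r T hT c w hw := by
    rw [LinearMap.smul_apply]
    exact Submodule.smul_mem _ r (hT c w hw)

/-- `𝒜` is a graded commutative algebra (the grading itself is a `GradedAlgebra` instance). -/
def GradedComm (𝒜 : ℤ → Submodule K A) : Prop :=
  ∀ (c d : ℤ), ∀ a ∈ 𝒜 c, ∀ b ∈ 𝒜 d, b * a = (c * d).negOnePow • (a * b)

/-- The field `K` as a graded algebra concentrated in degree `0`. -/
def groundGrading (K : Type*) [Field K] (d : ℤ) : Submodule K K := if d = 0 then ⊤ else ⊥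

end Maps

section Algebras

variable {K A L P : Type*} [Field K] [Ring A] [Algebra K A]
  [AddCommGroup L] [Module K L] [Module A L] [AddCommGroup P] [Module K P] [Module A P]

/-- An `LR_∞[1]` algebra structure on `(A, L)`: a formal sum `𝕏 = 𝕏_1 + 𝕏_2 + ⋯` of `A`-module
multiderivations of `L` of degree `1` with `[𝕏, 𝕏] = 0`. The component `𝕏_k` has the `k`-th
bracket `bracket k` (with `k` entries) and the symbol `anchor (k - 1)` (with `k - 1` entries,
taking values in the derivations of `A`). -/
@[ext]
structure LRInfinityAlgebra (𝒜 : ℤ → Submodule K A) (ℒ : ℤ → Submodule K L) where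
  bracket : (k : ℕ) → MultilinearMap K (fun _ : Fin k => L) L
  anchor : (n : ℕ) → MultilinearMap K (fun _ : Fin n => L) (Module.End K A)
  bracket_zero : bracket 0 = 0
  bracket_degree : ∀ k, HasDegree ℒ ℒ 1 (bracket k)
  bracket_symm : ∀ k, GradedSymm ℒ (bracket k)
  bracket_leibniz : ∀ (n : ℕ) (d : Fin n → ℤ) (ξ : Fin n → L), (∀ i, ξ i ∈ ℒ (d i)) →
    ∀ (b : ℤ), ∀ a ∈ 𝒜 b, ∀ ζ : L,
      bracket (n + 1) (Fin.snoc ξ (a • ζ)) =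
        anchor n ξ a • ζ + ((1 + ∑ i, d i) * b).negOnePow • a • bracket (n + 1) (Fin.snoc ξ ζ)
  anchor_degree : ∀ n, HasDegree ℒ (endDeg 𝒜) 1 (anchor n)
  anchor_symm : ∀ n, GradedSymm ℒ (anchor n)
  anchor_linear : ∀ (n : ℕ) (b : A),
    GradedALinear 𝒜 ℒ 1 ((LinearMap.applyₗ b).compMultilinearMap (anchor n))
  anchor_derivation : ∀ (n : ℕ) (d : Fin n → ℤ) (ξ : Fin n → L), (∀ i, ξ i ∈ ℒ (d i)) →
    ∀ (c : ℤ), ∀ a ∈ 𝒜 c, ∀ b : A,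
      anchor n ξ (a * b) =
        ((1 + ∑ i, d i) * c).negOnePow • (a * anchor n ξ b) + anchor n ξ a * b
  /-- The bracket component of `½[𝕏, 𝕏]` vanishes. -/
  jacobi_bracket : ∀ (k : ℕ) (d : Fin k → ℤ) (ξ : Fin k → L), (∀ i, ξ i ∈ ℒ (d i)) →
    ∑ I : Finset (Fin k), unshuffleSign d I •
      bracket (Iᶜ.card + 1) (Fin.cons (bracket I.card (sub ξ I)) (sub ξ Iᶜ)) = 0
  /-- The symbol of `½[𝕏, 𝕏]` vanishes. -/
  jacobi_anchor : ∀ (n : ℕ) (d : Fin n → ℤ) (ξ : Fin n → L), (∀ i, ξ i ∈ ℒ (d i)) → ∀ a : A,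
    ∑ I : Finset (Fin n), unshuffleSign d I •
      ((∑ i ∈ I, d i).negOnePow • anchor I.card (sub ξ I) (anchor Iᶜ.card (sub ξ Iᶜ) a) +
        anchor (Iᶜ.card + 1) (Fin.cons (bracket I.card (sub ξ I)) (sub ξ Iᶜ)) a) = 0

/-- A left `(A, L)`-connection in `P`: a form `∇ = ∇_1 + ∇_2 + ⋯` of degree `1` on `L` with values
in the derivations of the `A`-module `P`, with the anchors of `(A, L)` as symbols. The component
`∇_k` is `conn (k - 1)`, with `k - 1` entries from `L`. -/
structure LeftConnection {𝒜 : ℤ → Submodule K A} {ℒ : ℤ → Submodule K L}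
    (X : LRInfinityAlgebra 𝒜 ℒ) (ℳ : ℤ → Submodule K P) where
  conn : (n : ℕ) → MultilinearMap K (fun _ : Fin n => L) (Module.End K P)
  conn_degree : ∀ n, HasDegree ℒ (endDeg ℳ) 1 (conn n)
  conn_symm : ∀ n, GradedSymm ℒ (conn n)
  conn_linear : ∀ (n : ℕ) (p : P),
    GradedALinear 𝒜 ℒ 1 ((LinearMap.applyₗ p).compMultilinearMap (conn n))
  conn_leibniz : ∀ (n : ℕ) (d : Fin n → ℤ) (ξ : Fin n → L), (∀ i, ξ i ∈ ℒ (d i)) →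
    ∀ (b : ℤ), ∀ a ∈ 𝒜 b, ∀ p : P,
      conn n ξ (a • p) =
        ((1 + ∑ i, d i) * b).negOnePow • a • conn n ξ p + X.anchor n ξ a • p

/-- The curvature `J(∇) = ∇ ∘ X + ½[∇, ∇]` of a left connection, on homogeneous elements `ξ`
of degrees `d`. -/
def LeftConnection.curvature {𝒜 : ℤ → Submodule K A} {ℒ : ℤ → Submodule K L}
    {X : LRInfinityAlgebra 𝒜 ℒ} {ℳ : ℤ → Submodule K P} (N : LeftConnection X ℳ)
    {n : ℕ} (d : Fin n → ℤ) (ξ : Fin n → L) (p : P) : P :=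
  ∑ I : Finset (Fin n), unshuffleSign d I •
    (N.conn (Iᶜ.card + 1) (Fin.cons (X.bracket I.card (sub ξ I)) (sub ξ Iᶜ)) p +
      (∑ i ∈ I, d i).negOnePow • N.conn I.card (sub ξ I) (N.conn Iᶜ.card (sub ξ Iᶜ) p))

/-- A `P_∞[1]` algebra structure on the graded algebra `S`: a formal sum `Λ = Λ_1 + Λ_2 + ⋯` of
multiderivations of degree `1` of the algebra `S` with `[Λ, Λ] = 0`. -/
@[ext]
structure PInfinityAlgebra {S : Type*} [Ring S] [Algebra K S] (𝒮 : ℤ → Submodule K S) where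
  bracket : (k : ℕ) → MultilinearMap K (fun _ : Fin k => S) S
  bracket_zero : bracket 0 = 0
  bracket_degree : ∀ k, HasDegree 𝒮 𝒮 1 (bracket k)
  bracket_symm : ∀ k, GradedSymm 𝒮 (bracket k)
  bracket_leibniz : ∀ (n : ℕ) (d : Fin n → ℤ) (u : Fin n → S), (∀ i, u i ∈ 𝒮 (d i)) →
    ∀ (c : ℤ), ∀ v ∈ 𝒮 c, ∀ w : S,
      bracket (n + 1) (Fin.snoc u (v * w)) =
        ((1 + ∑ i, d i) * c).negOnePow • (v * bracket (n + 1) (Fin.snoc u w)) +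
          bracket (n + 1) (Fin.snoc u v) * w
  jacobi : ∀ (k : ℕ) (d : Fin k → ℤ) (u : Fin k → S), (∀ i, u i ∈ 𝒮 (d i)) →
    ∑ I : Finset (Fin k), unshuffleSign d I •
      bracket (Iᶜ.card + 1) (Fin.cons (bracket I.card (sub u I)) (sub u Iᶜ)) = 0

/-- A `P_∞[1]` algebra `S` is in particular an `L_∞[1]` algebra, i.e. `(K, S)` is an
`LR_∞[1]` algebra (with zero anchors). -/
def PInfinityAlgebra.toLRInfinityAlgebra {S : Type*} [Ring S] [Algebra K S]
    {𝒮 : ℤ → Submodule K S} (Λ : PInfinityAlgebra 𝒮) :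
    LRInfinityAlgebra (groundGrading K) 𝒮 where
  bracket := Λ.bracket
  anchor _ := 0
  bracket_zero := Λ.bracket_zero
  bracket_degree := Λ.bracket_degree
  bracket_symm := Λ.bracket_symm
  bracket_leibniz n d u _ b a ha w := by
    have h0 : b ≠ 0 → a = 0 := fun hb => by simpa [groundGrading, hb] using ha
    rcases eq_or_ne b 0 with rfl | hb
    · have := (Λ.bracket (n + 1)).map_update_smul (Fin.snoc u w) (Fin.last n) a w
      simpa [Fin.update_snoc_last] using this
    · have := (Λ.bracket (n + 1)).map_update_zero (Fin.snoc u w) (Fin.last n)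
      simp only [Fin.update_snoc_last] at this
      simpa [h0 hb] using this
  anchor_degree n d v _ := by simp
  anchor_symm n d v _ σ := by simp
  anchor_linear n b d v _ i c a _ := by simp
  anchor_derivation n d ξ _ c a _ b := by simp
  jacobi_bracket := Λ.jacobi
  jacobi_anchor n d ξ _ a := by simp

end Algebras

section SymmetricAlgebra

variable {K A L : Type*} [Field K] [Ring A] [Algebra K A]
  [AddCommGroup L] [Module K L] [Module A L]
  (𝒜 : ℤ → Submodule K A) (ℒ : ℤ → Submodule K L)

/-- The relations defining the graded symmetric algebra of the graded `A`-module `L` as a quotient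
of the free algebra on the vector space `A ⊕ L`. -/
inductive SymRel : TensorAlgebra K (A × L) → TensorAlgebra K (A × L) → Prop
  | one : SymRel (TensorAlgebra.ι K (1, 0)) 1
  | mul (a b : A) : SymRel (TensorAlgebra.ι K (a * b, 0))
      (TensorAlgebra.ι K (a, 0) * TensorAlgebra.ι K (b, 0))
  | smul (a : A) (ξ : L) : SymRel (TensorAlgebra.ι K (0, a • ξ))
      (TensorAlgebra.ι K (a, 0) * TensorAlgebra.ι K (0, ξ))
  | comm_smul (b c : ℤ) (a : A) (ξ : L) : a ∈ 𝒜 b → ξ ∈ ℒ c →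
      SymRel (TensorAlgebra.ι K (0, ξ) * TensorAlgebra.ι K (a, 0))
        ((b * c).negOnePow • (TensorAlgebra.ι K (a, 0) * TensorAlgebra.ι K (0, ξ)))
  | comm (b c : ℤ) (ξ ζ : L) : ξ ∈ ℒ b → ζ ∈ ℒ c →
      SymRel (TensorAlgebra.ι K (0, ξ) * TensorAlgebra.ι K (0, ζ))
        ((b * c).negOnePow • (TensorAlgebra.ι K (0, ζ) * TensorAlgebra.ι K (0, ξ)))

/-- The graded symmetric algebra `S_A^• L`. -/
abbrev SymAlg : Type _ := RingQuot (SymRel 𝒜 ℒ)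

/-- The algebra homomorphism `A → S_A^• L` onto the `0`-tensors. -/
def SymAlg.ofScalar : A →ₐ[K] SymAlg 𝒜 ℒ :=
  AlgHom.ofLinearMap
    ((RingQuot.mkAlgHom K (SymRel 𝒜 ℒ)).toLinearMap ∘ₗ TensorAlgebra.ι K ∘ₗ LinearMap.inl K A L)
    (by
      have := RingQuot.mkAlgHom_rel K (SymRel.one (𝒜 := 𝒜) (ℒ := ℒ))
      simpa using this)
    (fun a b => by
      have := RingQuot.mkAlgHom_rel K (SymRel.mul (𝒜 := 𝒜) (ℒ := ℒ) a b)
      simpa using this)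

/-- The map `L → S_A^• L` onto the `1`-tensors. -/
def SymAlg.ofVector : L →ₗ[K] SymAlg 𝒜 ℒ :=
  (RingQuot.mkAlgHom K (SymRel 𝒜 ℒ)).toLinearMap ∘ₗ TensorAlgebra.ι K ∘ₗ LinearMap.inr K A L

/-- The grading of `S_A^• L`: the tensors of degree `e` are the sums of the tensors
`a ξ_1 ⋯ ξ_n` with `a, ξ_1, …, ξ_n` homogeneous of degrees with sum `e`. -/
def SymAlg.grading (e : ℤ) : Submodule K (SymAlg 𝒜 ℒ) :=
  Submodule.span K {u | ∃ (n : ℕ) (b : ℤ) (d : Fin n → ℤ) (a : A) (ξ : Fin n → L),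
    a ∈ 𝒜 b ∧ (∀ i, ξ i ∈ ℒ (d i)) ∧ b + ∑ i, d i = e ∧
      u = SymAlg.ofScalar 𝒜 ℒ a * (List.ofFn fun i => SymAlg.ofVector 𝒜 ℒ (ξ i)).prod}

variable {𝒜 ℒ}

/-- The `P_∞[1]` structure `Λ` on `S_A^• L` extends the `LR_∞[1]` structure on `(A, L)`: on
`1`-tensors it is given by the brackets, on `1`-tensors and a single `0`-tensor by the anchors,
and it vanishes if two entries are `0`-tensors. -/
structure Extends (X : LRInfinityAlgebra 𝒜 ℒ)
    (Λ : PInfinityAlgebra (SymAlg.grading 𝒜 ℒ)) : Prop where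
  vector : ∀ (k : ℕ) (ξ : Fin k → L),
    Λ.bracket k (fun i => SymAlg.ofVector 𝒜 ℒ (ξ i)) = SymAlg.ofVector 𝒜 ℒ (X.bracket k ξ)
  scalar : ∀ (n : ℕ) (ξ : Fin n → L) (a : A),
    Λ.bracket (n + 1)
        (Fin.snoc (fun i => SymAlg.ofVector 𝒜 ℒ (ξ i)) (SymAlg.ofScalar 𝒜 ℒ a)) =
      SymAlg.ofScalar 𝒜 ℒ (X.anchor n ξ a)
  scalar_scalar : ∀ (k : ℕ) (u : Fin k → SymAlg 𝒜 ℒ) (i j : Fin k), i ≠ j →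
    u i ∈ Set.range (SymAlg.ofScalar 𝒜 ℒ) → u j ∈ Set.range (SymAlg.ofScalar 𝒜 ℒ) →
      Λ.bracket k u = 0

end SymmetricAlgebra

section Forms

variable {K A L P : Type*} [Field K] [Ring A] [Algebra K A]
  [AddCommGroup L] [Module K L] [Module A L]
  [AddCommGroup P] [Module K P] [Module A P] [IsScalarTower K A P]
  (𝒜 : ℤ → Submodule K A) (ℒ : ℤ → Submodule K L) (ℳ : ℤ → Submodule K P)

variable (K L P) in
/-- Families `Ω = (Ω_n)` of `K`-multilinear maps `Ω_n : L^n → P`. -/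
abbrev Cochain : Type _ := (n : ℕ) → MultilinearMap K (fun _ : Fin n => L) P

/-- The symmetric `P`-valued `n`-forms of degree `e`. -/
def homForms (n : ℕ) (e : ℤ) : Submodule K (MultilinearMap K (fun _ : Fin n => L) P) where
  carrier := {Ω | HasDegree ℒ ℳ e Ω ∧ GradedSymm ℒ Ω ∧ GradedALinear 𝒜 ℒ e Ω}
  add_mem' := by
    rintro Ω Ω' ⟨h1, h2, h3⟩ ⟨h1', h2', h3'⟩
    refine ⟨fun d v hv => ?_, fun d v hv σ => ?_, fun d v hv i b a ha => ?_⟩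
    · exact Submodule.add_mem _ (h1 d v hv) (h1' d v hv)
    · simp only [_root_.add_apply, h2 d v hv σ, h2' d v hv σ, smul_add]
    · simp only [_root_.add_apply, h3 d v hv i b a ha, h3' d v hv i b a ha, smul_add]
  zero_mem' := ⟨fun d v _ => by simp, fun d v _ σ => by simp, fun d v _ i b a _ => by simp⟩
  smul_mem' := by
    rintro r Ω ⟨h1, h2, h3⟩
    refine ⟨fun d v hv => ?_, fun d v hv σ => ?_, fun d v hv i b a ha => ?_⟩
    · exact Submodule.smul_mem _ r (h1 d v hv)
    · rw [_root_.smul_apply, _root_.smul_apply, h2 d v hv σ, smul_comm]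
    · rw [_root_.smul_apply, _root_.smul_apply, h3 d v hv i b a ha, smul_comm,
        smul_comm r a]

/-- The space `Sym_A(L, P)` of symmetric `P`-valued forms: the direct sum of the spaces of
`n`-forms of degree `e`, over all `n` and `e`. -/
def SymForms : Submodule K (Cochain K L P) :=
  ⨆ (n : ℕ) (e : ℤ), (homForms 𝒜 ℒ ℳ n e).map (LinearMap.single K _ n)

/-- The grading of `Sym_A(L, P)`. -/
def SymForms.grading (e : ℤ) : Submodule K (SymForms 𝒜 ℒ ℳ) :=
  (⨆ n : ℕ, (homForms 𝒜 ℒ ℳ n e).map (LinearMap.single K _ n)).comap (SymForms 𝒜 ℒ ℳ).subtype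

variable [Decomposition ℒ] [Decomposition ℳ]

/-- The operator multiplying homogeneous elements of degree `d` by `(-1) ^ (e d)`. -/
def gsign {M : Type*} [AddCommGroup M] [Module K M] (𝒩 : ℤ → Submodule K M) [Decomposition 𝒩]
    (e : ℤ) : M →ₗ[K] M :=
  DirectSum.toModule K ℤ M (fun d => ((e * d).negOnePow : ℤ) • (𝒩 d).subtype) ∘ₗ
    (decomposeLinearEquiv 𝒩).toLinearMap

theorem gsign_apply {M : Type*} [AddCommGroup M] [Module K M] (𝒩 : ℤ → Submodule K M)
    [Decomposition 𝒩] (e d : ℤ) (x : M) (hx : x ∈ 𝒩 d) :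
    gsign 𝒩 e x = (e * d).negOnePow • x := by
  rw [gsign, LinearMap.comp_apply, LinearEquiv.coe_coe, decomposeLinearEquiv_apply,
    decompose_of_mem 𝒩 hx, ← lof_eq_of K, toModule_lof, Units.smul_def]
  rfl

/-- The multilinear map `F` with `F v = F_d v` if each `v i` is homogeneous of degree `d i`. -/
def gradedExt {n : ℕ} (F : (Fin n → ℤ) → MultilinearMap K (fun _ : Fin n => L) P) :
    MultilinearMap K (fun _ : Fin n => L) P :=
  (MultilinearMap.fromDFinsuppEquiv (fun _ : Fin n => ℤ) K
      (fun d => (F d).compLinearMap fun i => (ℒ (d i)).subtype)).compLinearMap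
    fun _ => (decomposeLinearEquiv ℒ).toLinearMap

theorem gradedExt_apply {n : ℕ} (F : (Fin n → ℤ) → MultilinearMap K (fun _ : Fin n => L) P)
    (d : Fin n → ℤ) (v : Fin n → L) (hv : ∀ i, v i ∈ ℒ (d i)) : gradedExt ℒ F v = F d v := by
  have e : (fun i => decomposeLinearEquiv ℒ (v i)) =
      fun i => DFinsupp.single (d i) ⟨v i, hv i⟩ := funext fun i => decompose_of_mem ℒ (hv i)
  rw [gradedExt, MultilinearMap.compLinearMap_apply]
  simp only [LinearEquiv.coe_coe, e]
  exact MultilinearMap.fromDFinsuppEquiv_single (M := fun _ d => ℒ d) _ d _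

theorem ext_homogeneous {n : ℕ} {f g : MultilinearMap K (fun _ : Fin n => L) P}
    (h : ∀ (d : Fin n → ℤ) (v : Fin n → L), (∀ i, v i ∈ ℒ (d i)) → f v = g v) : f = g := by
  have h' : f.compLinearMap (fun _ => (decomposeLinearEquiv ℒ).symm.toLinearMap) =
      g.compLinearMap (fun _ => (decomposeLinearEquiv ℒ).symm.toLinearMap) := by
    apply (MultilinearMap.fromDFinsuppEquiv (fun _ : Fin n => ℤ) K
      (M := fun _ d => ℒ d)).symm.injective
    funext d
    refine MultilinearMap.ext fun x => ?_
    have e : ∀ i, (decomposeLinearEquiv ℒ).symm (DFinsupp.single (d i) (x i)) = x i :=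
      fun i => decompose_symm_of ℒ (x i)
    simpa [e] using h d (fun i => (x i : L)) (fun i => (x i).2)
  refine MultilinearMap.ext fun v => ?_
  have := congrArg (fun F => F fun i => decompose ℒ (v i)) h'
  simpa [decomposeLinearEquiv_symm_apply] using this

/-- The operator multiplying forms `Ω` of degree `c` by `(-1) ^ (e c)`. -/
def twist (e : ℤ) : Cochain K L P →ₗ[K] Cochain K L P where
  toFun Ω n := (gsign ℳ e).compMultilinearMap ((Ω n).compLinearMap fun _ => gsign ℒ e)
  map_add' Ω Ω' := by ext; simp
  map_smul' r Ω := by ext; simp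

theorem negOnePow_smul_smul {M : Type*} [AddCommGroup M] (a b : ℤ) (x : M) :
    a.negOnePow • b.negOnePow • x = (a + b).negOnePow • x := by
  rw [smul_smul, Int.negOnePow_add]

theorem map_negOnePow_smul {M M' : Type*} [AddCommGroup M] [AddCommGroup M'] [Module K M]
    [Module K M'] (f : M →ₗ[K] M') (a : ℤ) (x : M) :
    f (a.negOnePow • x) = a.negOnePow • f x := by
  rw [Units.smul_def, Units.smul_def, map_zsmul]

theorem negOnePow_mul_sum {n : ℕ} (e : ℤ) (d : Fin n → ℤ) :
    (∏ i, (e * d i).negOnePow) = (e * ∑ i, d i).negOnePow := by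
  rw [Finset.mul_sum]
  induction (Finset.univ : Finset (Fin n)) using Finset.induction_on with
  | empty => simp
  | insert a s ha ih => rw [Finset.prod_insert ha, Finset.sum_insert ha, Int.negOnePow_add, ih]

theorem twist_apply {e c : ℤ} {n : ℕ} {Ω : MultilinearMap K (fun _ : Fin n => L) P}
    (hΩ : HasDegree ℒ ℳ c Ω) :
    twist ℒ ℳ e (Pi.single n Ω) = (e * c).negOnePow • Pi.single n Ω := by
  have hz : ∀ m, twist ℒ ℳ e (Pi.single n Ω) m =
      (gsign ℳ e).compMultilinearMap
        (((Pi.single n Ω : Cochain K L P) m).compLinearMap fun _ => gsign ℒ e) := fun _ => rfl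
  funext m
  rw [hz, Pi.smul_apply]
  rcases eq_or_ne m n with rfl | hm
  · rw [Pi.single_eq_same]
    refine ext_homogeneous ℒ fun d v hv => ?_
    have h1 : (fun i => gsign ℒ e (v i)) = fun i => (((e * d i).negOnePow : ℤ) : K) • v i := by
      funext i
      rw [gsign_apply ℒ e (d i) (v i) (hv i), Units.smul_def, Int.cast_smul_eq_zsmul]
    rw [LinearMap.compMultilinearMap_apply, MultilinearMap.compLinearMap_apply, h1,
      MultilinearMap.map_smul_univ, map_smul, gsign_apply ℳ e _ _ (hΩ d v hv),
      ← Int.cast_prod, Int.cast_smul_eq_zsmul, ← Units.coe_prod, negOnePow_mul_sum,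
      ← Units.smul_def, negOnePow_smul_smul, Units.smul_def, Units.smul_def, _root_.smul_apply]
    congr 2
    rw [Int.negOnePow_eq_iff]
    exact ⟨e * ∑ i, d i, by ring⟩
  · rw [Pi.single_eq_of_ne hm]
    ext; simp

variable {𝒜 ℒ ℳ}

/-- The multilinear map `v ↦ ∇(v_I | Ω(v_{Iᶜ}))`. -/
def connTerm (f : (n : ℕ) → MultilinearMap K (fun _ : Fin n => L) (Module.End K P))
    (Ω : Cochain K L P) {n : ℕ} (I : Finset (Fin n)) :
    MultilinearMap K (fun _ : Fin n => L) P :=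
  (MultilinearMap.curryFinFinset K P L (s := I) rfl rfl).symm
    (LinearMap.compMultilinearMap
      { toFun := fun T => T.compMultilinearMap (Ω Iᶜ.card)
        map_add' := fun _ _ => rfl
        map_smul' := fun _ _ => rfl } (f I.card))

/-- The multilinear map `v ↦ Ω(X(v_I), v_{Iᶜ})`. -/
def bracketTerm (f : (n : ℕ) → MultilinearMap K (fun _ : Fin n => L) L)
    (Ω : Cochain K L P) {n : ℕ} (I : Finset (Fin n)) :
    MultilinearMap K (fun _ : Fin n => L) P :=
  (MultilinearMap.curryFinFinset K P L (s := I) rfl rfl).symm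
    ((Ω (Iᶜ.card + 1)).curryLeft.compMultilinearMap (f I.card))

theorem connTerm_apply (f : (n : ℕ) → MultilinearMap K (fun _ : Fin n => L) (Module.End K P))
    (Ω : Cochain K L P) {n : ℕ} (I : Finset (Fin n)) (v : Fin n → L) :
    connTerm f Ω I v = f I.card (sub v I) (Ω Iᶜ.card (sub v Iᶜ)) := by
  rw [connTerm, MultilinearMap.curryFinFinset_symm_apply]
  simp only [finSumEquivOfFinset_inl, finSumEquivOfFinset_inr]
  rfl

theorem bracketTerm_apply (f : (n : ℕ) → MultilinearMap K (fun _ : Fin n => L) L)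
    (Ω : Cochain K L P) {n : ℕ} (I : Finset (Fin n)) (v : Fin n → L) :
    bracketTerm f Ω I v = Ω (Iᶜ.card + 1) (Fin.cons (f I.card (sub v I)) (sub v Iᶜ)) := by
  rw [bracketTerm, MultilinearMap.curryFinFinset_symm_apply]
  simp only [finSumEquivOfFinset_inl, finSumEquivOfFinset_inr]
  rfl

/-- The operator `D_k^∇` with `k = m + 1`:
`(D_k^∇ Ω)(ξ) = ∑_{|I| = k - 1} ± ∇(ξ_I | Ω(ξ_{Iᶜ})) - ∑_{|I| = k} ± Ω(X(ξ_I), ξ_{Iᶜ})`,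
where the signs are the Koszul signs (see `LeftConnection.ceOp_apply`). -/
def LeftConnection.ceOp {X : LRInfinityAlgebra 𝒜 ℒ} (N : LeftConnection X ℳ) (m : ℕ) :
    Cochain K L P →ₗ[K] Cochain K L P where
  toFun Ω n := gradedExt ℒ fun d =>
    (∑ I : Finset (Fin n) with I.card = m,
      (unshuffleSign d I : ℤ) • connTerm N.conn (twist ℒ ℳ (∑ i ∈ I, d i) Ω) I) -
    ∑ I : Finset (Fin n) with I.card = m + 1,
      (unshuffleSign d I : ℤ) • bracketTerm X.bracket (twist ℒ ℳ 1 Ω) I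
  map_add' Ω Ω' := by
    refine funext fun n => ext_homogeneous ℒ fun d v hv => ?_
    rw [Pi.add_apply, _root_.add_apply]
    simp only [gradedExt_apply ℒ _ d v hv, _root_.sub_apply, _root_.sum_apply, _root_.smul_apply,
      connTerm_apply, bracketTerm_apply, map_add, Pi.add_apply, _root_.add_apply, smul_add,
      Finset.sum_add_distrib]
    abel
  map_smul' r Ω := by
    refine funext fun n => ext_homogeneous ℒ fun d v hv => ?_
    rw [Pi.smul_apply, _root_.smul_apply]
    simp only [gradedExt_apply ℒ _ d v hv, _root_.sub_apply, _root_.sum_apply, _root_.smul_apply,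
      connTerm_apply, bracketTerm_apply, map_smul, Pi.smul_apply, smul_sub, Finset.smul_sum,
      RingHom.id_apply, smul_comm r]

/-- The explicit formula for `D_k^∇ Ω`, `k = m + 1`, on an `l`-form `Ω` of degree `c` and
homogeneous `ξ` of degrees `d`. -/
theorem LeftConnection.ceOp_apply {X : LRInfinityAlgebra 𝒜 ℒ} (N : LeftConnection X ℳ) (m : ℕ)
    {c : ℤ} {l n : ℕ} {Ω : MultilinearMap K (fun _ : Fin l => L) P} (hΩ : HasDegree ℒ ℳ c Ω)
    (d : Fin n → ℤ) (ξ : Fin n → L) (hξ : ∀ i, ξ i ∈ ℒ (d i)) :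
    N.ceOp m (Pi.single l Ω) n ξ =
      (∑ I : Finset (Fin n) with I.card = m, unshuffleSign d I • ((∑ i ∈ I, d i) * c).negOnePow •
        N.conn I.card (sub ξ I) ((Pi.single l Ω : Cochain K L P) Iᶜ.card (sub ξ Iᶜ))) -
      ∑ I : Finset (Fin n) with I.card = m + 1, unshuffleSign d I • c.negOnePow •
        (Pi.single l Ω : Cochain K L P) (Iᶜ.card + 1)
          (Fin.cons (X.bracket I.card (sub ξ I)) (sub ξ Iᶜ)) := by
  have h : N.ceOp m (Pi.single l Ω) n ξ = _ := gradedExt_apply ℒ _ d ξ hξ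
  rw [h]
  simp only [_root_.sub_apply, _root_.sum_apply, _root_.smul_apply, connTerm_apply,
    bracketTerm_apply, twist_apply ℒ ℳ hΩ, one_mul, Units.smul_def, Pi.smul_apply, map_zsmul]

variable (𝒜 ℒ ℳ)

theorem homForms_le {n : ℕ} {e : ℤ} {Ω : MultilinearMap K (fun _ : Fin n => L) P}
    (hΩ : Ω ∈ homForms 𝒜 ℒ ℳ n e) : Pi.single n Ω ∈ SymForms 𝒜 ℒ ℳ :=
  Submodule.mem_iSup_of_mem n (Submodule.mem_iSup_of_mem e ⟨Ω, hΩ, rfl⟩)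

theorem SymForms.induction {p : Cochain K L P → Prop} {Ω : Cochain K L P}
    (hΩ : Ω ∈ SymForms 𝒜 ℒ ℳ)
    (single : ∀ (n : ℕ) (e : ℤ) (Ω : MultilinearMap K (fun _ : Fin n => L) P),
      Ω ∈ homForms 𝒜 ℒ ℳ n e → p (Pi.single n Ω))
    (zero : p 0) (add : ∀ Ω Ω', p Ω → p Ω' → p (Ω + Ω')) : p Ω := by
  refine Submodule.iSup_induction _ (motive := p) hΩ (fun n x hx => ?_) zero add
  refine Submodule.iSup_induction _ (motive := p) hx (fun e y hy => ?_) zero add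
  obtain ⟨Ω, h, rfl⟩ := hy
  exact single n e Ω h

/-- The insertion `ξ ↦ (Ω ↦ ± Ω(ξ, …))` of an element of degree `e` of `L`. -/
def contractDeg (e : ℤ) : L →ₗ[K] Cochain K L P →ₗ[K] Cochain K L P :=
  LinearMap.mk₂ K (fun ξ Ω n => (twist ℒ ℳ e Ω (n + 1)).curryLeft ξ)
    (fun ξ ζ Ω => by funext n; simp) (fun r ξ Ω => by funext n; simp)
    (fun ξ Ω Ω' => by funext n; ext; simp) (fun r ξ Ω => by funext n; ext; simp)

/-- The insertion of elements of `L` into forms: `(i_ξ Ω)(ζ) = (-1) ^ (ξ Ω) Ω(ξ, ζ)`. -/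
def contract : L →ₗ[K] Cochain K L P →ₗ[K] Cochain K L P :=
  DirectSum.toModule K ℤ _ (fun e => contractDeg ℒ ℳ e ∘ₗ (ℒ e).subtype) ∘ₗ
    (decomposeLinearEquiv ℒ).toLinearMap

theorem contract_apply {e c : ℤ} {n : ℕ} {Ω : MultilinearMap K (fun _ : Fin (n + 1) => L) P}
    (hΩ : HasDegree ℒ ℳ c Ω) {ξ : L} (hξ : ξ ∈ ℒ e) :
    contract ℒ ℳ ξ (Pi.single (n + 1) Ω) =
      (e * c).negOnePow • Pi.single n (Ω.curryLeft ξ) := by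
  rw [contract, LinearMap.comp_apply, LinearEquiv.coe_coe, decomposeLinearEquiv_apply,
    decompose_of_mem ℒ hξ, ← lof_eq_of K, toModule_lof]
  funext m
  change (twist ℒ ℳ e (Pi.single (n + 1) Ω) (m + 1)).curryLeft ξ = _
  rw [twist_apply ℒ ℳ hΩ, Pi.smul_apply, Pi.smul_apply]
  rcases eq_or_ne m n with rfl | h
  · simp only [Pi.single_eq_same]; rfl
  · rw [Pi.single_eq_of_ne h, Pi.single_eq_of_ne (by omega)]; ext; simp

theorem contract_apply_zero {e : ℤ} {Ω : MultilinearMap K (fun _ : Fin 0 => L) P} {c : ℤ}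
    (hΩ : HasDegree ℒ ℳ c Ω) {ξ : L} (hξ : ξ ∈ ℒ e) :
    contract ℒ ℳ ξ (Pi.single 0 Ω) = 0 := by
  rw [contract, LinearMap.comp_apply, LinearEquiv.coe_coe, decomposeLinearEquiv_apply,
    decompose_of_mem ℒ hξ, ← lof_eq_of K, toModule_lof]
  funext m
  change (twist ℒ ℳ e (Pi.single 0 Ω) (m + 1)).curryLeft ξ = _
  rw [twist_apply ℒ ℳ hΩ, Pi.smul_apply, Pi.single_eq_of_ne (by omega)]
  ext; simp

theorem sum_Iio_zero {n : ℕ} (d : Fin (n + 1) → ℤ) : ∑ j ∈ Finset.Iio 0, d j = 0 :=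
  Finset.sum_eq_zero fun j hj => absurd (Finset.mem_Iio.mp hj) (Fin.not_lt_zero j)

theorem sum_Iio_succ {n : ℕ} (e : ℤ) (d : Fin n → ℤ) (i : Fin n) :
    ∑ j ∈ Finset.Iio i.succ, (Fin.cons e d : Fin (n + 1) → ℤ) j = e + ∑ j ∈ Finset.Iio i, d j := by
  have h : ∀ {m : ℕ} (i : Fin m), Finset.Iio i = Finset.univ.filter (· < i) :=
    fun i => by ext; simp
  rw [h, h, Finset.sum_filter, Finset.sum_filter, Fin.sum_univ_succ]
  simp

theorem permSign_swap {n : ℕ} (d : Fin (n + 2) → ℤ) :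
    permSign d (Equiv.swap 0 1) = (d 1 * d 0).negOnePow := by
  rw [permSign, Finset.prod_eq_single 0, Finset.prod_eq_single 1]
  · simp
  · intro j _ hj
    rw [if_neg]
    rintro ⟨h, h'⟩
    rw [Equiv.swap_apply_left, Equiv.swap_apply_of_ne_of_ne h.ne' hj] at h'
    have : j.val ≠ 1 := fun h => hj (Fin.ext h)
    simp only [Fin.lt_def, Fin.val_zero, Fin.val_one] at h h'
    omega
  · simp
  · intro i _ hi
    refine Finset.prod_eq_one fun j _ => if_neg ?_
    rintro ⟨h, h'⟩
    have hj0 : j ≠ 0 := fun h0 => by simp [h0] at h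
    have hj1 : j ≠ 1 := fun h1 => by
      have : i.val ≠ 0 := fun h => hi (Fin.ext h)
      simp only [h1, Fin.lt_def, Fin.val_one] at h
      omega
    rw [Equiv.swap_apply_of_ne_of_ne hj0 hj1] at h'
    rcases eq_or_ne i 1 with rfl | hi1
    · simp at h'
    · rw [Equiv.swap_apply_of_ne_of_ne hi hi1] at h'
      exact absurd h h'.asymm
  · simp

theorem curryLeft_mem_homForms {e c : ℤ} {n : ℕ}
    {Ω : MultilinearMap K (fun _ : Fin (n + 1) => L) P}
    (hΩ : Ω ∈ homForms 𝒜 ℒ ℳ (n + 1) c) {ξ : L} (hξ : ξ ∈ ℒ e) :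
    Ω.curryLeft ξ ∈ homForms 𝒜 ℒ ℳ n (e + c) := by
  obtain ⟨h1, h2, h3⟩ := hΩ
  have hc : ∀ (d : Fin n → ℤ) (v : Fin n → L), (∀ i, v i ∈ ℒ (d i)) → ∀ i : Fin (n + 1),
      (Fin.cons ξ v : Fin (n + 1) → L) i ∈ ℒ ((Fin.cons e d : Fin (n + 1) → ℤ) i) :=
    fun d v hv i => by refine Fin.cases ?_ (fun i => ?_) i <;> simp [hξ, hv]
  refine ⟨fun d v hv => ?_, fun d v hv σ => ?_, fun d v hv i b a ha => ?_⟩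
  · have := h1 _ _ (hc d v hv)
    rw [Fin.sum_cons] at this
    rw [MultilinearMap.curryLeft_apply]
    convert this using 2
    ring
  · have := h2 _ _ (hc d v hv) (Equiv.Perm.decomposeFin.symm (0, σ))
    rw [MultilinearMap.curryLeft_apply, MultilinearMap.curryLeft_apply]
    convert this using 2
    · funext i
      refine Fin.cases ?_ (fun i => ?_) i <;> simp
    · simp [permSign, Fin.prod_univ_succ]
  · have := h3 _ _ (hc d v hv) i.succ b a ha
    rw [MultilinearMap.curryLeft_apply, MultilinearMap.curryLeft_apply]
    simp only [Fin.cons_succ, ← Fin.cons_update] at this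
    rw [this]
    rw [sum_Iio_succ, add_assoc, add_left_comm]

theorem curryLeft_smul {b e c : ℤ} {n : ℕ}
    {Ω : MultilinearMap K (fun _ : Fin (n + 1) => L) P}
    (hΩ : Ω ∈ homForms 𝒜 ℒ ℳ (n + 1) c) {a : A} (ha : a ∈ 𝒜 b) {ξ : L} (hξ : ξ ∈ ℒ e) :
    Ω.curryLeft (a • ξ) = (c * b).negOnePow • a • Ω.curryLeft ξ := by
  refine ext_homogeneous ℒ fun d v hv => ?_
  have hc : ∀ i : Fin (n + 1),
      (Fin.cons ξ v : Fin (n + 1) → L) i ∈ ℒ ((Fin.cons e d : Fin (n + 1) → ℤ) i) :=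
    fun i => by refine Fin.cases ?_ (fun i => ?_) i <;> simp [hξ, hv]
  have := hΩ.2.2 _ _ hc 0 b a ha
  simpa [Fin.update_cons_zero, sum_Iio_zero] using this

theorem curryLeft_comm {e e' c : ℤ} {n : ℕ}
    {Ω : MultilinearMap K (fun _ : Fin (n + 2) => L) P}
    (hΩ : Ω ∈ homForms 𝒜 ℒ ℳ (n + 2) c) {ξ ζ : L} (hξ : ξ ∈ ℒ e) (hζ : ζ ∈ ℒ e') :
    (Ω.curryLeft ξ).curryLeft ζ = (e * e').negOnePow • (Ω.curryLeft ζ).curryLeft ξ := by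
  refine ext_homogeneous ℒ fun d v hv => ?_
  have hc : ∀ i : Fin (n + 2), (Fin.cons ζ (Fin.cons ξ v : Fin (n + 1) → L) : Fin (n + 2) → L) i ∈
      ℒ ((Fin.cons e' (Fin.cons e d : Fin (n + 1) → ℤ) : Fin (n + 2) → ℤ) i) :=
    fun i => by
      refine Fin.cases ?_ (fun i => ?_) i
      · simpa using hζ
      · refine Fin.cases ?_ (fun i => ?_) i <;> simp [hξ, hv]
  have := hΩ.2.1 _ _ hc (Equiv.swap 0 1)
  rw [permSign_swap] at this
  simp only [MultilinearMap.curryLeft_apply, _root_.smul_apply]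
  rw [show (e * e') = (Fin.cons e' (Fin.cons e d : Fin (n + 1) → ℤ) : Fin (n + 2) → ℤ) 1 *
    (Fin.cons e' (Fin.cons e d : Fin (n + 1) → ℤ) : Fin (n + 2) → ℤ) 0 from rfl, ← this]
  congr 1
  funext i
  refine Fin.cases (by simp) (fun i => ?_) i
  refine Fin.cases (by simp) (fun i => ?_) i
  have h0 : i.succ.succ ≠ 0 := Fin.succ_ne_zero _
  have h1 : i.succ.succ ≠ 1 := fun h => Fin.succ_ne_zero i (Fin.succ_injective _ h)
  rw [Equiv.swap_apply_of_ne_of_ne h0 h1]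
  simp
instance : IsScalarTower K A (Cochain K L P) :=
  ⟨fun r a Ω => by funext n; ext v; exact smul_assoc r a (Ω n v)⟩

theorem smul_mem_homForms [GradedAlgebra 𝒜] [SetLike.GradedSMul 𝒜 ℳ] (hA : GradedComm 𝒜)
    {b c : ℤ} {n : ℕ} {Ω : MultilinearMap K (fun _ : Fin n => L) P}
    (hΩ : Ω ∈ homForms 𝒜 ℒ ℳ n c) {a : A} (ha : a ∈ 𝒜 b) :
    a • Ω ∈ homForms 𝒜 ℒ ℳ n (b + c) := by
  obtain ⟨h1, h2, h3⟩ := hΩ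
  refine ⟨fun d v hv => ?_, fun d v hv σ => ?_, fun d v hv i b' a' ha' => ?_⟩
  · rw [_root_.smul_apply, add_assoc]
    exact SetLike.GradedSMul.smul_mem ha (h1 d v hv)
  · rw [_root_.smul_apply, _root_.smul_apply, h2 d v hv σ, smul_comm]
  · rw [_root_.smul_apply, _root_.smul_apply, h3 d v hv i b' a' ha', smul_comm a,
      smul_smul a a', hA b' b a' ha' a ha, smul_assoc, negOnePow_smul_smul, smul_smul a' a]
    congr 2
    ring

theorem smul_mem_symForms [GradedAlgebra 𝒜] [SetLike.GradedSMul 𝒜 ℳ] (hA : GradedComm 𝒜)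
    (a : A) {Ω : Cochain K L P} (hΩ : Ω ∈ SymForms 𝒜 ℒ ℳ) : a • Ω ∈ SymForms 𝒜 ℒ ℳ := by
  induction a using DirectSum.Decomposition.inductionOn 𝒜 with
  | zero => rw [zero_smul]; exact zero_mem _
  | add a b ha hb => rw [add_smul]; exact add_mem ha hb
  | @homogeneous b a =>
    refine SymForms.induction 𝒜 ℒ ℳ (p := fun Ω => (a : A) • Ω ∈ SymForms 𝒜 ℒ ℳ) hΩ
      (fun n e Ω h => ?_) (by simp) fun Ω Ω' h h' => by rw [smul_add]; exact add_mem h h'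
    rw [← Pi.single_smul]
    exact homForms_le 𝒜 ℒ ℳ (smul_mem_homForms 𝒜 ℒ ℳ hA h a.2)

theorem contract_mem_symForms (ξ : L) {Ω : Cochain K L P} (hΩ : Ω ∈ SymForms 𝒜 ℒ ℳ) :
    contract ℒ ℳ ξ Ω ∈ SymForms 𝒜 ℒ ℳ := by
  induction ξ using DirectSum.Decomposition.inductionOn ℒ with
  | zero => rw [map_zero]; exact zero_mem _
  | add a b ha hb => rw [map_add]; exact add_mem ha hb
  | @homogeneous b ξ =>
    refine SymForms.induction 𝒜 ℒ ℳ (p := fun Ω => contract ℒ ℳ ξ Ω ∈ SymForms 𝒜 ℒ ℳ) hΩ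
      (fun n e Ω h => ?_) (by simp) fun Ω Ω' h h' => by rw [map_add]; exact add_mem h h'
    cases n with
    | zero => rw [contract_apply_zero ℒ ℳ h.1 ξ.2]; exact zero_mem _
    | succ n =>
      rw [contract_apply ℒ ℳ h.1 ξ.2, Units.smul_def]
      exact zsmul_mem (homForms_le 𝒜 ℒ ℳ (curryLeft_mem_homForms 𝒜 ℒ ℳ h ξ.2)) _

/-- The multiplication of forms by elements of `A`. -/
def scalarOp [GradedAlgebra 𝒜] [SetLike.GradedSMul 𝒜 ℳ] (hA : GradedComm 𝒜) :
    A →ₐ[K] Module.End K (SymForms 𝒜 ℒ ℳ) :=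
  AlgHom.ofLinearMap
    { toFun := fun a => (Algebra.lsmul K K (Cochain K L P) a).restrict
        fun _ hΩ => smul_mem_symForms 𝒜 ℒ ℳ hA a hΩ
      map_add' := fun a b => by ext Ω : 2; exact add_smul a b Ω.1
      map_smul' := fun r a => by ext Ω : 2; exact smul_assoc r a Ω.1 }
    (by ext Ω : 2; exact one_smul A Ω.1)
    (fun a b => by ext Ω : 2; exact mul_smul a b Ω.1)

/-- The insertion of elements of `L` into symmetric forms. -/
def vectorOp : L →ₗ[K] Module.End K (SymForms 𝒜 ℒ ℳ) where
  toFun ξ := (contract ℒ ℳ ξ).restrict fun _ hΩ => contract_mem_symForms 𝒜 ℒ ℳ ξ hΩ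
  map_add' ξ ζ := by ext Ω : 2; simp
  map_smul' r ξ := by ext Ω : 2; simp

theorem vectorOp_coe (ξ : L) (Ω : SymForms 𝒜 ℒ ℳ) :
    (vectorOp 𝒜 ℒ ℳ ξ Ω : Cochain K L P) = contract ℒ ℳ ξ Ω := rfl

theorem scalarOp_coe [GradedAlgebra 𝒜] [SetLike.GradedSMul 𝒜 ℳ] (hA : GradedComm 𝒜)
    (a : A) (Ω : SymForms 𝒜 ℒ ℳ) :
    (scalarOp 𝒜 ℒ ℳ hA a Ω : Cochain K L P) = a • (Ω : Cochain K L P) := rfl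

theorem SymForms.end_ext {S T : Module.End K (SymForms 𝒜 ℒ ℳ)}
    (h : ∀ (n : ℕ) (e : ℤ) (Ω : MultilinearMap K (fun _ : Fin n => L) P)
      (hΩ : Ω ∈ homForms 𝒜 ℒ ℳ n e),
      (S ⟨Pi.single n Ω, homForms_le 𝒜 ℒ ℳ hΩ⟩ : Cochain K L P) =
        T ⟨Pi.single n Ω, homForms_le 𝒜 ℒ ℳ hΩ⟩) : S = T := by
  have key : ∀ Ω, Ω ∈ SymForms 𝒜 ℒ ℳ → ∃ h : Ω ∈ SymForms 𝒜 ℒ ℳ, S ⟨Ω, h⟩ = T ⟨Ω, h⟩ := by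
    intro Ω hΩ
    refine SymForms.induction 𝒜 ℒ ℳ
      (p := fun Ω => ∃ h : Ω ∈ SymForms 𝒜 ℒ ℳ, S ⟨Ω, h⟩ = T ⟨Ω, h⟩) hΩ
      (fun n e Ω hΩ => ?_) ?_ ?_
    · exact ⟨_, Subtype.ext (h n e Ω hΩ)⟩
    · exact ⟨zero_mem _, (map_zero S).trans (map_zero T).symm⟩
    · rintro Ω Ω' ⟨h1, h2⟩ ⟨h1', h2'⟩
      refine ⟨add_mem h1 h1', ?_⟩
      have := (map_add S ⟨Ω, h1⟩ ⟨Ω', h1'⟩).trans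
        ((congrArg₂ (· + ·) h2 h2').trans (map_add T ⟨Ω, h1⟩ ⟨Ω', h1'⟩).symm)
      exact this
  exact LinearMap.ext fun Ω => (key Ω.1 Ω.2).2

theorem single_smul (n : ℕ) (a : A) (Ω : MultilinearMap K (fun _ : Fin n => L) P) :
    (Pi.single n (a • Ω) : Cochain K L P) = a • Pi.single n Ω := by
  funext m
  rcases eq_or_ne m n with rfl | h
  · rw [Pi.smul_apply, Pi.single_eq_same, Pi.single_eq_same]
  · rw [Pi.smul_apply, Pi.single_eq_of_ne h, Pi.single_eq_of_ne h, smul_zero]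

theorem single_negOnePow_smul (n : ℕ) (e : ℤ) (Ω : MultilinearMap K (fun _ : Fin n => L) P) :
    (Pi.single n (e.negOnePow • Ω) : Cochain K L P) = e.negOnePow • Pi.single n Ω :=
  by
  funext m
  rcases eq_or_ne m n with rfl | h
  · rw [Pi.smul_apply, Pi.single_eq_same, Pi.single_eq_same]
  · rw [Pi.smul_apply, Pi.single_eq_of_ne h, Pi.single_eq_of_ne h, smul_zero]

theorem negOnePow_smul_eq {M : Type*} [AddCommGroup M] {a b : ℤ} (h : Even (a - b)) (x : M) :
    a.negOnePow • x = b.negOnePow • x := by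
  rw [(Int.negOnePow_eq_iff a b).mpr h]

theorem contract_negOnePow_smul (ξ : L) (e : ℤ) (Ω : Cochain K L P) :
    contract ℒ ℳ ξ (e.negOnePow • Ω) = e.negOnePow • contract ℒ ℳ ξ Ω :=
  map_negOnePow_smul _ _ _

theorem vectorOp_smul [GradedAlgebra 𝒜] [SetLike.GradedSMul 𝒜 ℒ] [SetLike.GradedSMul 𝒜 ℳ]
    (hA : GradedComm 𝒜) (a : A) (ξ : L) :
    vectorOp 𝒜 ℒ ℳ (a • ξ) = scalarOp 𝒜 ℒ ℳ hA a * vectorOp 𝒜 ℒ ℳ ξ := by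
  induction a using DirectSum.Decomposition.inductionOn 𝒜 with
  | zero => simp
  | add a b ha hb => rw [add_smul, map_add, ha, hb, map_add, add_mul]
  | @homogeneous b a =>
    induction ξ using DirectSum.Decomposition.inductionOn ℒ with
    | zero => simp
    | add ξ ζ hξ hζ => rw [smul_add, map_add, hξ, hζ, map_add, mul_add]
    | @homogeneous c ξ =>
      refine SymForms.end_ext 𝒜 ℒ ℳ fun n e Ω hΩ => ?_
      rw [Module.End.mul_apply, scalarOp_coe, vectorOp_coe, vectorOp_coe]
      have haξ : (a : A) • (ξ : L) ∈ ℒ (b + c) := SetLike.GradedSMul.smul_mem a.2 ξ.2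
      cases n with
      | zero => rw [contract_apply_zero ℒ ℳ hΩ.1 ξ.2, contract_apply_zero ℒ ℳ hΩ.1 haξ, smul_zero]
      | succ n =>
        rw [contract_apply ℒ ℳ hΩ.1 ξ.2, contract_apply ℒ ℳ hΩ.1 haξ,
          curryLeft_smul 𝒜 ℒ ℳ hΩ a.2 ξ.2, smul_comm (a : A), single_negOnePow_smul,
          negOnePow_smul_smul, single_smul]
        exact negOnePow_smul_eq ⟨b * e, by ring⟩ _

theorem vectorOp_mul_scalarOp [GradedAlgebra 𝒜] [SetLike.GradedSMul 𝒜 ℳ]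
    (hA : GradedComm 𝒜) {b c : ℤ} {a : A} {ξ : L} (ha : a ∈ 𝒜 b) (hξ : ξ ∈ ℒ c) :
    vectorOp 𝒜 ℒ ℳ ξ * scalarOp 𝒜 ℒ ℳ hA a =
      (b * c).negOnePow • (scalarOp 𝒜 ℒ ℳ hA a * vectorOp 𝒜 ℒ ℳ ξ) := by
  refine SymForms.end_ext 𝒜 ℒ ℳ fun n e Ω hΩ => ?_
  have h : (((b * c).negOnePow • (scalarOp 𝒜 ℒ ℳ hA a * vectorOp 𝒜 ℒ ℳ ξ))
      ⟨Pi.single n Ω, homForms_le 𝒜 ℒ ℳ hΩ⟩ : Cochain K L P) =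
      (b * c).negOnePow • a • contract ℒ ℳ ξ (Pi.single n Ω) := rfl
  rw [h, Module.End.mul_apply, vectorOp_coe, scalarOp_coe, ← Pi.single_smul]
  have haΩ := smul_mem_homForms 𝒜 ℒ ℳ hA hΩ ha
  cases n with
  | zero => rw [contract_apply_zero ℒ ℳ hΩ.1 hξ, contract_apply_zero ℒ ℳ haΩ.1 hξ]; simp
  | succ n =>
    rw [contract_apply ℒ ℳ hΩ.1 hξ, contract_apply ℒ ℳ haΩ.1 hξ, smul_comm a,
      negOnePow_smul_smul, mul_add, mul_comm c b, ← single_smul]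
    rfl

theorem vectorOp_comm {b c : ℤ} {ξ ζ : L} (hξ : ξ ∈ ℒ b) (hζ : ζ ∈ ℒ c) :
    vectorOp 𝒜 ℒ ℳ ξ * vectorOp 𝒜 ℒ ℳ ζ =
      (b * c).negOnePow • (vectorOp 𝒜 ℒ ℳ ζ * vectorOp 𝒜 ℒ ℳ ξ) := by
  refine SymForms.end_ext 𝒜 ℒ ℳ fun n e Ω hΩ => ?_
  have h : (((b * c).negOnePow • (vectorOp 𝒜 ℒ ℳ ζ * vectorOp 𝒜 ℒ ℳ ξ))
      ⟨Pi.single n Ω, homForms_le 𝒜 ℒ ℳ hΩ⟩ : Cochain K L P) =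
      (b * c).negOnePow • contract ℒ ℳ ζ (contract ℒ ℳ ξ (Pi.single n Ω)) := rfl
  rw [h, Module.End.mul_apply, vectorOp_coe, vectorOp_coe]
  match n, Ω, hΩ with
  | 0, Ω, hΩ => rw [contract_apply_zero ℒ ℳ hΩ.1 hξ, contract_apply_zero ℒ ℳ hΩ.1 hζ]; simp
  | 1, Ω, hΩ =>
    rw [contract_apply ℒ ℳ hΩ.1 hξ, contract_apply ℒ ℳ hΩ.1 hζ, contract_negOnePow_smul,
      contract_negOnePow_smul,
      contract_apply_zero ℒ ℳ (curryLeft_mem_homForms 𝒜 ℒ ℳ hΩ hξ).1 hζ,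
      contract_apply_zero ℒ ℳ (curryLeft_mem_homForms 𝒜 ℒ ℳ hΩ hζ).1 hξ]
    simp
  | n + 2, Ω, hΩ =>
    rw [contract_apply ℒ ℳ hΩ.1 hξ, contract_apply ℒ ℳ hΩ.1 hζ, contract_negOnePow_smul,
      contract_negOnePow_smul,
      contract_apply ℒ ℳ (curryLeft_mem_homForms 𝒜 ℒ ℳ hΩ hξ).1 hζ,
      contract_apply ℒ ℳ (curryLeft_mem_homForms 𝒜 ℒ ℳ hΩ hζ).1 hξ,
      curryLeft_comm 𝒜 ℒ ℳ hΩ hζ hξ]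
    rw [single_negOnePow_smul, negOnePow_smul_smul, negOnePow_smul_smul, negOnePow_smul_smul,
      negOnePow_smul_smul]
    congr 2
    ring

/-- The `S_A^• L`-module structure `u ↦ i_u` of `Sym_A(L, P)`: the algebra homomorphism with
`i_a Ω = a Ω` for `a ∈ A` and `(i_ξ Ω)(ζ) = (-1) ^ (ξ Ω) Ω(ξ, ζ)` for `ξ ∈ L`. -/
def ins [GradedAlgebra 𝒜] [SetLike.GradedSMul 𝒜 ℒ] [SetLike.GradedSMul 𝒜 ℳ]
    (hA : GradedComm 𝒜) : SymAlg 𝒜 ℒ →ₐ[K] Module.End K (SymForms 𝒜 ℒ ℳ) :=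
  RingQuot.liftAlgHom K ⟨TensorAlgebra.lift K
    ((scalarOp 𝒜 ℒ ℳ hA).toLinearMap.coprod (vectorOp 𝒜 ℒ ℳ)), by
    have hz : ∀ (e : ℤ) (x : TensorAlgebra K (A × L)), TensorAlgebra.lift K
        ((scalarOp 𝒜 ℒ ℳ hA).toLinearMap.coprod (vectorOp 𝒜 ℒ ℳ)) (e.negOnePow • x) =
        e.negOnePow • TensorAlgebra.lift K
          ((scalarOp 𝒜 ℒ ℳ hA).toLinearMap.coprod (vectorOp 𝒜 ℒ ℳ)) x :=
      fun e x => by rw [Units.smul_def, Units.smul_def, map_zsmul]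
    rintro _ _ (_ | ⟨a, b⟩ | ⟨a, ξ⟩ | ⟨b, c, a, ξ, ha, hξ⟩ | ⟨b, c, ξ, ζ, hξ, hζ⟩)
    · simp
    · simp
    · simpa using vectorOp_smul 𝒜 ℒ ℳ hA a ξ
    · simpa [hz] using vectorOp_mul_scalarOp 𝒜 ℒ ℳ hA ha hξ
    · simpa [hz] using vectorOp_comm 𝒜 ℒ ℳ hξ hζ⟩

/-- The operator `D_k^∇`, `k = m + 1`, on `Sym_A(L, P)`, given that the formula for it maps
symmetric forms to symmetric forms. -/
def LeftConnection.ce {𝒜 : ℤ → Submodule K A} {ℒ : ℤ → Submodule K L} {ℳ : ℤ → Submodule K P}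
    [Decomposition ℒ] [Decomposition ℳ] {X : LRInfinityAlgebra 𝒜 ℒ} (N : LeftConnection X ℳ)
    (h : ∀ m, ∀ Ω ∈ SymForms 𝒜 ℒ ℳ, N.ceOp m Ω ∈ SymForms 𝒜 ℒ ℳ) (m : ℕ) :
    Module.End K (SymForms 𝒜 ℒ ℳ) :=
  (N.ceOp m).restrict (h m)

end Forms

section Commutators

variable {K W : Type*} [Field K] [AddCommGroup W] [Module K W]

/-- The graded commutator `[S, T] = S T - (-1) ^ (p q) T S` of operators of degrees `p`, `q`. -/
def gradedComm (p q : ℤ) (S T : Module.End K W) : Module.End K W :=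
  S * T - (p * q).negOnePow • (T * S)

/-- The nested graded commutator `[⋯[[T, U 0], U 1], ⋯, U (n - 1)]`, where `T` is of degree `e` and
`U i` of degree `d i`. -/
def nestedComm : {n : ℕ} → ℤ → Module.End K W → (Fin n → ℤ) → (Fin n → Module.End K W) →
    Module.End K W
  | 0, _, T, _, _ => T
  | _ + 1, e, T, d, U =>
    nestedComm (e + d 0) (gradedComm e (d 0) T (U 0)) (fun i => d i.succ) (fun i => U i.succ)

/-- The component `𝒥_k = ½ ∑_{i + j = k + 1} [D_i, D_j]`, `k = n + 1`, of `½[D, D]`, where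
`D = D_1 + D_2 + ⋯` is of degree `1` and the operator `D_k` is the term `D (k - 1)`. -/
def halfSquare (D : ℕ → Module.End K W) (n : ℕ) : Module.End K W :=
  (1 / 2 : K) • ∑ p ∈ Finset.HasAntidiagonal.antidiagonal n, gradedComm 1 1 (D p.1) (D p.2)

end Commutators

end SHLR

set_option linter.unusedSectionVars false

namespace SHLR

open DirectSum

/-! ### Sums over unshuffles as recursions on lists; graded symmetry of functions of lists. -/

section Shuffles

variable {V M N : Type*} [AddCommGroup M] [AddCommGroup N]

/-! Arguments are kept as lists of pairs (degree, element). A sum over unshuffles becomes the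
recursion `shuf`, in which the head of the list goes to the first or to the second block
(`sum_unshuffleSign`), and graded symmetry becomes a rule for adjacent transpositions (`LSymm`).
Sign checks then reduce to parity identities in the degrees.

The extension `Λ`. Write `S` for the graded symmetric algebra. A graded symmetric multiderivation of
`S` is determined by its values on generators (`IsMultiDer.ext`), whence uniqueness. For existence,
a multiderivation with `n + 1` entries is a derivation of `S` with values in multiderivations with
`n` entries. A derivation `S → M` is the off-diagonal part of an algebra map `S → End (S × M)`, so
the universal property of `S` allows it to be prescribed on `A` and `L`
(`IsSymAlg.exists_derivation`); induction on `n` gives `IsSymAlg.exists_isDerMap`. The axioms of an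
`LR_∞[1]` algebra are what makes brackets and anchors admissible values (`isGenDer_genBracket`). The
Jacobiator of a multiderivation of degree `1` is again a multiderivation (`isMultiDer_jacobiator`),
so it is enough that it vanishes on generators: without scalars this is the Jacobi identity of the
brackets, with one scalar that of the anchors, and with two scalars each term is zero
(`IsExtension.jacobiator_eq_zero`).

The operators on forms. In `D_k (a-multiple)` the Leibniz rule of the connection and that of the
bracket produce the same anchor term, with opposite signs, so `D_k` preserves `A`-linear forms
(`LeftConnection.ceForm_cons_smul`). Since `u ↦ i_u` is an algebra map and insertions commute in the
graded sense, the nested commutators of any operator with insertions form a multiderivation along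
this map (`isMultiDer_ncl`). Commuting `D_k` with `i_ξ` places `ξ` into the connection and into the
bracket; commuting it with a scalar leaves only the anchor (`IsCE.vectorOp`, `IsCE.scalarOp`). So
`k` nested commutators of `D_k` with generators give `±i` of the bracket of these generators, and
then the same holds for all tensors (`LeftConnection.ncl_ce_eq`).

This one identity, recorded in `GeneratesBracket`, implies the rest formally. Expanding the last
commutator gives the rule for `i_u Ω`; the multiderivation property gives the rule for a product `u
u_1`. For the curvature, the nested commutators of `D_p D_q` are sums over splittings of the entries
into `a` and `b` (`ncl_mul`). Too many entries on one factor give zero, so only `p = |a|`, which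
yields the composition of two Lie derivatives, and `p = |a| ± 1` survive; the latter two contain `i`
of a bracket on the right or on the left and together make up the Lie derivative along that bracket
(`GeneratesBracket.ncl_halfSquare`). -/

/-- The total degree of a list of elements with degrees. -/
def ldeg (l : List (ℤ × V)) : ℤ := (l.map Prod.fst).sum

@[simp] theorem ldeg_nil : ldeg ([] : List (ℤ × V)) = 0 := rfl

@[simp] theorem ldeg_cons (x : ℤ × V) (l : List (ℤ × V)) : ldeg (x :: l) = x.1 + ldeg l := by
  simp [ldeg]

@[simp] theorem ldeg_append (l l' : List (ℤ × V)) : ldeg (l ++ l') = ldeg l + ldeg l' := by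
  simp [ldeg]

theorem ldeg_ofFn {n : ℕ} (w : Fin n → ℤ × V) : ldeg (List.ofFn w) = ∑ i, (w i).1 := by
  rw [ldeg, List.map_ofFn, List.sum_ofFn]; rfl

/-- The sum of `± f a b` over all ways to split the list `l` into two sublists `a` and `b`, with
the Koszul signs. -/
def shuf : (l : List (ℤ × V)) → (f : List (ℤ × V) → List (ℤ × V) → M) → M
  | [], f => f [] []
  | x :: l, f => shuf l (fun a b => f (x :: a) b) +
      shuf l fun a b => (x.1 * ldeg a).negOnePow • f a (x :: b)

theorem shuf_nil (f : List (ℤ × V) → List (ℤ × V) → M) : shuf [] f = f [] [] := rfl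

theorem shuf_cons (x : ℤ × V) (l : List (ℤ × V)) (f : List (ℤ × V) → List (ℤ × V) → M) :
    shuf (x :: l) f = shuf l (fun a b => f (x :: a) b) +
      shuf l fun a b => (x.1 * ldeg a).negOnePow • f a (x :: b) := rfl

/-- Inclusion carries homogeneity over to the two blocks; additivity of degrees and lengths is what
sign and arity computations need. The splittings themselves are not required. -/
theorem shuf_congr {l : List (ℤ × V)} {f g : List (ℤ × V) → List (ℤ × V) → M}
    (h : ∀ a b, a ⊆ l → b ⊆ l → ldeg a + ldeg b = ldeg l → a.length + b.length = l.length →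
      f a b = g a b) : shuf l f = shuf l g := by
  induction l generalizing f g with
  | nil => exact h [] [] (by simp) (by simp) (by simp) rfl
  | cons x l ih =>
    rw [shuf_cons, shuf_cons]
    congr 1
    · refine ih fun a b ha hb hd hl => h _ _ ?_ ?_ ?_ ?_
      · exact List.cons_subset_cons x ha
      · exact List.subset_cons_of_subset x hb
      · simp only [ldeg_cons]; omega
      · simp only [List.length_cons]; omega
    · refine ih fun a b ha hb hd hl => ?_
      rw [h a (x :: b) (List.subset_cons_of_subset x ha) (List.cons_subset_cons x hb)
        (by simp only [ldeg_cons]; omega) (by simp only [List.length_cons]; omega)]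

theorem shuf_add (l : List (ℤ × V)) (f g : List (ℤ × V) → List (ℤ × V) → M) :
    shuf l (fun a b => f a b + g a b) = shuf l f + shuf l g := by
  induction l generalizing f g with
  | nil => rfl
  | cons x l ih =>
    simp only [shuf_cons, smul_add, ih]
    abel

theorem map_shuf {F : Type*} [FunLike F M N] [AddMonoidHomClass F M N] (φ : F)
    (l : List (ℤ × V)) (f : List (ℤ × V) → List (ℤ × V) → M) :
    φ (shuf l f) = shuf l fun a b => φ (f a b) := by
  induction l generalizing f with
  | nil => rfl
  | cons x l ih =>
    simp only [shuf_cons, map_add, ih, Units.smul_def, map_zsmul]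

theorem shuf_negOnePow_smul (l : List (ℤ × V)) (e : ℤ)
    (f : List (ℤ × V) → List (ℤ × V) → M) :
    shuf l (fun a b => e.negOnePow • f a b) = e.negOnePow • shuf l f :=
  (map_shuf (DistribSMul.toAddMonoidHom M e.negOnePow) l f).symm

theorem shuf_neg (l : List (ℤ × V)) (f : List (ℤ × V) → List (ℤ × V) → M) :
    shuf l (fun a b => -f a b) = -shuf l f :=
  (map_shuf (negAddMonoidHom : M →+ M) l f).symm

theorem shuf_sub (l : List (ℤ × V)) (f g : List (ℤ × V) → List (ℤ × V) → M) :
    shuf l (fun a b => f a b - g a b) = shuf l f - shuf l g := by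
  simp only [sub_eq_add_neg, shuf_add, shuf_neg]

@[simp] theorem shuf_zero (l : List (ℤ × V)) : shuf l (fun _ _ => (0 : M)) = 0 := by
  induction l with
  | nil => rfl
  | cons x l ih => simp [shuf_cons, ih]

theorem shuf_eq_zero {l : List (ℤ × V)} {f : List (ℤ × V) → List (ℤ × V) → M}
    (h : ∀ a b, a ⊆ l → b ⊆ l → ldeg a + ldeg b = ldeg l → a.length + b.length = l.length →
      f a b = 0) : shuf l f = 0 :=
  (shuf_congr h).trans (shuf_zero l)

theorem shuf_finsetSum {ι : Type*} (s : Finset ι) (l : List (ℤ × V))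
    (f : ι → List (ℤ × V) → List (ℤ × V) → M) :
    shuf l (fun a b => ∑ i ∈ s, f i a b) = ∑ i ∈ s, shuf l (f i) := by
  classical
  induction s using Finset.induction_on with
  | empty => simp
  | insert i s hi ih => simp only [Finset.sum_insert hi, shuf_add, ih]

/-- Complementary splittings differ by the Koszul sign of moving one whole block past the other. -/
theorem shuf_comm (l : List (ℤ × V)) (f : List (ℤ × V) → List (ℤ × V) → M) :
    shuf l f = shuf l fun a b => (ldeg a * ldeg b).negOnePow • f b a := by
  induction l generalizing f with
  | nil => simp [shuf_nil]
  | cons x l ih =>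
    rw [shuf_cons, shuf_cons, add_comm, ih, ih fun a b => f (x :: a) b]
    congr 1 <;> refine shuf_congr fun a b _ _ _ _ => ?_ <;>
      simp only [negOnePow_smul_smul, ldeg_cons] <;> apply negOnePow_smul_eq <;>
      simp only [parity_simps] <;> grind

/-- Only the splitting with empty second part contributes. -/
theorem shuf_of_right_nil {l : List (ℤ × V)} {f : List (ℤ × V) → List (ℤ × V) → M}
    (h : ∀ a b, b ⊆ l → b ≠ [] → f a b = 0) : shuf l f = f l [] := by
  induction l generalizing f with
  | nil => rfl
  | cons x l ih =>
    rw [shuf_cons, ih fun a b hb hb' => h _ _ (List.subset_cons_of_subset x hb) hb',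
      shuf_eq_zero, add_zero]
    intro a b _ hb _ _
    rw [h _ _ (List.cons_subset_cons x hb) (by simp), smul_zero]

/-- Only the splitting with empty first part contributes. -/
theorem shuf_of_left_nil {l : List (ℤ × V)} {f : List (ℤ × V) → List (ℤ × V) → M}
    (h : ∀ a b, a ⊆ l → a ≠ [] → f a b = 0) : shuf l f = f [] l := by
  rw [shuf_comm, shuf_of_right_nil]
  · simp
  · intro a b hb hb'
    rw [h _ _ hb hb', smul_zero]

/-- A function of lists that is symmetric up to Koszul signs on lists with entries in `Hm`. -/
def LSymm (Hm : Set (ℤ × V)) (F : List (ℤ × V) → M) : Prop :=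
  ∀ pre x y post, (∀ p ∈ pre ++ x :: y :: post, p ∈ Hm) →
    F (pre ++ x :: y :: post) = (x.1 * y.1).negOnePow • F (pre ++ y :: x :: post)

namespace LSymm

variable {Hm : Set (ℤ × V)} {F : List (ℤ × V) → M}

theorem cons (hF : LSymm Hm F) {x : ℤ × V} (hx : x ∈ Hm) : LSymm Hm fun l => F (x :: l) :=
  fun pre y z post h => hF (x :: pre) y z post (by
    rw [List.cons_append, List.forall_mem_cons]; exact ⟨hx, h⟩)

theorem swap (hF : LSymm Hm F) {x y : ℤ × V} {l : List (ℤ × V)} (hx : x ∈ Hm) (hy : y ∈ Hm)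
    (hl : ∀ p ∈ l, p ∈ Hm) : F (x :: y :: l) = (x.1 * y.1).negOnePow • F (y :: x :: l) :=
  hF [] x y l (by simpa using ⟨hx, hy, fun a b => hl (a, b)⟩)

/-- An adjacent transposition either fixes the first entry or exchanges the first two. -/
theorem of_cons (h : ∀ x ∈ Hm, LSymm Hm fun l => F (x :: l))
    (h2 : ∀ x ∈ Hm, ∀ y ∈ Hm, ∀ l : List (ℤ × V), (∀ p ∈ l, p ∈ Hm) →
      F (x :: y :: l) = (x.1 * y.1).negOnePow • F (y :: x :: l)) : LSymm Hm F := by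
  intro pre x y post hp
  cases pre with
  | nil =>
    rw [List.nil_append, List.forall_mem_cons, List.forall_mem_cons] at hp
    exact h2 x hp.1 y hp.2.1 post hp.2.2
  | cons z pre =>
    rw [List.cons_append, List.forall_mem_cons] at hp
    exact h z hp.1 pre x y post hp.2

theorem move_front (hF : LSymm Hm F) (pre : List (ℤ × V)) (x : ℤ × V) (post : List (ℤ × V))
    (h : ∀ p ∈ pre ++ x :: post, p ∈ Hm) :
    F (pre ++ x :: post) = (x.1 * ldeg pre).negOnePow • F (x :: (pre ++ post)) := by
  induction pre generalizing F with
  | nil => simp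
  | cons y pre ih =>
    rw [List.cons_append, List.forall_mem_cons] at h
    have hx : x ∈ Hm := h.2 x (by simp)
    have h' : ∀ p ∈ pre ++ post, p ∈ Hm := fun p hp => h.2 p (by
      simp only [List.mem_append, List.mem_cons] at hp ⊢; tauto)
    rw [List.cons_append, ih (hF.cons h.1) h.2, hF.swap h.1 hx h', negOnePow_smul_smul, ldeg_cons]
    apply negOnePow_smul_eq
    simp only [parity_simps]; grind

theorem concat (hF : LSymm Hm F) (l : List (ℤ × V)) (x : ℤ × V) (h : ∀ p ∈ l ++ [x], p ∈ Hm) :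
    F (l ++ [x]) = (x.1 * ldeg l).negOnePow • F (x :: l) := by
  rw [hF.move_front l x [] h, List.append_nil]

theorem cons_eq (hF : LSymm Hm F) {l : List (ℤ × V)} {x : ℤ × V} (hx : x ∈ Hm)
    (h : ∀ p ∈ l, p ∈ Hm) : F (x :: l) = (x.1 * ldeg l).negOnePow • F (l ++ [x]) := by
  rw [hF.concat l x (by simpa [or_imp, forall_and] using ⟨fun a b => h (a, b), hx⟩),
    negOnePow_smul_smul, ← two_mul, Int.negOnePow_two_mul, one_smul]

/-- Permuting a list changes all symmetric functions by the same sign. -/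
theorem perm {l l' : List (ℤ × V)} (h : l.Perm l') (hl : ∀ p ∈ l, p ∈ Hm) :
    ∃ s : ℤˣ, ∀ F : List (ℤ × V) → M, LSymm Hm F → F l = s • F l' := by
  induction h with
  | nil => exact ⟨1, fun F _ => (one_smul _ _).symm⟩
  | cons x h ih =>
    rw [List.forall_mem_cons] at hl
    obtain ⟨s, hs⟩ := ih hl.2
    exact ⟨s, fun F hF => hs _ (hF.cons hl.1)⟩
  | swap x y l =>
    rw [List.forall_mem_cons, List.forall_mem_cons] at hl
    exact ⟨_, fun F hF => hF.swap hl.1 hl.2.1 hl.2.2⟩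
  | trans h1 _ ih1 ih2 =>
    obtain ⟨s, hs⟩ := ih1 hl
    obtain ⟨t, ht⟩ := ih2 fun p hp => hl p (h1.mem_iff.mpr hp)
    exact ⟨s * t, fun F hF => by rw [hs F hF, ht F hF, mul_smul]⟩

/-- The sign of a reordering depends on the entries only and not on the function, so two symmetric
functions may be compared after any reordering. -/
theorem eq_of_perm {G : List (ℤ × V) → M} (hF : LSymm Hm F) (hG : LSymm Hm G)
    {l l' : List (ℤ × V)} (h : l.Perm l') (hl : ∀ p ∈ l, p ∈ Hm) (h' : F l' = G l') :
    F l = G l := by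
  obtain ⟨s, hs⟩ := perm (M := M) h hl
  rw [hs F hF, hs G hG, h']

theorem zero : LSymm Hm fun _ => (0 : M) := fun _ _ _ _ _ => (smul_zero _).symm

theorem add {G : List (ℤ × V) → M} (hF : LSymm Hm F) (hG : LSymm Hm G) :
    LSymm Hm fun l => F l + G l :=
  fun pre x y post h => by simp only [hF pre x y post h, hG pre x y post h, smul_add]

theorem map {Φ : Type*} [FunLike Φ M N] [AddMonoidHomClass Φ M N] (φ : Φ) (hF : LSymm Hm F) :
    LSymm Hm fun l => φ (F l) :=
  fun pre x y post h => by simp only [hF pre x y post h, Units.smul_def, map_zsmul]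

theorem sub {G : List (ℤ × V) → M} (hF : LSymm Hm F) (hG : LSymm Hm G) :
    LSymm Hm fun l => F l - G l :=
  fun pre x y post h => by simp only [hF pre x y post h, hG pre x y post h, smul_sub]

theorem comap {W : Type*} {Hm' : Set (ℤ × W)} {G : List (ℤ × W) → M} (hG : LSymm Hm' G)
    (j : V → W) (hj : ∀ x ∈ Hm, (x.1, j x.2) ∈ Hm') :
    LSymm Hm fun l => G (l.map fun x => (x.1, j x.2)) := by
  intro pre x y post h
  simp only [List.map_append, List.map_cons]
  refine hG _ (x.1, j x.2) (y.1, j y.2) _ fun p hp => ?_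
  have : p ∈ (pre ++ x :: y :: post).map fun x => (x.1, j x.2) := by simpa using hp
  obtain ⟨q, hq, rfl⟩ := List.mem_map.mp this
  exact hj q (h q hq)

theorem smul {R : Type*} [Monoid R] [DistribMulAction R M] (r : R) (hF : LSymm Hm F) :
    LSymm Hm fun l => r • F l :=
  hF.map (DistribSMul.toAddMonoidHom M r)

end LSymm

/-- Two neighbours in the same block are exchanged by the symmetry of `f` in that block; the two
terms with the neighbours in different blocks are exchanged with each other. -/
theorem shuf_lsymm {Hm : Set (ℤ × V)} {f : List (ℤ × V) → List (ℤ × V) → M}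
    (h1 : ∀ b, (∀ p ∈ b, p ∈ Hm) → LSymm Hm fun a => f a b)
    (h2 : ∀ a, (∀ p ∈ a, p ∈ Hm) → LSymm Hm (f a)) : LSymm Hm fun l => shuf l f := by
  intro pre
  induction pre generalizing f with
  | nil =>
    intro x y post h
    rw [List.nil_append, List.forall_mem_cons, List.forall_mem_cons] at h
    simp only [List.nil_append, shuf_cons, smul_add, ← shuf_add, ← shuf_negOnePow_smul]
    refine shuf_congr fun a b ha hb _ _ => ?_
    have ha' : ∀ p ∈ a, p ∈ Hm := fun p hp => h.2.2 p (ha hp)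
    have hb' : ∀ p ∈ b, p ∈ Hm := fun p hp => h.2.2 p (hb hp)
    rw [(h1 b hb').swap h.1 h.2.1 ha', (h2 a ha').swap h.1 h.2.1 hb']
    simp only [negOnePow_smul_smul, ldeg_cons]
    rw [add_assoc, add_assoc, add_left_comm (_ • f (y :: a) (x :: b))]
    congr 1
    congr 1
    · apply negOnePow_smul_eq
      simp only [parity_simps]; grind
    · congr 1
      · apply negOnePow_smul_eq
        simp only [parity_simps]; grind
      · apply negOnePow_smul_eq
        simp only [parity_simps]; grind
  | cons z pre ih =>
    intro x y post h
    rw [List.cons_append, List.forall_mem_cons] at h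
    simp only [List.cons_append, shuf_cons, smul_add]
    congr 1
    · refine ih (fun b hb => (h1 b hb).cons h.1)
        (fun a ha => h2 _ ?_) x y post h.2
      rw [List.forall_mem_cons]
      exact ⟨h.1, ha⟩
    · refine ih (f := fun a b => (z.1 * ldeg a).negOnePow • f a (z :: b)) ?_ ?_ x y post h.2
      · intro b hb pre x y post h'
        simp only [h1 (z :: b) (by rw [List.forall_mem_cons]; exact ⟨h.1, hb⟩) pre x y post h']
        simp only [negOnePow_smul_smul, ldeg_append, ldeg_cons]
        apply negOnePow_smul_eq
        simp only [parity_simps]; grind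
      · intro a ha
        exact ((h2 a ha).cons h.1).smul _

theorem ofFn_sub {α : Type*} {n : ℕ} (w : Fin n → α) (I : Finset (Fin n)) :
    List.ofFn (sub w I) = I.sort.map w := by
  refine List.ext_getElem (by simp) fun i h1 h2 => ?_
  simp [sub, Finset.orderEmbOfFin_apply]

theorem ofFn_sub_map_succ {α : Type*} {n : ℕ} (w : Fin (n + 1) → α) (J : Finset (Fin n)) :
    List.ofFn (sub w (J.map (Fin.succEmb n))) = List.ofFn (sub (fun i => w i.succ) J) := by
  have h : (J.map (Fin.succEmb n)).sort = J.sort.map Fin.succ :=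
    (StrictMonoOn.map_finsetSort (f := Fin.succEmb n) J
      (Fin.strictMono_succ.strictMonoOn _)).symm
  rw [ofFn_sub, ofFn_sub, h, List.map_map]
  rfl

theorem ofFn_sub_insert_zero {α : Type*} {n : ℕ} (w : Fin (n + 1) → α) (J : Finset (Fin n)) :
    List.ofFn (sub w (insert 0 (J.map (Fin.succEmb n)))) =
      w 0 :: List.ofFn (sub (fun i => w i.succ) J) := by
  rw [← ofFn_sub_map_succ, ofFn_sub, ofFn_sub, Finset.sort_insert, List.map_cons]
  · simp
  · simp

/-- Sorting the subsets by whether they contain `0` mirrors the two terms in the recursion of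
`shuf`. -/
theorem sum_finset_fin_succ {n : ℕ} (F : Finset (Fin (n + 1)) → M) :
    ∑ I, F I = ∑ J : Finset (Fin n), F (insert 0 (J.map (Fin.succEmb n))) +
      ∑ J : Finset (Fin n), F (J.map (Fin.succEmb n)) := by
  have h0 : (0 : Fin (n + 1)) ∉ (Finset.univ : Finset (Fin n)).map (Fin.succEmb n) := by simp
  have hu : (Finset.univ : Finset (Finset (Fin (n + 1)))) =
      (insert 0 ((Finset.univ : Finset (Fin n)).map (Fin.succEmb n))).powerset := by
    rw [← Finset.powerset_univ]
    congr 1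
    ext i
    refine Fin.cases (by simp) (fun i => by simp) i
  have hm : ((Finset.univ : Finset (Fin n)).map (Fin.succEmb n)).powerset =
      (Finset.univ : Finset (Finset (Fin n))).map
        ⟨Finset.map (Fin.succEmb n), Finset.map_injective _⟩ := by
    ext I
    simp only [Finset.mem_powerset, Finset.subset_map_iff, Finset.mem_map, Finset.mem_univ,
      Finset.subset_univ, true_and, Function.Embedding.coeFn_mk, eq_comm]
  rw [hu, Finset.sum_powerset_insert h0, hm, Finset.sum_map, Finset.sum_map, add_comm]
  rfl

theorem compl_map_succ {n : ℕ} (J : Finset (Fin n)) :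
    (J.map (Fin.succEmb n))ᶜ = insert 0 (Jᶜ.map (Fin.succEmb n)) := by
  ext i
  refine Fin.cases (by simp) (fun i => by simp) i

theorem compl_insert_zero {n : ℕ} (J : Finset (Fin n)) :
    (insert 0 (J.map (Fin.succEmb n)))ᶜ = Jᶜ.map (Fin.succEmb n) := by
  rw [← compl_inj_iff, compl_map_succ, compl_compl, compl_compl]

/-- If `0` lies in the second block, it has to pass every element of the first. -/
theorem unshuffleSign_map_succ {n : ℕ} (d : Fin (n + 1) → ℤ) (J : Finset (Fin n)) :
    unshuffleSign d (J.map (Fin.succEmb n)) =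
      (d 0 * ∑ i ∈ J, d i.succ).negOnePow * unshuffleSign (fun i => d i.succ) J := by
  rw [unshuffleSign, compl_map_succ, Finset.prod_map, unshuffleSign, Finset.mul_sum]
  have h : (∑ i ∈ J, d 0 * d i.succ).negOnePow = ∏ i ∈ J, (d 0 * d i.succ).negOnePow := by
    induction J using Finset.induction_on with
    | empty => simp
    | insert a s ha ih => rw [Finset.prod_insert ha, Finset.sum_insert ha, Int.negOnePow_add, ih]
  rw [h, ← Finset.prod_mul_distrib]
  refine Finset.prod_congr rfl fun i _ => ?_
  rw [Finset.prod_insert (by simp), Finset.prod_map]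
  simp [mul_comm]

theorem unshuffleSign_insert_zero {n : ℕ} (d : Fin (n + 1) → ℤ) (J : Finset (Fin n)) :
    unshuffleSign d (insert 0 (J.map (Fin.succEmb n))) =
      unshuffleSign (fun i => d i.succ) J := by
  rw [unshuffleSign, compl_insert_zero, Finset.prod_insert (by simp), Finset.prod_map,
    unshuffleSign]
  simp

/-- The sum over all unshuffles as an iterated sum. -/
theorem sum_unshuffleSign {n : ℕ} (w : Fin n → ℤ × V)
    (f : List (ℤ × V) → List (ℤ × V) → M) :
    ∑ I : Finset (Fin n), unshuffleSign (fun i => (w i).1) I •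
      f (List.ofFn (sub w I)) (List.ofFn (sub w Iᶜ)) = shuf (List.ofFn w) f := by
  induction n generalizing f with
  | zero =>
    rw [Fintype.sum_eq_single ∅ fun I hI => absurd (Subsingleton.elim I ∅) hI]
    have h : ∀ I : Finset (Fin 0), List.ofFn (sub w I) = [] := fun I => by
      rw [ofFn_sub, Subsingleton.elim I ∅, Finset.sort_empty, List.map_nil]
    rw [h, h]
    simp [unshuffleSign, shuf_nil]
  | succ n ih =>
    rw [sum_finset_fin_succ, List.ofFn_succ, shuf_cons, ← ih, ← ih]
    congr 1 <;> refine Finset.sum_congr rfl fun J _ => ?_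
    · rw [unshuffleSign_insert_zero, compl_insert_zero, ofFn_sub_insert_zero, ofFn_sub_map_succ]
    · have h : ldeg (List.ofFn (sub (fun i => w i.succ) J)) = ∑ i ∈ J, (w i.succ).1 := by
        rw [ldeg_ofFn]
        have := Finset.sum_map (Finset.univ) (J.orderEmbOfFin rfl).toEmbedding
          fun i => (w i.succ).1
        rw [Finset.map_orderEmbOfFin_univ] at this
        exact this.symm
      rw [unshuffleSign_map_succ, compl_map_succ, ofFn_sub_insert_zero, ofFn_sub_map_succ, h,
        mul_comm, mul_smul]

end Shuffles

/-! ### The cocycle property of the Koszul sign. -/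

section Permutations

/-- For symmetric `k` the product runs over the two-element subsets, and `τ` permutes these; the
bijection sorts each image pair. -/
theorem prod_pairs_comp {n : ℕ} (τ : Equiv.Perm (Fin n)) (k : Fin n → Fin n → ℤˣ)
    (hk : ∀ a b, k a b = k b a) :
    ∏ i, ∏ j, (if i < j then k (τ i) (τ j) else 1) = ∏ i, ∏ j, if i < j then k i j else 1 := by
  rw [← Finset.prod_product', ← Finset.prod_product', ← Finset.prod_filter, ← Finset.prod_filter]
  refine Finset.prod_bij'
    (fun p _ => if τ p.1 < τ p.2 then (τ p.1, τ p.2) else (τ p.2, τ p.1))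
    (fun p _ => if τ.symm p.1 < τ.symm p.2 then (τ.symm p.1, τ.symm p.2)
      else (τ.symm p.2, τ.symm p.1)) ?_ ?_ ?_ ?_ ?_
  · rintro ⟨i, j⟩ h
    have hne : τ i ≠ τ j := fun h' => (Finset.mem_filter.mp h).2.ne (τ.injective h')
    simp only [Finset.mem_filter, Finset.mem_product, Finset.mem_univ, true_and]
    split_ifs with h1
    · exact h1
    · exact lt_of_le_of_ne (not_lt.mp h1) hne.symm
  · rintro ⟨i, j⟩ h
    have hne : τ.symm i ≠ τ.symm j :=
      fun h' => (Finset.mem_filter.mp h).2.ne (τ.symm.injective h')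
    simp only [Finset.mem_filter, Finset.mem_product, Finset.mem_univ, true_and]
    split_ifs with h1
    · exact h1
    · exact lt_of_le_of_ne (not_lt.mp h1) hne.symm
  · rintro ⟨i, j⟩ h
    have hij : i < j := (Finset.mem_filter.mp h).2
    by_cases h1 : τ i < τ j <;> simp [h1, hij, hij.not_gt]
  · rintro ⟨i, j⟩ h
    have hij : i < j := (Finset.mem_filter.mp h).2
    by_cases h1 : τ.symm i < τ.symm j <;> simp [h1, hij, hij.not_gt]
  · rintro ⟨i, j⟩ h
    by_cases h1 : τ i < τ j
    · simp [h1]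
    · simp [h1, hk (τ i)]

/-- A pair is inverted by `σ * τ` if exactly one of the two factors inverts it; if both do, their
equal signs cancel. -/
theorem permSign_mul {n : ℕ} (d : Fin n → ℤ) (σ τ : Equiv.Perm (Fin n)) :
    permSign d (σ * τ) = permSign (fun i => d (σ i)) τ * permSign d σ := by
  -- The sign that `σ` attaches to the unordered pair `{a, b}`, made symmetric so that the pairs can
  -- be reindexed by `τ`.
  let k : Fin n → Fin n → ℤˣ := fun a b =>
    if (a < b ∧ σ b < σ a) ∨ (b < a ∧ σ a < σ b) then (d (σ a) * d (σ b)).negOnePow else 1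
  have hk : ∀ a b, k a b = k b a := fun a b => by
    simp only [k, mul_comm (d (σ a)), or_comm]
  have h : permSign d σ = ∏ i, ∏ j, if i < j then k i j else 1 := by
    refine Finset.prod_congr rfl fun i _ => Finset.prod_congr rfl fun j _ => ?_
    by_cases hij : i < j
    · simp [k, hij, hij.not_gt]
    · simp [hij]
  rw [h, ← prod_pairs_comp τ k hk, permSign, permSign, ← Finset.prod_mul_distrib]
  refine Finset.prod_congr rfl fun i _ => ?_
  rw [← Finset.prod_mul_distrib]
  refine Finset.prod_congr rfl fun j _ => ?_
  by_cases hij : i < j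
  · have h1 : τ i ≠ τ j := fun h' => hij.ne (τ.injective h')
    have h2 : σ (τ i) ≠ σ (τ j) := fun h' => h1 (σ.injective h')
    rcases h1.lt_or_gt with h1 | h1 <;> rcases h2.lt_or_gt with h2 | h2 <;>
      simp [k, hij, h1, h2, h1.not_gt, h2.not_gt]
  · simp [hij]

theorem permSign_swap_adjacent {n : ℕ} (d : Fin (n + 1) → ℤ) (k : Fin n) :
    permSign d (Equiv.swap k.castSucc k.succ) = (d k.castSucc * d k.succ).negOnePow := by
  have hlt : k.castSucc < k.succ := Fin.castSucc_lt_succ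
  rw [permSign, Finset.prod_eq_single k.castSucc, Finset.prod_eq_single k.succ]
  · simp [hlt, mul_comm]
  · intro j _ hj
    rw [if_neg]
    rintro ⟨h, h'⟩
    rw [Equiv.swap_apply_left, Equiv.swap_apply_of_ne_of_ne h.ne' hj] at h'
    simp only [Fin.lt_def, Fin.val_castSucc, Fin.val_succ] at h h'
    omega
  · simp
  · intro i _ hi
    refine Finset.prod_eq_one fun j _ => if_neg ?_
    rintro ⟨h, h'⟩
    have hi' : i.val ≠ k.val := fun h => hi (Fin.ext h)
    simp only [Equiv.swap_apply_def, Fin.lt_def, Fin.ext_iff] at h h'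
    split_ifs at h' <;> simp_all <;> omega
  · simp

end Permutations

/-! ### Multilinear maps as functions of lists. -/

section Evaluation

variable {K V W W' : Type*} [Field K] [AddCommGroup V] [Module K V] [AddCommGroup W] [Module K W]
  [AddCommGroup W'] [Module K W']

/-- The homogeneous elements with their degrees. -/
def homog (𝒱 : ℤ → Submodule K V) : Set (ℤ × V) := {x | x.2 ∈ 𝒱 x.1}

@[simp] theorem mem_homog {𝒱 : ℤ → Submodule K V} {x : ℤ × V} : x ∈ homog 𝒱 ↔ x.2 ∈ 𝒱 x.1 :=
  Iff.rfl

/-- The value of a multilinear map on a list, zero if the length of the list is not the number of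
entries. -/
def lev {m : ℕ} (F : MultilinearMap K (fun _ : Fin m => V) W) (l : List (ℤ × V)) : W :=
  if h : l.length = m then F fun i => (l.get (i.cast h.symm)).2 else 0

theorem lev_of_ne {m : ℕ} (F : MultilinearMap K (fun _ : Fin m => V) W) {l : List (ℤ × V)}
    (h : l.length ≠ m) : lev F l = 0 := dif_neg h

theorem lev_ofFn {m : ℕ} (F : MultilinearMap K (fun _ : Fin m => V) W) (w : Fin m → ℤ × V) :
    lev F (List.ofFn w) = F fun i => (w i).2 := by
  rw [lev, dif_pos (by simp)]
  simp

theorem exists_eq_ofFn {α : Type*} {n : ℕ} (l : List α) (h : l.length = n) :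
    ∃ w : Fin n → α, l = List.ofFn w := by
  subst h
  exact ⟨l.get, (List.ofFn_get l).symm⟩

@[simp] theorem lev_nil (F : MultilinearMap K (fun _ : Fin 0 => V) W) (v : Fin 0 → V) :
    lev F [] = F v := by
  exact (dif_pos (show ([] : List (ℤ × V)).length = 0 from rfl)).trans
    (congrArg F (Subsingleton.elim _ _))

theorem lev_cons {m : ℕ} (F : MultilinearMap K (fun _ : Fin (m + 1) => V) W) (x : ℤ × V)
    (l : List (ℤ × V)) : lev F (x :: l) = lev (F.curryLeft x.2) l := by
  rcases eq_or_ne l.length m with h | h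
  · obtain ⟨w, rfl⟩ := exists_eq_ofFn l h
    have := lev_ofFn F (Fin.cons x w)
    rw [List.ofFn_cons] at this
    rw [this, lev_ofFn, MultilinearMap.curryLeft_apply]
    congr 1
    funext i
    refine Fin.cases ?_ (fun i => ?_) i <;> simp
  · rw [lev_of_ne _ h, lev_of_ne _ (by simpa using h)]

theorem lev_zero_cons (F : MultilinearMap K (fun _ : Fin 0 => V) W) (x : ℤ × V)
    (l : List (ℤ × V)) : lev F (x :: l) = 0 := lev_of_ne _ (by simp)

@[simp] theorem lev_add {m : ℕ} (F G : MultilinearMap K (fun _ : Fin m => V) W)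
    (l : List (ℤ × V)) : lev (F + G) l = lev F l + lev G l := by
  by_cases h : l.length = m <;> simp [lev, h]

@[simp] theorem lev_zero {m : ℕ} (l : List (ℤ × V)) :
    lev (0 : MultilinearMap K (fun _ : Fin m => V) W) l = 0 := by
  by_cases h : l.length = m <;> simp [lev, h]

theorem lev_smul {R : Type*} [Monoid R] [DistribMulAction R W] [SMulCommClass K R W] {m : ℕ}
    (r : R) (F : MultilinearMap K (fun _ : Fin m => V) W)
    (l : List (ℤ × V)) : lev (r • F) l = r • lev F l := by
  by_cases h : l.length = m <;> simp [lev, h]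

theorem lev_comp {m : ℕ} (φ : W →ₗ[K] W') (F : MultilinearMap K (fun _ : Fin m => V) W)
    (l : List (ℤ × V)) : lev (φ.compMultilinearMap F) l = φ (lev F l) := by
  by_cases h : l.length = m <;> simp [lev, h]

theorem lev_add_cons {m : ℕ} (F : MultilinearMap K (fun _ : Fin m => V) W) (d : ℤ) (x y : V)
    (l : List (ℤ × V)) : lev F ((d, x + y) :: l) = lev F ((d, x) :: l) + lev F ((d, y) :: l) := by
  cases m with
  | zero => simp only [lev_zero_cons, add_zero]
  | succ m => simp only [lev_cons, map_add, lev_add]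

theorem lev_smul_cons {m : ℕ} (F : MultilinearMap K (fun _ : Fin m => V) W) (d : ℤ) (r : K)
    (x : V) (l : List (ℤ × V)) : lev F ((d, r • x) :: l) = r • lev F ((d, x) :: l) := by
  cases m with
  | zero => simp only [lev_zero_cons, smul_zero]
  | succ m => simp only [lev_cons, map_smul, lev_smul]

theorem lev_negOnePow_smul_cons {m : ℕ} (F : MultilinearMap K (fun _ : Fin m => V) W) (d e : ℤ)
    (x : V) (l : List (ℤ × V)) :
    lev F ((d, e.negOnePow • x) :: l) = e.negOnePow • lev F ((d, x) :: l) := by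
  have := lev_smul_cons F d ((e.negOnePow : ℤ) : K) x l
  rwa [Int.cast_smul_eq_zsmul, Int.cast_smul_eq_zsmul, ← Units.smul_def, ← Units.smul_def] at this

variable {𝒱 : ℤ → Submodule K V} {𝒲 : ℤ → Submodule K W}

theorem forall_ofFn_mem {α : Type*} {S : Set α} {n : ℕ} {w : Fin n → α} :
    (∀ p ∈ List.ofFn w, p ∈ S) ↔ ∀ i, w i ∈ S := by
  simp [List.mem_ofFn]

theorem hasDegree_iff {e : ℤ} {n : ℕ} {f : MultilinearMap K (fun _ : Fin n => V) W} :
    HasDegree 𝒱 𝒲 e f ↔ ∀ l, (∀ p ∈ l, p ∈ homog 𝒱) → lev f l ∈ 𝒲 (e + ldeg l) := by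
  constructor
  · intro h l hl
    by_cases hn : l.length = n
    · obtain ⟨w, rfl⟩ := exists_eq_ofFn l hn
      rw [lev_ofFn, ldeg_ofFn]
      exact h _ _ fun i => forall_ofFn_mem.mp hl i
    · rw [lev_of_ne _ hn]
      exact zero_mem _
  · intro h d v hv
    have := h (List.ofFn fun i => (d i, v i)) (forall_ofFn_mem.mpr hv)
    rwa [lev_ofFn, ldeg_ofFn] at this

/-- Adjacent transpositions generate the symmetric group as a monoid, and `permSign` is
multiplicative in the twisted sense of `permSign_mul`. -/
theorem gradedSymm_iff {n : ℕ} {f : MultilinearMap K (fun _ : Fin n => V) W} :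
    GradedSymm 𝒱 f ↔ LSymm (homog 𝒱) (lev f) := by
  constructor
  · intro hf pre x y post h
    rcases eq_or_ne (pre ++ x :: y :: post).length n with hn | hn
    · have hn' : (pre ++ y :: x :: post).length = n := by simpa using hn
      obtain ⟨w, hw⟩ := exists_eq_ofFn _ hn
      obtain ⟨w', hw'⟩ := exists_eq_ofFn _ hn'
      rw [hw, forall_ofFn_mem] at h
      obtain ⟨m, rfl⟩ : ∃ m, n = m + 1 := ⟨n - 1, by simp at hn; omega⟩
      have hk : pre.length < m := by simp at hn; omega
      have e1 : ∀ i : Fin (m + 1), w i = (pre ++ x :: y :: post)[i.val]'(by omega) := fun i => by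
        simp [hw, -List.ofFn_succ]
      have e2 : ∀ i : Fin (m + 1), w' i = (pre ++ y :: x :: post)[i.val]'(by omega) := fun i => by
        simp [hw', -List.ofFn_succ]
      have hs := hf (fun i => (w i).1) (fun i => (w i).2) h
        (Equiv.swap (Fin.castSucc ⟨pre.length, hk⟩) (Fin.succ ⟨pre.length, hk⟩))
      rw [permSign_swap_adjacent] at hs
      have hx : w (Fin.castSucc ⟨pre.length, hk⟩) = x := by simp [e1]
      have hy : w (Fin.succ ⟨pre.length, hk⟩) = y := by simp [e1]
      have hw2 : (fun i => (w (Equiv.swap (Fin.castSucc ⟨pre.length, hk⟩)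
          (Fin.succ ⟨pre.length, hk⟩) i)).2) = fun i => (w' i).2 := by
        funext i
        rw [Equiv.swap_apply_def]
        split_ifs with h1 h2
        · rw [hy, h1, e2]; simp
        · rw [hx, h2, e2]; simp
        · rw [e1, e2]
          have h1' : i.val ≠ pre.length := fun h => h1 (Fin.ext h)
          have h2' : i.val ≠ pre.length + 1 := fun h => h2 (Fin.ext h)
          rcases lt_or_gt_of_ne h1' with h3 | h3
          · simp [List.getElem_append_left h3]
          · obtain ⟨k, hk⟩ := Nat.exists_eq_add_of_le (show pre.length + 2 ≤ i.val by omega)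
            simp only [hk]
            simp [List.getElem_append, show ¬ pre.length + 2 + k < pre.length by omega,
              show pre.length + 2 + k - pre.length = k + 2 by omega]
      rw [hx, hy, hw2] at hs
      rw [hw, hw', lev_ofFn, lev_ofFn, hs, negOnePow_smul_smul, ← two_mul,
        Int.negOnePow_two_mul, one_smul]
    · rw [lev_of_ne _ hn, lev_of_ne _ (by simpa using hn), smul_zero]
  · intro hf d v hv σ
    cases n with
    | zero =>
      rw [Subsingleton.elim (fun i => v (σ i)) v]
      simp [permSign]
    | succ n =>
      have hσ : σ ∈ Submonoid.closure
          (Set.range fun i : Fin n => Equiv.swap i.castSucc i.succ) := by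
        rw [Equiv.Perm.mclosure_swap_castSucc_succ]; trivial
      induction hσ using Submonoid.closure_induction generalizing d v with
      | mem τ hτ =>
        obtain ⟨k, rfl⟩ := hτ
        simp only [permSign_swap_adjacent]
        have key : ∀ w : Fin (n + 1) → ℤ × V, List.ofFn w =
            (List.ofFn w).take k.val ++ w k.castSucc :: w k.succ :: (List.ofFn w).drop (k.val + 2) := by
          intro w
          have h1 : k.val < (List.ofFn w).length := by
            rw [List.length_ofFn]; omega
          have h2 : k.val + 1 < (List.ofFn w).length := by simp
          conv_lhs => rw [← List.take_append_drop k.val (List.ofFn w),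
            List.drop_eq_getElem_cons h1, List.drop_eq_getElem_cons h2]
          simp only [List.getElem_ofFn]
          rfl
        let w : Fin (n + 1) → ℤ × V := fun i => (d i, v i)
        have e2 := key fun i => w (Equiv.swap k.castSucc k.succ i)
        have e1 := key w
        have h1 : (List.ofFn fun i => w (Equiv.swap k.castSucc k.succ i)).take k.val =
            (List.ofFn w).take k.val := by
          refine List.ext_getElem (by simp) fun i hi hi' => ?_
          simp only [List.getElem_take, List.getElem_ofFn]
          simp only [List.length_take, List.length_ofFn] at hi
          rw [Equiv.swap_apply_of_ne_of_ne] <;> simp [Fin.ext_iff] <;> omega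
        have h2 : (List.ofFn fun i => w (Equiv.swap k.castSucc k.succ i)).drop (k.val + 2) =
            (List.ofFn w).drop (k.val + 2) := by
          refine List.ext_getElem (by simp) fun i hi hi' => ?_
          simp only [List.getElem_drop, List.getElem_ofFn]
          rw [Equiv.swap_apply_of_ne_of_ne] <;> simp [Fin.ext_iff] <;> omega
        rw [h1, h2, Equiv.swap_apply_left, Equiv.swap_apply_right] at e2
        have hh : ∀ p ∈ List.ofFn w, p ∈ homog 𝒱 := forall_ofFn_mem.mpr hv
        rw [e1] at hh
        have := hf _ _ _ _ hh
        rw [← e1, ← e2, lev_ofFn, lev_ofFn] at this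
        simp only [w] at this
        rw [this, negOnePow_smul_smul, ← two_mul, Int.negOnePow_two_mul, one_smul]
      | one =>
        rw [show permSign d 1 = 1 from Finset.prod_eq_one fun i _ => Finset.prod_eq_one fun j _ =>
          if_neg fun h => lt_asymm h.1 h.2, one_smul]
        rfl
      | mul σ τ _ _ ihσ ihτ =>
        rw [permSign_mul, mul_smul, ← ihσ d v hv, ← ihτ _ _ fun i => hv (σ i)]
        rfl

theorem ext_lev [Decomposition 𝒱] {n : ℕ} {f g : MultilinearMap K (fun _ : Fin n => V) W}
    (h : ∀ l : List (ℤ × V), l.length = n → (∀ p ∈ l, p ∈ homog 𝒱) → lev f l = lev g l) :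
    f = g := by
  refine ext_homogeneous 𝒱 fun d v hv => ?_
  have := h (List.ofFn fun i => (d i, v i)) (by simp) (forall_ofFn_mem.mpr hv)
  rwa [lev_ofFn, lev_ofFn] at this

variable {A : Type*} [Ring A] [Algebra K A] [Module A V] [Module A W]
  {𝒜 : ℤ → Submodule K A}

/-- The label `d'` may be arbitrary because `lev` ignores the degrees recorded in the list. -/
theorem GradedALinear.lev_cons {e : ℤ} {n : ℕ} {f : MultilinearMap K (fun _ : Fin n => V) W}
    (hf : GradedALinear 𝒜 𝒱 e f) {x : ℤ × V} {l : List (ℤ × V)} (hx : x ∈ homog 𝒱)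
    (hl : ∀ p ∈ l, p ∈ homog 𝒱) {b d' : ℤ} {a : A} (ha : a ∈ 𝒜 b) :
    lev f ((d', a • x.2) :: l) = (e * b).negOnePow • a • lev f (x :: l) := by
  cases n with
  | zero => simp only [lev_zero_cons, smul_zero]
  | succ n =>
    rcases eq_or_ne l.length n with h | h
    · obtain ⟨w, rfl⟩ := exists_eq_ofFn l h
      rw [forall_ofFn_mem] at hl
      have := hf (Fin.cons x.1 fun i => (w i).1) (Fin.cons x.2 fun i => (w i).2)
        (fun i => by refine Fin.cases ?_ (fun i => ?_) i <;> simp [-mem_homog]; exacts [hx, hl i])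
        0 b a ha
      rw [sum_Iio_zero, add_zero, Fin.update_cons_zero, Fin.cons_zero] at this
      rw [SHLR.lev_cons, SHLR.lev_cons, lev_ofFn, lev_ofFn]
      exact this
    · rw [lev_of_ne _ (by simpa using h), lev_of_ne _ (by simpa using h), smul_zero, smul_zero]

/-- By symmetry the entry can be moved to the front and back. Going forward it has degree `b + d i`,
going back only `d i`; the difference is the sign of moving the scalar past the preceding entries.
-/
theorem gradedALinear_of_cons [GradedAlgebra 𝒜] [SetLike.GradedSMul 𝒜 𝒱]
    {e : ℤ} {n : ℕ} {f : MultilinearMap K (fun _ : Fin n => V) W} (hs : GradedSymm 𝒱 f)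
    (h : ∀ (d : ℤ) (x : V) (l : List (ℤ × V)), x ∈ 𝒱 d → (∀ p ∈ l, p ∈ homog 𝒱) →
      ∀ (b : ℤ), ∀ a ∈ 𝒜 b,
        lev f ((b + d, a • x) :: l) = (e * b).negOnePow • a • lev f ((d, x) :: l)) :
    GradedALinear 𝒜 𝒱 e f := by
  intro d v hv i b a ha
  rw [gradedSymm_iff] at hs
  let w : Fin n → ℤ × V := fun i => (d i, v i)
  have key : ∀ z : ℤ × V, List.ofFn (Function.update w i z) =
      (List.ofFn w).take i.val ++ z :: (List.ofFn w).drop (i.val + 1) := by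
    intro z
    refine List.ext_getElem (by simp; omega) fun j h1 h2 => ?_
    simp only [List.getElem_ofFn, Function.update_apply]
    rcases lt_trichotomy j i.val with hj | hj | hj
    · rw [List.getElem_append_left (by simp; simp at h1; omega)]
      simp [Fin.ext_iff, hj.ne]
    · subst hj
      rw [List.getElem_append_right (by simp)]
      simp
    · rw [List.getElem_append_right (by simp; omega)]
      obtain ⟨k, rfl⟩ := Nat.exists_eq_add_of_lt hj
      simp [Fin.ext_iff, show i.val + k + 1 - i.val = k + 1 by omega,
        show i.val + 1 + k = i.val + k + 1 by omega]
      intro h; omega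
  have h0 := key (w i)
  have h1 := key (b + d i, a • v i)
  rw [Function.update_eq_self] at h0
  have hh : ∀ p ∈ List.ofFn w, p ∈ homog 𝒱 := forall_ofFn_mem.mpr hv
  have hav : a • v i ∈ 𝒱 (b + d i) := SetLike.GradedSMul.smul_mem ha (hv i)
  have hh1 : ∀ p ∈ (List.ofFn w).take i.val ++ (List.ofFn w).drop (i.val + 1), p ∈ homog 𝒱 := by
    intro p hp
    rcases List.mem_append.mp hp with hp | hp
    · exact hh p (List.mem_of_mem_take hp)
    · exact hh p (List.mem_of_mem_drop hp)
  have hh2 : ∀ z ∈ homog 𝒱, ∀ p ∈ (List.ofFn w).take i.val ++ z :: (List.ofFn w).drop (i.val + 1),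
      p ∈ homog 𝒱 := by
    intro z hz p hp
    rcases List.mem_append.mp hp with hp | hp
    · exact hh p (List.mem_of_mem_take hp)
    · rcases List.mem_cons.mp hp with rfl | hp
      · exact hz
      · exact hh p (List.mem_of_mem_drop hp)
  have e0 := hs.move_front _ _ _ (hh2 (w i) (hv i))
  have e1 := hs.move_front _ _ _ (hh2 (b + d i, a • v i) hav)
  rw [← h0, lev_ofFn] at e0
  rw [← h1, lev_ofFn, h _ _ _ (hv i) hh1 b a ha] at e1
  have hsum : ∑ j ∈ Finset.Iio i, d j = ldeg ((List.ofFn w).take i.val) := by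
    rw [ldeg, ← List.map_take.symm, List.map_ofFn, List.sum_take_ofFn]
    refine Finset.sum_congr ?_ fun _ _ => rfl
    ext j
    simp only [Finset.mem_Iio, Finset.mem_filter, Finset.mem_univ, true_and, Fin.lt_def]
  have hu : (fun j => (Function.update w i (b + d i, a • v i) j).2) =
      Function.update v i (a • v i) := by
    funext j
    by_cases hj : j = i <;> simp [hj, w]
  rw [hu] at e1
  rw [e1, hsum]
  change _ = _ • a • f (fun j => (w j).2)
  rw [e0]
  simp only [w]
  rw [smul_comm a, negOnePow_smul_smul, negOnePow_smul_smul]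
  apply negOnePow_smul_eq
  simp only [parity_simps]; grind

end Evaluation

/-! ### Linear maps prescribed on homogeneous parts. -/

section HomLift

variable {K M N : Type*} [Field K] [AddCommMonoid M] [Module K M] [AddCommGroup N] [Module K N]

/-- The linear map on a graded space with given restrictions to the homogeneous parts. -/
def homLift (𝒩 : ℤ → Submodule K N) [Decomposition 𝒩] (φ : ∀ d, 𝒩 d →ₗ[K] M) : N →ₗ[K] M :=
  DirectSum.toModule K ℤ M φ ∘ₗ (decomposeLinearEquiv 𝒩).toLinearMap

theorem homLift_apply (𝒩 : ℤ → Submodule K N) [Decomposition 𝒩] (φ : ∀ d, 𝒩 d →ₗ[K] M) {d : ℤ}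
    {x : N} (hx : x ∈ 𝒩 d) : homLift 𝒩 φ x = φ d ⟨x, hx⟩ := by
  rw [homLift, LinearMap.comp_apply, LinearEquiv.coe_coe, decomposeLinearEquiv_apply,
    decompose_of_mem 𝒩 hx, ← lof_eq_of K, toModule_lof]

end HomLift

/-! ### The graded symmetric algebra: universal property, commutativity, grading. -/

section SymmetricAlgebra

variable {K A L : Type*} [Field K] [Ring A] [Algebra K A]
  [AddCommGroup L] [Module K L] [Module A L]
  {𝒜 : ℤ → Submodule K A} {ℒ : ℤ → Submodule K L}
  {S : Type*} [Ring S] [Algebra K S] {sc : A →ₐ[K] S} {vc : L →ₗ[K] S} {𝒮 : ℤ → Submodule K S}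

/-- The graded algebra `S` with the maps `sc : A → S` and `vc : L → S` is a graded symmetric
algebra of the graded `A`-module `L`. -/
structure IsSymAlg.{u} {K A L : Type*} [Field K] [Ring A] [Algebra K A]
    [AddCommGroup L] [Module K L] [Module A L]
    (𝒜 : ℤ → Submodule K A) (ℒ : ℤ → Submodule K L)
    {S : Type u} [Ring S] [Algebra K S] (sc : A →ₐ[K] S) (vc : L →ₗ[K] S)
    (𝒮 : ℤ → Submodule K S) : Prop where
  grading_eq : ∀ e, 𝒮 e = Submodule.span K {u | ∃ (n : ℕ) (b : ℤ) (d : Fin n → ℤ) (a : A)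
    (ξ : Fin n → L), a ∈ 𝒜 b ∧ (∀ i, ξ i ∈ ℒ (d i)) ∧ b + ∑ i, d i = e ∧
      u = sc a * (List.ofFn fun i => vc (ξ i)).prod}
  vc_smul : ∀ a ξ, vc (a • ξ) = sc a * vc ξ
  vc_mul_sc : ∀ b, ∀ a ∈ 𝒜 b, ∀ c, ∀ ξ ∈ ℒ c,
    vc ξ * sc a = (b * c).negOnePow • (sc a * vc ξ)
  vc_mul_vc : ∀ b, ∀ ξ ∈ ℒ b, ∀ c, ∀ ζ ∈ ℒ c, vc ξ * vc ζ = (b * c).negOnePow • (vc ζ * vc ξ)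
  ext : ∀ {R : Type u} [Ring R] [Algebra K R] {f g : S →ₐ[K] R},
    (∀ a, f (sc a) = g (sc a)) → (∀ ξ, f (vc ξ) = g (vc ξ)) → f = g
  lift : ∀ {R : Type u} [Ring R] [Algebra K R] (φ : A →ₗ[K] R) (ψ : L →ₗ[K] R), φ 1 = 1 →
    (∀ b, ∀ a ∈ 𝒜 b, ∀ c, ∀ a' ∈ 𝒜 c, φ (a * a') = φ a * φ a') →
    (∀ b, ∀ a ∈ 𝒜 b, ∀ c, ∀ ξ ∈ ℒ c, ψ (a • ξ) = φ a * ψ ξ) →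
    (∀ b, ∀ a ∈ 𝒜 b, ∀ c, ∀ ξ ∈ ℒ c, ψ ξ * φ a = (b * c).negOnePow • (φ a * ψ ξ)) →
    (∀ b, ∀ ξ ∈ ℒ b, ∀ c, ∀ ζ ∈ ℒ c, ψ ξ * ψ ζ = (b * c).negOnePow • (ψ ζ * ψ ξ)) →
    ∃ f : S →ₐ[K] R, (∀ a, f (sc a) = φ a) ∧ ∀ ξ, f (vc ξ) = ψ ξ

/-- The arguments about tensors below rest on these properties alone and not on the presentation as
a quotient ring. -/
theorem SymAlg.isSymAlg [Decomposition 𝒜] [Decomposition ℒ] :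
    IsSymAlg 𝒜 ℒ (SymAlg.ofScalar 𝒜 ℒ) (SymAlg.ofVector 𝒜 ℒ) (SymAlg.grading 𝒜 ℒ) where
  grading_eq _ := rfl
  vc_smul a ξ := by
    have := RingQuot.mkAlgHom_rel K (SymRel.smul (𝒜 := 𝒜) (ℒ := ℒ) a ξ)
    rw [map_mul] at this
    exact this
  vc_mul_sc b a ha c ξ hξ := by
    have := RingQuot.mkAlgHom_rel K (SymRel.comm_smul (𝒜 := 𝒜) (ℒ := ℒ) b c a ξ ha hξ)
    rw [Units.smul_def, map_zsmul, map_mul, map_mul] at this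
    exact this
  vc_mul_vc b ξ hξ c ζ hζ := by
    have := RingQuot.mkAlgHom_rel K (SymRel.comm (𝒜 := 𝒜) (ℒ := ℒ) b c ξ ζ hξ hζ)
    rw [Units.smul_def, map_zsmul, map_mul, map_mul] at this
    exact this
  ext h1 h2 := by
    refine RingQuot.ringQuot_ext' K _ _ (TensorAlgebra.hom_ext ?_)
    exact LinearMap.prod_ext (LinearMap.ext h1) (LinearMap.ext h2)
  lift φ ψ one mul smul comm_smul comm := by
    have hz : ∀ (e : ℤ) (x : TensorAlgebra K (A × L)), TensorAlgebra.lift K (φ.coprod ψ)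
        (e.negOnePow • x) = e.negOnePow • TensorAlgebra.lift K (φ.coprod ψ) x :=
      fun e x => by rw [Units.smul_def, Units.smul_def, map_zsmul]
    have h : ∀ ⦃x y : TensorAlgebra K (A × L)⦄, SymRel 𝒜 ℒ x y →
        TensorAlgebra.lift K (φ.coprod ψ) x = TensorAlgebra.lift K (φ.coprod ψ) y := by
      rintro _ _ (_ | ⟨a, b⟩ | ⟨a, ξ⟩ | ⟨b, c, a, ξ, ha, hξ⟩ | ⟨b, c, ξ, ζ, hξ, hζ⟩)
      · simpa using one
      · suffices φ (a * b) = φ a * φ b by simpa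
        induction a using DirectSum.Decomposition.inductionOn 𝒜 with
        | zero => simp
        | add a a' h h' => rw [add_mul, map_add, h, h', map_add, add_mul]
        | @homogeneous i a =>
          induction b using DirectSum.Decomposition.inductionOn 𝒜 with
          | zero => simp
          | add b b' h h' => rw [mul_add, map_add, h, h', map_add, mul_add]
          | homogeneous b => exact mul _ _ a.2 _ _ b.2
      · suffices ψ (a • ξ) = φ a * ψ ξ by simpa
        induction a using DirectSum.Decomposition.inductionOn 𝒜 with
        | zero => simp
        | add a a' h h' => rw [add_smul, map_add, h, h', map_add, add_mul]
        | @homogeneous i a =>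
          induction ξ using DirectSum.Decomposition.inductionOn ℒ with
          | zero => simp
          | add b b' h h' => rw [smul_add, map_add, h, h', map_add, mul_add]
          | homogeneous b => exact smul _ _ a.2 _ _ b.2
      · simpa [hz] using comm_smul b a ha c ξ hξ
      · simpa [hz] using comm b ξ hξ c ζ hζ
    refine ⟨RingQuot.liftAlgHom K ⟨TensorAlgebra.lift K (φ.coprod ψ), h⟩, fun a => ?_, fun ξ => ?_⟩
    · have : SymAlg.ofScalar 𝒜 ℒ a =
        RingQuot.mkAlgHom K (SymRel 𝒜 ℒ) (TensorAlgebra.ι K (a, 0)) := rfl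
      rw [this, RingQuot.liftAlgHom_mkAlgHom_apply, TensorAlgebra.lift_ι_apply]
      simp
    · have : SymAlg.ofVector 𝒜 ℒ ξ =
        RingQuot.mkAlgHom K (SymRel 𝒜 ℒ) (TensorAlgebra.ι K (0, ξ)) := rfl
      rw [this, RingQuot.liftAlgHom_mkAlgHom_apply, TensorAlgebra.lift_ι_apply]
      simp

namespace IsSymAlg

theorem sc_mem (hS : IsSymAlg 𝒜 ℒ sc vc 𝒮) {b : ℤ} {a : A} (ha : a ∈ 𝒜 b) : sc a ∈ 𝒮 b := by
  rw [hS.grading_eq]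
  exact Submodule.subset_span
    ⟨0, b, Fin.elim0, a, Fin.elim0, ha, fun i => i.elim0, by simp, by simp⟩

theorem sc_mul_mem (hS : IsSymAlg 𝒜 ℒ sc vc 𝒮) [GradedAlgebra 𝒜] {b e : ℤ} {a : A} (ha : a ∈ 𝒜 b) {x : S}
    (hx : x ∈ 𝒮 e) : sc a * x ∈ 𝒮 (b + e) := by
  rw [hS.grading_eq] at hx ⊢
  induction hx using Submodule.span_induction with
  | zero => rw [mul_zero]; exact zero_mem _
  | add x y _ _ hx hy => rw [mul_add]; exact add_mem hx hy
  | smul r x _ hx => rw [mul_smul_comm]; exact Submodule.smul_mem _ r hx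
  | mem x hx =>
    obtain ⟨n, c, d, a', ξ, ha', hξ, he, rfl⟩ := hx
    exact Submodule.subset_span ⟨n, b + c, d, a * a', ξ, SetLike.mul_mem_graded ha ha', hξ,
      by rw [← he, add_assoc], by rw [map_mul, mul_assoc]⟩

theorem vc_mul_mem (hS : IsSymAlg 𝒜 ℒ sc vc 𝒮) {b e : ℤ} {ξ : L} (hξ : ξ ∈ ℒ b) {x : S}
    (hx : x ∈ 𝒮 e) : vc ξ * x ∈ 𝒮 (b + e) := by
  rw [hS.grading_eq] at hx ⊢
  induction hx using Submodule.span_induction with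
  | zero => rw [mul_zero]; exact zero_mem _
  | add x y _ _ hx hy => rw [mul_add]; exact add_mem hx hy
  | smul r x _ hx => rw [mul_smul_comm]; exact Submodule.smul_mem _ r hx
  | mem x hx =>
    obtain ⟨n, c, d, a, ζ, ha, hζ, rfl, rfl⟩ := hx
    rw [← mul_assoc, hS.vc_mul_sc _ _ ha _ _ hξ, Units.smul_def, smul_mul_assoc]
    refine zsmul_mem ?_ _
    rw [mul_assoc, ← List.prod_cons]
    refine Submodule.subset_span ⟨n + 1, c, Fin.cons b d, a, Fin.cons ξ ζ, ha, fun i => ?_, ?_, ?_⟩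
    · refine Fin.cases ?_ (fun i => ?_) i <;> simp [hξ, hζ]
    · rw [Fin.sum_cons]; ring
    · rw [List.ofFn_succ]
      simp

theorem vc_mem (hS : IsSymAlg 𝒜 ℒ sc vc 𝒮) [GradedAlgebra 𝒜] {b : ℤ} {ξ : L} (hξ : ξ ∈ ℒ b) :
    vc ξ ∈ 𝒮 b := by
  have := hS.vc_mul_mem hξ (hS.sc_mem SetLike.GradedOne.one_mem)
  rwa [map_one, mul_one, add_zero] at this

theorem prod_mem (hS : IsSymAlg 𝒜 ℒ sc vc 𝒮) [GradedAlgebra 𝒜] {n : ℕ} {d : Fin n → ℤ} {ξ : Fin n → L}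
    (hξ : ∀ i, ξ i ∈ ℒ (d i)) :
    (List.ofFn fun i => vc (ξ i)).prod ∈ 𝒮 (∑ i, d i) := by
  rw [hS.grading_eq]
  exact Submodule.subset_span ⟨n, 0, d, 1, ξ, SetLike.GradedOne.one_mem, hξ, by simp, by simp⟩

theorem gradedMonoid (hS : IsSymAlg 𝒜 ℒ sc vc 𝒮) [GradedAlgebra 𝒜] :
    SetLike.GradedMonoid 𝒮 where
  one_mem := by
    have := hS.sc_mem (SetLike.GradedOne.one_mem (A := 𝒜))
    rwa [map_one] at this
  mul_mem := by
    intro i j x y hx hy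
    rw [hS.grading_eq] at hx
    induction hx using Submodule.span_induction with
    | zero => rw [zero_mul]; exact zero_mem _
    | add x y _ _ hx hy => rw [add_mul]; exact add_mem hx hy
    | smul r x _ hx => rw [smul_mul_assoc]; exact Submodule.smul_mem _ r hx
    | mem x hx =>
      obtain ⟨n, c, d, a, ξ, ha, hξ, rfl, rfl⟩ := hx
      rw [mul_assoc, add_assoc]
      refine hS.sc_mul_mem ha ?_
      clear ha
      induction n with
      | zero => simpa using hy
      | succ n ih =>
        rw [List.ofFn_succ, List.prod_cons, mul_assoc, Fin.sum_univ_succ, add_assoc]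
        exact hS.vc_mul_mem (hξ 0) (ih (fun i => d i.succ) (fun i => ξ i.succ) fun i => hξ _)

/-- Induction for homogeneous tensors. -/
theorem grading_induction (hS : IsSymAlg 𝒜 ℒ sc vc 𝒮) [GradedAlgebra 𝒜] {p : ℤ → S → Prop}
    (scalar : ∀ b, ∀ a ∈ 𝒜 b, p b (sc a))
    (vector : ∀ b, ∀ ξ ∈ ℒ b, p b (vc ξ))
    (mul : ∀ b, ∀ x ∈ 𝒮 b, ∀ c, ∀ y ∈ 𝒮 c, p b x → p c y → p (b + c) (x * y))
    (zero : ∀ b, p b 0)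
    (add : ∀ b, ∀ x ∈ 𝒮 b, ∀ y ∈ 𝒮 b, p b x → p b y → p b (x + y))
    {e : ℤ} {x : S} (hx : x ∈ 𝒮 e) : p e x := by
  rw [hS.grading_eq] at hx
  induction hx using Submodule.span_induction with
  | zero => exact zero e
  | add x y hx' hy' hx hy =>
    rw [← hS.grading_eq] at hx' hy'
    exact add e x hx' y hy' hx hy
  | smul r x hx' hx =>
    rw [← hS.grading_eq] at hx'
    have h1 : algebraMap K A r ∈ 𝒜 0 := SetLike.algebraMap_mem_graded 𝒜 r
    have := mul 0 _ (hS.sc_mem h1) e x hx' (scalar 0 _ h1) hx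
    rwa [AlgHom.commutes, ← Algebra.smul_def, zero_add] at this
  | mem x hx =>
    obtain ⟨n, c, d, a, ξ, ha, hξ, rfl, rfl⟩ := hx
    refine mul _ _ (hS.sc_mem ha) _ _ (hS.prod_mem hξ) (scalar c a ha) ?_
    clear ha
    induction n with
    | zero =>
      have := scalar 0 1 SetLike.GradedOne.one_mem
      simpa using this
    | succ n ih =>
      rw [List.ofFn_succ, List.prod_cons, Fin.sum_univ_succ]
      exact mul _ _ (hS.vc_mem (hξ 0)) _ _ (hS.prod_mem fun i => hξ i.succ) (vector _ _ (hξ 0))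
        (ih (fun i => d i.succ) (fun i => ξ i.succ) fun i => hξ _)

/-- Graded commutation with a fixed element is inherited by products, so it may be tested on
generators, first in one factor and then in the other. -/
theorem mul_comm_of_mem (hS : IsSymAlg 𝒜 ℒ sc vc 𝒮) [GradedAlgebra 𝒜] (hA : GradedComm 𝒜) {b c : ℤ} {x y : S}
    (hx : x ∈ 𝒮 b) (hy : y ∈ 𝒮 c) :
    x * y = (b * c).negOnePow • (y * x) := by
  have mul : ∀ (y : S) (c b : ℤ) (x x' : S) (b' : ℤ),
      x * y = (b * c).negOnePow • (y * x) → x' * y = (b' * c).negOnePow • (y * x') →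
      x * x' * y = ((b + b') * c).negOnePow • (y * (x * x')) := by
    intro y c b x x' b' h h'
    rw [mul_assoc, h', mul_smul_comm, ← mul_assoc, h, smul_mul_assoc, negOnePow_smul_smul,
      mul_assoc]
    apply negOnePow_smul_eq
    simp only [parity_simps]; grind
  have symm : ∀ {b c : ℤ} {x y : S}, x * y = (b * c).negOnePow • (y * x) →
      y * x = (c * b).negOnePow • (x * y) := by
    intro b c x y h
    rw [h, mul_comm c b, negOnePow_smul_smul, ← two_mul, Int.negOnePow_two_mul, one_smul]
  have gen : ∀ (c : ℤ) (y : S),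
      (∀ b, ∀ a ∈ 𝒜 b, sc a * y = (b * c).negOnePow • (y * sc a)) →
      (∀ b, ∀ ξ ∈ ℒ b, vc ξ * y = (b * c).negOnePow • (y * vc ξ)) →
      ∀ b, ∀ x ∈ 𝒮 b, x * y = (b * c).negOnePow • (y * x) := by
    intro c y h1 h2 b x hx
    refine hS.grading_induction (p := fun b x => x * y = (b * c).negOnePow • (y * x)) h1 h2
      (fun b x _ b' x' _ h h' => mul y c b x x' b' h h') (fun b => by
        rw [zero_mul, mul_zero, smul_zero])
      (fun b x _ x' _ h h' => by rw [add_mul, h, h', mul_add, smul_add]) hx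
  refine gen c y (fun b a ha => ?_) (fun b ξ hξ => ?_) b x hx
  · refine symm (gen b _ (fun c a' ha' => ?_) (fun c ξ hξ => ?_) c y hy)
    · rw [← map_mul, hA b c a ha a' ha', Units.smul_def, map_zsmul, map_mul, Units.smul_def,
        mul_comm c b]
    · rw [hS.vc_mul_sc _ _ ha _ _ hξ, mul_comm b c]
  · refine symm (gen b _ (fun c a ha => ?_) (fun c ζ hζ => ?_) c y hy)
    · exact symm (by rw [hS.vc_mul_sc _ _ ha _ _ hξ, mul_comm b c])
    · exact hS.vc_mul_vc _ _ hζ _ _ hξ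

theorem decomposition_of_congr {i j : ℤ} (x : 𝒮 i) (y : 𝒮 j) (h : i = j) (hxy : (x : S) = y) :
    DirectSum.of (fun i => 𝒮 i) i x = DirectSum.of (fun i => 𝒮 i) j y := by
  subst h
  rw [Subtype.ext hxy]

theorem negOnePow_smul_of {i e : ℤ} (x : 𝒮 i) :
    e.negOnePow • DirectSum.of (fun i => 𝒮 i) i x =
      DirectSum.of (fun i => 𝒮 i) i (e.negOnePow • x) := by
  rw [Units.smul_def, Units.smul_def]
  exact (map_zsmul (DirectSum.of (fun i => 𝒮 i) i) _ x).symm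

/-- The grading of the graded symmetric algebra is a direct sum decomposition. -/
theorem exists_decomposition (hS : IsSymAlg 𝒜 ℒ sc vc 𝒮) [GradedAlgebra 𝒜] [Decomposition ℒ]
    [SetLike.GradedSMul 𝒜 ℒ] : Nonempty (Decomposition 𝒮) := by
  have := hS.gradedMonoid
  -- The pieces of the grading are defined as spans, so their independence has to be proved. Tagging
  -- each homogeneous generator with its degree respects the relations and extends to an algebra map
  -- into the external direct sum.
  let φ : A →ₗ[K] ⨁ i, 𝒮 i := homLift 𝒜 fun d => DirectSum.lof K ℤ (fun i => 𝒮 i) d ∘ₗ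
    sc.toLinearMap.restrict (p := 𝒜 d) (q := 𝒮 d) fun _ => hS.sc_mem
  let ψ : L →ₗ[K] ⨁ i, 𝒮 i := homLift ℒ fun d => DirectSum.lof K ℤ (fun i => 𝒮 i) d ∘ₗ
    vc.restrict (p := ℒ d) (q := 𝒮 d) fun _ => hS.vc_mem
  have hφ : ∀ {d : ℤ} {a : A} (ha : a ∈ 𝒜 d),
      φ a = DirectSum.of (fun i => 𝒮 i) d ⟨_, hS.sc_mem ha⟩ := fun ha => homLift_apply 𝒜 _ ha
  have hψ : ∀ {d : ℤ} {ξ : L} (hξ : ξ ∈ ℒ d),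
      ψ ξ = DirectSum.of (fun i => 𝒮 i) d ⟨_, hS.vc_mem hξ⟩ := fun hξ => homLift_apply ℒ _ hξ
  obtain ⟨f, hf1, hf2⟩ := hS.lift (R := ⨁ i, 𝒮 i) φ ψ
    (by
      rw [hφ (SetLike.GradedOne.one_mem (A := 𝒜))]
      exact decomposition_of_congr _ _ rfl (map_one sc))
    (fun b a ha c a' ha' => by
      rw [hφ (SetLike.mul_mem_graded ha ha'), hφ ha, hφ ha', DirectSum.of_mul_of]
      exact decomposition_of_congr _ _ rfl (map_mul sc a a'))
    (fun b a ha c ξ hξ => by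
      rw [hψ (show a • ξ ∈ ℒ (b + c) from SetLike.GradedSMul.smul_mem ha hξ), hφ ha, hψ hξ,
        DirectSum.of_mul_of]
      exact decomposition_of_congr _ _ rfl (hS.vc_smul a ξ))
    (fun b a ha c ξ hξ => by
      rw [hφ ha, hψ hξ, DirectSum.of_mul_of, DirectSum.of_mul_of, negOnePow_smul_of]
      exact decomposition_of_congr _ _ (add_comm _ _) (hS.vc_mul_sc b a ha c ξ hξ))
    (fun b ξ hξ c ζ hζ => by
      rw [hψ hζ, hψ hξ, DirectSum.of_mul_of, DirectSum.of_mul_of, negOnePow_smul_of]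
      exact decomposition_of_congr _ _ (add_comm _ _) (hS.vc_mul_vc b ξ hξ c ζ hζ))
  have hf : ∀ {e : ℤ} {x : S} (hx : x ∈ 𝒮 e), f x = DirectSum.of (fun i => 𝒮 i) e ⟨x, hx⟩ := by
    intro e x hx
    suffices ∃ h : x ∈ 𝒮 e, f x = DirectSum.of (fun i => 𝒮 i) e ⟨x, h⟩ from this.2
    refine hS.grading_induction (p := fun e x => ∃ h : x ∈ 𝒮 e,
      f x = DirectSum.of (fun i => 𝒮 i) e ⟨x, h⟩)
      (fun b a ha => ⟨hS.sc_mem ha, by rw [hf1, hφ ha]⟩)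
      (fun b ξ hξ => ⟨hS.vc_mem hξ, by rw [hf2, hψ hξ]⟩) ?_ ?_ ?_ hx
    · rintro b x hx c y hy ⟨_, h⟩ ⟨_, h'⟩
      refine ⟨SetLike.mul_mem_graded hx hy, ?_⟩
      rw [map_mul, h, h', DirectSum.of_mul_of]
      rfl
    · exact fun b => ⟨zero_mem _, by rw [map_zero]; exact (map_zero _).symm⟩
    · rintro b x hx y hy ⟨_, h⟩ ⟨_, h'⟩
      refine ⟨add_mem hx hy, ?_⟩
      rw [map_add, h, h', ← map_add]
      rfl
  -- Summing the components fixes the generators, so it is a left inverse of `f`; `hf` gives the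
  -- other side.
  have hid : (DirectSum.coeAlgHom 𝒮).comp f = AlgHom.id K _ := by
    refine hS.ext (fun a => ?_) fun ξ => ?_
    · induction a using DirectSum.Decomposition.inductionOn 𝒜 with
      | zero => simp
      | add a b ha hb => rw [map_add, map_add, ha, hb, map_add]
      | homogeneous a =>
        rw [AlgHom.comp_apply, hf (hS.sc_mem a.2)]
        exact DirectSum.coeAlgHom_of _ _ _
    · induction ξ using DirectSum.Decomposition.inductionOn ℒ with
      | zero => simp
      | add a b ha hb => rw [map_add, map_add, ha, hb, map_add]
      | homogeneous ξ =>
        rw [AlgHom.comp_apply, hf (hS.vc_mem ξ.2)]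
        exact DirectSum.coeAlgHom_of _ _ _
  refine ⟨⟨f, fun x => congrArg (fun g => g x) hid, fun x => ?_⟩⟩
  induction x using DirectSum.induction_on with
  | zero => simp
  | of i x => rw [DirectSum.coeAddMonoidHom_of, hf x.2]
  | add x y hx hy => rw [map_add, map_add, hx, hy]

end IsSymAlg

/-! ### Lists of generators; multiderivations are determined by generators. -/

section Generators

variable (𝒜 ℒ) in
/-- The homogeneous generators of the graded symmetric algebra with their degrees. -/
def homGen : Set (ℤ × (A ⊕ L)) :=
  {x | Sum.elim (fun a => a ∈ 𝒜 x.1) (fun ξ => ξ ∈ ℒ x.1) x.2}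

variable (sc vc) in
/-- A generator as a tensor. -/
def ofGen : A ⊕ L → S := Sum.elim sc vc

variable (sc vc) in
/-- A list of generators as a list of tensors. -/
def ofGens (g : List (ℤ × (A ⊕ L))) : List (ℤ × S) := g.map fun x => (x.1, ofGen sc vc x.2)

/-- A list of vectors as a list of generators. -/
def vecs (l : List (ℤ × L)) : List (ℤ × (A ⊕ L)) := l.map fun x => (x.1, Sum.inr x.2)

@[simp] theorem ldeg_map {V W : Type*} (l : List (ℤ × V)) (j : V → W) :
    ldeg (l.map fun x => (x.1, j x.2)) = ldeg l := by
  simp [ldeg, Function.comp_def]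

@[simp] theorem ldeg_ofGens (g : List (ℤ × (A ⊕ L))) : ldeg (ofGens sc vc g) = ldeg g :=
  ldeg_map _ _

@[simp] theorem ldeg_vecs (l : List (ℤ × L)) : ldeg (vecs (A := A) l) = ldeg l := ldeg_map _ _

theorem ofGen_mem (hS : IsSymAlg 𝒜 ℒ sc vc 𝒮) [GradedAlgebra 𝒜] {x : ℤ × (A ⊕ L)} (hx : x ∈ homGen 𝒜 ℒ) :
    ofGen sc vc x.2 ∈ 𝒮 x.1 := by
  obtain ⟨d, a | ξ⟩ := x
  · exact hS.sc_mem hx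
  · exact hS.vc_mem hx

theorem ofGens_mem (hS : IsSymAlg 𝒜 ℒ sc vc 𝒮) [GradedAlgebra 𝒜] {g : List (ℤ × (A ⊕ L))} (hg : ∀ p ∈ g, p ∈ homGen 𝒜 ℒ) :
    ∀ p ∈ ofGens sc vc g, p ∈ homog 𝒮 := by
  intro p hp
  obtain ⟨q, hq, rfl⟩ := List.mem_map.mp hp
  exact ofGen_mem hS (hg q hq)

theorem vecs_mem {l : List (ℤ × L)} :
    (∀ p ∈ vecs l, p ∈ homGen 𝒜 ℒ) ↔ ∀ p ∈ l, p ∈ homog ℒ := by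
  simp only [vecs, List.mem_map, forall_exists_index, and_imp, forall_apply_eq_imp_iff₂]
  rfl

/-- The three cases are no scalar, one scalar, at least two scalars: those in which the extension is
given by brackets, by anchors, and by zero. -/
theorem gens_perm (g : List (ℤ × (A ⊕ L))) :
    (∃ l, g = vecs l) ∨ (∃ b a l, g.Perm ((b, Sum.inl a) :: vecs l)) ∨
      ∃ b a b' a' g', g.Perm ((b, Sum.inl a) :: (b', Sum.inl a') :: g') := by
  induction g with
  | nil => exact Or.inl ⟨[], rfl⟩
  | cons x g ih =>
    obtain ⟨d, a | ξ⟩ := x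
    · right
      rcases ih with ⟨l, rfl⟩ | ⟨b, a', l, h⟩ | ⟨b, a', b', a'', g', h⟩
      · exact Or.inl ⟨d, a, l, List.Perm.refl _⟩
      · exact Or.inr ⟨d, a, b, a', _, h.cons _⟩
      · exact Or.inr ⟨d, a, b, a', _, h.cons _⟩
    · rcases ih with ⟨l, rfl⟩ | ⟨b, a', l, h⟩ | ⟨b, a', b', a'', g', h⟩
      · exact Or.inl ⟨(d, ξ) :: l, rfl⟩
      · exact Or.inr (Or.inl ⟨b, a', (d, ξ) :: l, (h.cons _).trans (List.Perm.swap _ _ _)⟩)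
      · exact Or.inr (Or.inr ⟨b, a', b', a'', (d, Sum.inr ξ) :: g', (h.cons _).trans
          ((List.Perm.swap _ _ _).trans ((List.Perm.swap _ _ _).cons _))⟩)

/-- Symmetric functions on lists of generators agree if they do so on lists with no scalars, on
lists with one scalar at the front and on lists starting with two scalars. -/
theorem gens_ext {M : Type*} [AddCommGroup M] {F G : List (ℤ × (A ⊕ L)) → M}
    (hF : LSymm (homGen 𝒜 ℒ) F) (hG : LSymm (homGen 𝒜 ℒ) G)
    (h0 : ∀ l : List (ℤ × L), (∀ p ∈ l, p ∈ homog ℒ) → F (vecs l) = G (vecs l))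
    (h1 : ∀ (l : List (ℤ × L)) (b : ℤ) (a : A), (∀ p ∈ l, p ∈ homog ℒ) → a ∈ 𝒜 b →
      F ((b, Sum.inl a) :: vecs l) = G ((b, Sum.inl a) :: vecs l))
    (h2 : ∀ (g : List (ℤ × (A ⊕ L))) (b : ℤ) (a : A) (b' : ℤ) (a' : A),
      (∀ p ∈ g, p ∈ homGen 𝒜 ℒ) → a ∈ 𝒜 b → a' ∈ 𝒜 b' →
      F ((b, Sum.inl a) :: (b', Sum.inl a') :: g) = G ((b, Sum.inl a) :: (b', Sum.inl a') :: g))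
    {g : List (ℤ × (A ⊕ L))} (hg : ∀ p ∈ g, p ∈ homGen 𝒜 ℒ) : F g = G g := by
  rcases gens_perm g with ⟨l, rfl⟩ | ⟨b, a, l, h⟩ | ⟨b, a, b', a', g', h⟩
  · exact h0 l (vecs_mem.mp hg)
  · have h' := fun p hp => hg p (h.mem_iff.mpr hp)
    rw [List.forall_mem_cons] at h'
    exact hF.eq_of_perm hG h hg (h1 l b a (vecs_mem.mp h'.2) h'.1)
  · have h' := fun p hp => hg p (h.mem_iff.mpr hp)
    rw [List.forall_mem_cons, List.forall_mem_cons] at h'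
    exact hF.eq_of_perm hG h hg (h2 g' b a b' a' h'.2.2 h'.1 h'.2.1)

variable {R : Type*} [Ring R] [Algebra K R]

/-- Graded symmetric functions on lists of homogeneous tensors that are graded derivations in
the first entry. -/
structure IsMultiDer (𝒮 : ℤ → Submodule K S) (ρ : S →ₐ[K] R) (E : ℤ) (F : List (ℤ × S) → R) : Prop where
  symm : LSymm (homog 𝒮) F
  add : ∀ d x y l, x ∈ 𝒮 d → y ∈ 𝒮 d → (∀ p ∈ l, p ∈ homog 𝒮) →
    F ((d, x + y) :: l) = F ((d, x) :: l) + F ((d, y) :: l)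
  leib : ∀ b x c y l, x ∈ 𝒮 b → y ∈ 𝒮 c →
    (∀ p ∈ l, p ∈ homog 𝒮) →
    F ((b + c, x * y) :: l) = (E * b).negOnePow • (ρ x * F ((c, y) :: l)) +
      (c * ldeg l).negOnePow • (F ((b, x) :: l) * ρ y)

/-- The values of a multiderivation on lists of a given length are determined by those on lists of
generators of that length. -/
theorem IsMultiDer.eq_of_gens (hS : IsSymAlg 𝒜 ℒ sc vc 𝒮) [GradedAlgebra 𝒜]
    {ρ : S →ₐ[K] R} {E : ℤ}
    {F G : List (ℤ × S) → R} (hF : IsMultiDer 𝒮 ρ E F) (hG : IsMultiDer 𝒮 ρ E G)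
    {l : List (ℤ × S)} (hl : ∀ p ∈ l, p ∈ homog 𝒮)
    (h : ∀ g, g.length = l.length → (∀ p ∈ g, p ∈ homGen 𝒜 ℒ) →
      F (ofGens sc vc g) = G (ofGens sc vc g)) : F l = G l := by
  -- The entries are replaced by generators one at a time; `g` collects, behind the untreated
  -- entries, those already replaced.
  suffices ∀ g, (∀ p ∈ g, p ∈ homGen 𝒜 ℒ) → (∀ g', g'.length = l.length + g.length →
      (∀ p ∈ g', p ∈ homGen 𝒜 ℒ) → F (ofGens sc vc g') = G (ofGens sc vc g')) →
      F (l ++ ofGens sc vc g) = G (l ++ ofGens sc vc g) by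
    simpa [ofGens] using this [] (by simp) (by simpa using h)
  clear h
  induction l with
  | nil => exact fun g hg h => h g (by simp) hg
  | cons x l ih =>
    intro g hg h'
    rw [List.forall_mem_cons] at hl
    have hm : ∀ p ∈ l ++ ofGens sc vc g, p ∈ homog 𝒮 :=
      List.forall_mem_append.mpr ⟨hl.2, ofGens_mem hS hg⟩
    have gen : ∀ y ∈ homGen 𝒜 ℒ, F ((y.1, ofGen sc vc y.2) :: (l ++ ofGens sc vc g)) =
        G ((y.1, ofGen sc vc y.2) :: (l ++ ofGens sc vc g)) := by
      intro y hy
      -- A first entry that is a generator is moved behind the untreated entries, where the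
      -- induction hypothesis applies.
      refine hF.symm.eq_of_perm hG.symm List.perm_middle.symm
        (List.forall_mem_cons.mpr ⟨ofGen_mem hS hy, hm⟩) ?_
      exact ih hl.2 (y :: g) (List.forall_mem_cons.mpr ⟨hy, hg⟩) fun g' hn hg' =>
        h' g' (by rw [hn, List.length_cons, List.length_cons]; omega) hg'
    refine hS.grading_induction
      (p := fun d x => F ((d, x) :: (l ++ ofGens sc vc g)) = G ((d, x) :: (l ++ ofGens sc vc g)))
      (fun b a ha => gen (b, Sum.inl a) ha) (fun b ξ hξ => gen (b, Sum.inr ξ) hξ)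
      (fun b x hx c y hy h h' => ?_) (fun b => ?_) (fun b x hx y hy h h' => ?_) hl.1
    · rw [hF.leib b x c y _ hx hy hm, hG.leib b x c y _ hx hy hm, h, h']
    · have h1 := hF.add b 0 0 _ (zero_mem _) (zero_mem _) hm
      have h2 := hG.add b 0 0 _ (zero_mem _) (zero_mem _) hm
      rw [add_zero, left_eq_add] at h1 h2
      rw [h1, h2]
    · rw [hF.add b x y _ hx hy hm, hG.add b x y _ hx hy hm, h, h']

/-- A multiderivation is determined by its values on generators. -/
theorem IsMultiDer.ext (hS : IsSymAlg 𝒜 ℒ sc vc 𝒮) [GradedAlgebra 𝒜]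
    {ρ : S →ₐ[K] R} {E : ℤ}
    {F G : List (ℤ × S) → R} (hF : IsMultiDer 𝒮 ρ E F) (hG : IsMultiDer 𝒮 ρ E G)
    (h : ∀ g, (∀ p ∈ g, p ∈ homGen 𝒜 ℒ) → F (ofGens sc vc g) = G (ofGens sc vc g))
    (l : List (ℤ × S)) (hl : ∀ p ∈ l, p ∈ homog 𝒮) : F l = G l :=
  hF.eq_of_gens hS hG hl fun g _ => h g

end Generators

end SymmetricAlgebra

/-! ### Derivations prescribed on generators, by a square-zero argument. -/

section Derivations

variable {K A L : Type*} [Field K] [Ring A] [Algebra K A]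
  [AddCommGroup L] [Module K L] [Module A L]
  {𝒜 : ℤ → Submodule K A} {ℒ : ℤ → Submodule K L}

/-- The operator `(s, m) ↦ (v s, (-1) ^ (E b) v m + (-1) ^ ((E + b) s) s μ)`. For `v` of degree `b`
these operators compose like the values `μ = δ v` of a derivation of degree `E`. -/
def derOp {S M : Type*} [Ring S] [Algebra K S] (𝒮 : ℤ → Submodule K S) [Decomposition 𝒮]
    [AddCommGroup M] [Module K M] [Module S M] [IsScalarTower K S M] (E b : ℤ) (v : S) (μ : M) :
    Module.End K (S × M) :=
  LinearMap.prod (LinearMap.mulLeft K v ∘ₗ LinearMap.fst K S M)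
    ((((E * b).negOnePow : ℤ) : K) • Algebra.lsmul K K M v ∘ₗ LinearMap.snd K S M +
      (LinearMap.toSpanSingleton S M μ).restrictScalars K ∘ₗ gsign 𝒮 (E + b) ∘ₗ
        LinearMap.fst K S M)

section
variable {S M : Type*} [Ring S] [Algebra K S] {𝒮 : ℤ → Submodule K S} [Decomposition 𝒮]
    [AddCommGroup M] [Module K M] [Module S M] [IsScalarTower K S M]

theorem derOp_apply (E b : ℤ) (v : S) (μ : M) (x : S × M) :
    derOp (K := K) 𝒮 E b v μ x =
      (v * x.1, (E * b).negOnePow • v • x.2 + gsign 𝒮 (E + b) x.1 • μ) := by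
  rw [Units.smul_def, ← Int.cast_smul_eq_zsmul K]
  rfl

theorem derOp_add (E b : ℤ) (v w : S) (μ ν : M) :
    derOp (K := K) 𝒮 E b (v + w) (μ + ν) = derOp 𝒮 E b v μ + derOp 𝒮 E b w ν := by
  refine LinearMap.ext fun x => ?_
  simp only [derOp_apply, LinearMap.add_apply, add_mul, add_smul, smul_add, Prod.mk_add_mk]
  congr 1
  abel

theorem derOp_smul (E b : ℤ) (r : K) (v : S) (μ : M) :
    derOp (K := K) 𝒮 E b (r • v) (r • μ) = r • derOp 𝒮 E b v μ := by
  refine LinearMap.ext fun x => ?_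
  simp only [derOp_apply, LinearMap.smul_apply, smul_mul_assoc, smul_assoc, Prod.smul_mk, smul_add]
  have h : ∀ (x : S) (m : M), x • r • m = r • x • m := fun x m => by
    rw [← algebraMap_smul S r m, smul_smul, ← Algebra.commutes, mul_smul, algebraMap_smul]
  rw [h, smul_comm r (_ : ℤˣ)]

theorem derOp_negOnePow_smul (E b e : ℤ) (v : S) (μ : M) :
    derOp (K := K) 𝒮 E b (e.negOnePow • v) (e.negOnePow • μ) = e.negOnePow • derOp 𝒮 E b v μ := by
  simp only [Units.smul_def, ← Int.cast_smul_eq_zsmul K]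
  exact derOp_smul E b _ v μ

/-- The operators are triangular on `S × M`: their diagonal parts compose as multiplications, and
the off-diagonal part of a product is a Leibniz rule. The `gsign` factor pays for moving `v` and the
derivation past the argument `s`. -/
theorem derOp_mul (hcomm : ∀ {b c : ℤ} {x y : S}, x ∈ 𝒮 b → y ∈ 𝒮 c →
      x * y = (b * c).negOnePow • (y * x)) [SetLike.GradedMonoid 𝒮]
    (E : ℤ) {b c : ℤ} {v w : S} (hv : v ∈ 𝒮 b) (hw : w ∈ 𝒮 c) (μ ν : M) :
    derOp (K := K) 𝒮 E b v μ * derOp 𝒮 E c w ν =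
      derOp 𝒮 E (b + c) (v * w)
        ((E * b).negOnePow • v • ν + ((E + b) * c).negOnePow • w • μ) := by
  have key : ∀ s : S, (E * b).negOnePow • v • gsign 𝒮 (E + c) s • ν +
      gsign 𝒮 (E + b) (w * s) • μ = gsign 𝒮 (E + (b + c)) s •
        ((E * b).negOnePow • v • ν + ((E + b) * c).negOnePow • w • μ) := by
    intro s
    induction s using DirectSum.Decomposition.inductionOn 𝒮 with
    | zero => simp
    | add s t hs ht =>
      refine Eq.trans ?_ ((congrArg₂ (· + ·) hs ht).trans ?_) <;>
        simp only [mul_add, map_add, add_smul, smul_add] <;> abel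
    | @homogeneous d s =>
      rw [gsign_apply _ _ _ _ s.2, gsign_apply _ _ _ _ s.2,
        gsign_apply _ _ _ _ (SetLike.mul_mem_graded hw s.2)]
      simp only [smul_add, smul_assoc, smul_comm v (_ : ℤˣ), smul_comm (s : S) (_ : ℤˣ),
        negOnePow_smul_smul, smul_smul v, smul_smul (s : S)]
      rw [hcomm hv s.2, hcomm hw s.2]
      simp only [smul_assoc, negOnePow_smul_smul]
      refine congrArg₂ _ ?_ ?_ <;> apply negOnePow_smul_eq <;> simp only [parity_simps] <;> grind
  refine LinearMap.ext fun x => ?_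
  rw [Module.End.mul_apply, derOp_apply, derOp_apply, derOp_apply, mul_assoc, ← key]
  refine Prod.ext rfl ?_
  simp only [smul_add, smul_comm v (_ : ℤˣ), negOnePow_smul_smul, smul_smul v, mul_add, add_assoc]
end

/-- A derivation of the graded symmetric algebra with values in a module can be prescribed on
generators. -/
theorem IsSymAlg.exists_derivation.{u} {S M : Type u} [Ring S] [Algebra K S] {sc : A →ₐ[K] S}
    {vc : L →ₗ[K] S} {𝒮 : ℤ → Submodule K S} (hS : IsSymAlg 𝒜 ℒ sc vc 𝒮) [GradedAlgebra 𝒜]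
    (hA : GradedComm 𝒜) [Decomposition ℒ] [SetLike.GradedSMul 𝒜 ℒ] [Decomposition 𝒮]
    [AddCommGroup M] [Module K M] [Module S M] [IsScalarTower K S M] (E : ℤ)
    (α : A →ₗ[K] M) (β : L →ₗ[K] M)
    (hα : ∀ b, ∀ a ∈ 𝒜 b, ∀ c, ∀ a' ∈ 𝒜 c, α (a * a') =
      (E * b).negOnePow • sc a • α a' + ((E + b) * c).negOnePow • sc a' • α a)
    (hβ : ∀ b, ∀ a ∈ 𝒜 b, ∀ c, ∀ ξ ∈ ℒ c, β (a • ξ) =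
      (E * b).negOnePow • sc a • β ξ + ((E + b) * c).negOnePow • vc ξ • α a) :
    ∃ δ : S →ₗ[K] M, (∀ a, δ (sc a) = α a) ∧ (∀ ξ, δ (vc ξ) = β ξ) ∧
      ∀ b, ∀ x ∈ 𝒮 b, ∀ c, ∀ y ∈ 𝒮 c, δ (x * y) =
        (E * b).negOnePow • x • δ y + ((E + b) * c).negOnePow • y • δ x := by
  have := hS.gradedMonoid
  have hcomm : ∀ {b c : ℤ} {x y : S}, x ∈ 𝒮 b → y ∈ 𝒮 c →
      x * y = (b * c).negOnePow • (y * x) := fun hx hy => hS.mul_comm_of_mem hA hx hy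
  have hadd : ∀ (b : ℤ) (v w : S) (μ ν : M), derOp (K := K) 𝒮 E b (v + w) (μ + ν) =
    derOp 𝒮 E b v μ + derOp 𝒮 E b w ν := derOp_add E
  -- The candidate algebra map on generators; by `derOp_mul`, the hypotheses `hα` and `hβ` are the
  -- relations it has to satisfy.
  let φ : A →ₗ[K] Module.End K (S × M) := homLift 𝒜 fun d =>
    { toFun := fun a => derOp 𝒮 E d (sc a) (α a)
      map_add' := fun a b => by simp only [Submodule.coe_add, map_add, derOp_add]
      map_smul' := fun r a => by
        simp only [Submodule.coe_smul, map_smul, derOp_smul, RingHom.id_apply] }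
  let ψ : L →ₗ[K] Module.End K (S × M) := homLift ℒ fun d =>
    { toFun := fun ξ => derOp 𝒮 E d (vc ξ) (β ξ)
      map_add' := fun a b => by simp only [Submodule.coe_add, map_add, derOp_add]
      map_smul' := fun r a => by
        simp only [Submodule.coe_smul, map_smul, derOp_smul, RingHom.id_apply] }
  have hφ : ∀ {d : ℤ} {a : A}, a ∈ 𝒜 d → φ a = derOp 𝒮 E d (sc a) (α a) :=
    fun ha => homLift_apply 𝒜 _ ha
  have hψ : ∀ {d : ℤ} {ξ : L}, ξ ∈ ℒ d → ψ ξ = derOp 𝒮 E d (vc ξ) (β ξ) :=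
    fun ha => homLift_apply ℒ _ ha
  have swap : ∀ {b c : ℤ} {v w : S}, v ∈ 𝒮 b → w ∈ 𝒮 c → ∀ μ ν : M,
      derOp (K := K) 𝒮 E b v μ * derOp 𝒮 E c w ν =
        (c * b).negOnePow • (derOp 𝒮 E c w ν * derOp 𝒮 E b v μ) := by
    intro b c v w hv hw μ ν
    rw [derOp_mul (𝒮 := 𝒮) hcomm E hv hw, derOp_mul (𝒮 := 𝒮) hcomm E hw hv, hcomm hv hw,
      mul_comm b c, ← derOp_negOnePow_smul, add_comm c b, smul_add, negOnePow_smul_smul,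
      negOnePow_smul_smul, add_comm (_ • v • ν)]
    congr 1
    refine congrArg₂ _ ?_ ?_ <;> apply negOnePow_smul_eq <;> simp only [parity_simps] <;> grind
  have h1 : (1 : A) ∈ 𝒜 0 := SetLike.GradedOne.one_mem
  obtain ⟨f, hf1, hf2⟩ := hS.lift φ ψ
    (by
      -- The Leibniz rule for `1 * 1` forces `α 1 = 0`, so the unit goes to the identity.
      have h0 := hα 0 1 h1 0 1 h1
      simp only [mul_one, mul_zero, Int.negOnePow_zero, one_smul, map_one] at h0
      rw [left_eq_add] at h0
      rw [hφ h1, h0, map_one]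
      refine LinearMap.ext fun x => ?_
      simp [derOp_apply])
    (fun b a ha c a' ha' => by
      rw [hφ (SetLike.mul_mem_graded ha ha'), hφ ha, hφ ha',
        derOp_mul hcomm E (hS.sc_mem ha) (hS.sc_mem ha'), hα b a ha c a' ha', map_mul])
    (fun b a ha c ξ hξ => by
      rw [hψ (show a • ξ ∈ ℒ (b + c) from SetLike.GradedSMul.smul_mem ha hξ), hφ ha, hψ hξ,
        derOp_mul hcomm E (hS.sc_mem ha) (hS.vc_mem hξ), hβ b a ha c ξ hξ, hS.vc_smul])
    (fun b a ha c ξ hξ => by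
      rw [hφ ha, hψ hξ]
      exact swap (hS.vc_mem hξ) (hS.sc_mem ha) _ _)
    (fun b ξ hξ c ζ hζ => by
      rw [hψ hζ, hψ hξ, mul_comm b c]
      exact swap (hS.vc_mem hξ) (hS.vc_mem hζ) _ _)
  have one_mem : (1 : S) ∈ 𝒮 0 := SetLike.GradedOne.one_mem
  have eval : ∀ (b : ℤ) (v : S) (μ : M), derOp (K := K) 𝒮 E b v μ (1, 0) = (v, μ) := by
    intro b v μ
    rw [derOp_apply, gsign_apply _ _ _ _ one_mem]
    simp
  -- Evaluation at `(1, 0)` reads off the off-diagonal part.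
  let δ : S →ₗ[K] M := LinearMap.snd K S M ∘ₗ LinearMap.applyₗ ((1, 0) : S × M) ∘ₗ f.toLinearMap
  have hδ : ∀ x, δ x = (f x (1, 0)).2 := fun x => rfl
  have hf : ∀ {b : ℤ} {x : S}, x ∈ 𝒮 b → f x = derOp 𝒮 E b x (δ x) := by
    intro b x hx
    suffices ∃ μ, f x = derOp 𝒮 E b x μ by
      obtain ⟨μ, h⟩ := this
      rw [hδ, h, eval]
    refine hS.grading_induction (p := fun b x => ∃ μ, f x = derOp 𝒮 E b x μ)
      (fun b a ha => ⟨_, by rw [hf1, hφ ha]⟩) (fun b ξ hξ => ⟨_, by rw [hf2, hψ hξ]⟩)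
      ?_ ?_ ?_ hx
    · rintro b x hx c y hy ⟨μ, h⟩ ⟨ν, h'⟩
      exact ⟨_, by rw [map_mul, h, h', derOp_mul hcomm E hx hy]⟩
    · exact fun b => ⟨0, by simpa using (derOp_smul (𝒮 := 𝒮) E b (0 : K) (0 : S) (0 : M)).symm⟩
    · rintro b x hx y hy ⟨μ, h⟩ ⟨ν, h'⟩
      exact ⟨_, by rw [map_add, h, h', derOp_add]⟩
  refine ⟨δ, fun a => ?_, fun ξ => ?_, fun b x hx c y hy => ?_⟩
  · induction a using DirectSum.Decomposition.inductionOn 𝒜 with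
    | zero => simp
    | add a b ha hb => rw [map_add, map_add, ha, hb, map_add]
    | homogeneous a => rw [hδ, hf1, hφ a.2, eval]
  · induction ξ using DirectSum.Decomposition.inductionOn ℒ with
    | zero => simp
    | add a b ha hb => rw [map_add, map_add, ha, hb, map_add]
    | homogeneous ξ => rw [hδ, hf2, hψ ξ.2, eval]
  · rw [hδ, map_mul, hf hx, hf hy, derOp_mul hcomm E hx hy, eval]

end Derivations

/-! ### Operations on multiderivations; admissible values on generators. -/

section MultiDerivations

variable {K S R : Type*} [Field K] [Ring S] [Algebra K S] [Ring R] [Algebra K R]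
  {𝒮 : ℤ → Submodule K S} {ρ : S →ₐ[K] R} {E : ℤ} {F G : List (ℤ × S) → R}

namespace IsMultiDer

theorem add_map (hF : IsMultiDer 𝒮 ρ E F) (hG : IsMultiDer 𝒮 ρ E G) :
    IsMultiDer 𝒮 ρ E fun l => F l + G l where
  symm := hF.symm.add hG.symm
  add d x y l hx hy hl := by rw [hF.add d x y l hx hy hl, hG.add d x y l hx hy hl]; abel
  leib b x c y l hx hy hl := by
    rw [hF.leib b x c y l hx hy hl, hG.leib b x c y l hx hy hl]
    simp only [mul_add, add_mul, smul_add]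
    abel

theorem smul_map (r : K) (hF : IsMultiDer 𝒮 ρ E F) : IsMultiDer 𝒮 ρ E fun l => r • F l where
  symm := hF.symm.smul r
  add d x y l hx hy hl := by rw [hF.add d x y l hx hy hl, smul_add]
  leib b x c y l hx hy hl := by
    rw [hF.leib b x c y l hx hy hl, smul_add, mul_smul_comm, smul_mul_assoc, smul_comm r,
      smul_comm r]

theorem negOnePow_smul (e : ℤ) (hF : IsMultiDer 𝒮 ρ E F) :
    IsMultiDer 𝒮 ρ E fun l => e.negOnePow • F l := by
  simpa only [Units.smul_def, Int.cast_smul_eq_zsmul] using hF.smul_map (((e.negOnePow : ℤ) : K))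

theorem mul_left (hρ : ∀ {b c : ℤ} {x y : S}, x ∈ 𝒮 b → y ∈ 𝒮 c →
      x * y = (b * c).negOnePow • (y * x)) (hF : IsMultiDer 𝒮 ρ E F) {e : ℤ} {z : S}
    (hz : z ∈ 𝒮 e) : IsMultiDer 𝒮 ρ (e + E) fun l => ρ z * F l where
  symm := hF.symm.map (AddMonoidHom.mulLeft (ρ z))
  add d x y l hx hy hl := by rw [hF.add d x y l hx hy hl, mul_add]
  leib b x c y l hx hy hl := by
    have h : ρ z * ρ x = (e * b).negOnePow • (ρ x * ρ z) := by
      rw [← map_mul, hρ hz hx, Units.smul_def, map_zsmul, map_mul, Units.smul_def]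
    rw [hF.leib b x c y l hx hy hl, mul_add, mul_smul_comm, mul_smul_comm, ← mul_assoc, h,
      smul_mul_assoc, negOnePow_smul_smul, mul_assoc, mul_assoc]
    congr 2
    rw [add_mul, add_comm]

/-- Fixing the first entry of a multiderivation. -/
theorem cons [SetLike.GradedMonoid 𝒮] (hF : IsMultiDer 𝒮 ρ E F) {z : ℤ × S} (hz : z ∈ homog 𝒮) :
    IsMultiDer 𝒮 ρ (z.1 + E) fun l => F (z :: l) where
  symm := hF.symm.cons hz
  add d x y l hx hy hl := by
    rw [hF.symm.swap hz (show (d, x + y) ∈ homog 𝒮 from add_mem hx hy) hl, hF.add d x y _ hx hy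
      (List.forall_mem_cons.mpr ⟨hz, hl⟩), smul_add, ← hF.symm.swap hz (y := (d, x)) hx hl,
      ← hF.symm.swap hz (y := (d, y)) hy hl]
  leib b x c y l hx hy hl := by
    have h : x * y ∈ 𝒮 (b + c) := SetLike.mul_mem_graded hx hy
    rw [hF.symm.swap hz (show (b + c, x * y) ∈ homog 𝒮 from h) hl,
      hF.leib b x c y _ hx hy (List.forall_mem_cons.mpr ⟨hz, hl⟩),
      hF.symm.swap (y := z) (x := (b, x)) hx hz hl, hF.symm.swap (y := z) (x := (c, y)) hy hz hl]
    simp only [smul_add, negOnePow_smul_smul, mul_smul_comm, smul_mul_assoc, ldeg_cons]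
    refine congrArg₂ _ ?_ ?_ <;> apply negOnePow_smul_eq <;> simp only [parity_simps] <;> grind

end IsMultiDer

/-- Two additive functions of a tensor with the same Leibniz rule agree if they agree on
generators. -/
theorem IsSymAlg.leibniz_ext {A L M : Type*} [Ring A] [Algebra K A] [AddCommGroup L] [Module K L]
    [Module A L] {𝒜 : ℤ → Submodule K A} {ℒ : ℤ → Submodule K L} {sc : A →ₐ[K] S} {vc : L →ₗ[K] S}
    (hS : IsSymAlg 𝒜 ℒ sc vc 𝒮) [GradedAlgebra 𝒜] [AddCommGroup M] {P Q : ℤ × S → M}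
    (φ : ∀ (_ : ℤ) (_ : S) (_ : ℤ) (_ : S), M → M → M)
    (hP : ∀ b x c y, x ∈ 𝒮 b → y ∈ 𝒮 c → P (b + c, x * y) = φ b x c y (P (b, x)) (P (c, y)))
    (hQ : ∀ b x c y, x ∈ 𝒮 b → y ∈ 𝒮 c → Q (b + c, x * y) = φ b x c y (Q (b, x)) (Q (c, y)))
    (hP' : ∀ b x y, x ∈ 𝒮 b → y ∈ 𝒮 b → P (b, x + y) = P (b, x) + P (b, y))
    (hQ' : ∀ b x y, x ∈ 𝒮 b → y ∈ 𝒮 b → Q (b, x + y) = Q (b, x) + Q (b, y))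
    (h : ∀ g ∈ homGen 𝒜 ℒ, P (g.1, ofGen sc vc g.2) = Q (g.1, ofGen sc vc g.2))
    {x : ℤ × S} (hx : x ∈ homog 𝒮) : P x = Q x := by
  refine hS.grading_induction (p := fun d x => P (d, x) = Q (d, x))
    (fun b a ha => h (b, Sum.inl a) ha) (fun b ξ hξ => h (b, Sum.inr ξ) hξ)
    (fun b x hx c y hy h h' => ?_) (fun b => ?_) (fun b x hx y hy h h' => ?_) hx
  · rw [hP b x c y hx hy, hQ b x c y hx hy, h, h']
  · have h1 := hP' b 0 0 (zero_mem _) (zero_mem _)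
    have h2 := hQ' b 0 0 (zero_mem _) (zero_mem _)
    rw [add_zero, left_eq_add] at h1 h2
    rw [h1, h2]
  · rw [hP' b x y hx hy, hQ' b x y hx hy, h, h']

/-- A multilinear map of degree `E` that is a graded symmetric multiderivation. -/
structure IsDerMap (𝒮 : ℤ → Submodule K S) (E : ℤ) {n : ℕ}
    (F : MultilinearMap K (fun _ : Fin n => S) S) : Prop where
  degree : ∀ l, (∀ p ∈ l, p ∈ homog 𝒮) → lev F l ∈ 𝒮 (E + ldeg l)
  der : IsMultiDer 𝒮 (AlgHom.id K S) E (lev F)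

namespace IsDerMap

variable {n : ℕ} {F G : MultilinearMap K (fun _ : Fin n => S) S}

theorem add (hF : IsDerMap 𝒮 E F) (hG : IsDerMap 𝒮 E G) : IsDerMap 𝒮 E (F + G) where
  degree l hl := by rw [lev_add]; exact add_mem (hF.degree l hl) (hG.degree l hl)
  der := by simpa only [← lev_add] using hF.der.add_map hG.der

theorem smul (r : K) (hF : IsDerMap 𝒮 E F) : IsDerMap 𝒮 E (r • F) where
  degree l hl := by rw [lev_smul]; exact Submodule.smul_mem _ r (hF.degree l hl)
  der := by simpa only [← lev_smul] using hF.der.smul_map r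

theorem negOnePow_smul (e : ℤ) (hF : IsDerMap 𝒮 E F) : IsDerMap 𝒮 E (e.negOnePow • F) := by
  rw [Units.smul_def, ← Int.cast_smul_eq_zsmul K]
  exact hF.smul _

theorem mul_left [SetLike.GradedMonoid 𝒮] (h𝒮 : ∀ {b c : ℤ} {x y : S}, x ∈ 𝒮 b → y ∈ 𝒮 c →
      x * y = (b * c).negOnePow • (y * x)) (hF : IsDerMap 𝒮 E F) {e : ℤ} {z : S}
    (hz : z ∈ 𝒮 e) : IsDerMap 𝒮 (e + E) (z • F) where
  degree l hl := by
    rw [lev_smul, add_assoc]; exact SetLike.mul_mem_graded hz (hF.degree l hl)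
  der := by
    have := hF.der.mul_left h𝒮 hz
    simpa only [AlgHom.id_apply, ← smul_eq_mul, ← lev_smul] using this

variable {A L : Type*} [Ring A] [Algebra K A] [AddCommGroup L] [Module K L]
    [Module A L] {𝒜 : ℤ → Submodule K A} {ℒ : ℤ → Submodule K L} {sc : A →ₐ[K] S} {vc : L →ₗ[K] S}

theorem eq_of_gens (hS : IsSymAlg 𝒜 ℒ sc vc 𝒮) [GradedAlgebra 𝒜] [Decomposition 𝒮]
    (hF : IsDerMap 𝒮 E F) (hG : IsDerMap 𝒮 E G)
    (h : ∀ g, g.length = n → (∀ p ∈ g, p ∈ homGen 𝒜 ℒ) →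
      lev F (ofGens sc vc g) = lev G (ofGens sc vc g)) : F = G := by
  refine ext_lev (𝒱 := 𝒮) fun l _ hl => IsMultiDer.ext hS hF.der hG.der (fun g hg => ?_) l hl
  rcases eq_or_ne g.length n with hn | hn
  · exact h g hn hg
  · rw [lev_of_ne _ (by simpa [ofGens] using hn), lev_of_ne _ (by simpa [ofGens] using hn)]

end IsDerMap

/-- Functions on lists of generators that satisfy the relations of the values of a
multiderivation. -/
structure IsGenDer {A L : Type*} [Ring A] [Algebra K A] [AddCommGroup L] [Module K L]
    [Module A L] (𝒜 : ℤ → Submodule K A) (ℒ : ℤ → Submodule K L) (sc : A →ₐ[K] S) (vc : L →ₗ[K] S)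
    (𝒮 : ℤ → Submodule K S) (E : ℤ) (β : List (ℤ × (A ⊕ L)) → S) : Prop where
  symm : LSymm (homGen 𝒜 ℒ) β
  degree : ∀ g, (∀ p ∈ g, p ∈ homGen 𝒜 ℒ) → β g ∈ 𝒮 (E + ldeg g)
  scalar_add : ∀ d a a' g, a ∈ 𝒜 d → a' ∈ 𝒜 d → (∀ p ∈ g, p ∈ homGen 𝒜 ℒ) →
    β ((d, Sum.inl (a + a')) :: g) = β ((d, Sum.inl a) :: g) + β ((d, Sum.inl a') :: g)
  vector_add : ∀ d ξ ζ g, ξ ∈ ℒ d → ζ ∈ ℒ d → (∀ p ∈ g, p ∈ homGen 𝒜 ℒ) →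
    β ((d, Sum.inr (ξ + ζ)) :: g) = β ((d, Sum.inr ξ) :: g) + β ((d, Sum.inr ζ) :: g)
  scalar_smul : ∀ d a (r : K) g, a ∈ 𝒜 d → (∀ p ∈ g, p ∈ homGen 𝒜 ℒ) →
    β ((d, Sum.inl (r • a)) :: g) = r • β ((d, Sum.inl a) :: g)
  vector_smul : ∀ d ξ (r : K) g, ξ ∈ ℒ d → (∀ p ∈ g, p ∈ homGen 𝒜 ℒ) →
    β ((d, Sum.inr (r • ξ)) :: g) = r • β ((d, Sum.inr ξ) :: g)
  mul : ∀ b a c a' g, a ∈ 𝒜 b → a' ∈ 𝒜 c → (∀ p ∈ g, p ∈ homGen 𝒜 ℒ) →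
    β ((b + c, Sum.inl (a * a')) :: g) = (E * b).negOnePow • (sc a * β ((c, Sum.inl a') :: g)) +
      (c * ldeg g).negOnePow • (β ((b, Sum.inl a) :: g) * sc a')
  smul : ∀ b a c ξ g, a ∈ 𝒜 b → ξ ∈ ℒ c → (∀ p ∈ g, p ∈ homGen 𝒜 ℒ) →
    β ((b + c, Sum.inr (a • ξ)) :: g) = (E * b).negOnePow • (sc a * β ((c, Sum.inr ξ) :: g)) +
      (c * ldeg g).negOnePow • (β ((b, Sum.inl a) :: g) * vc ξ)

end MultiDerivations

/-! ### Existence of multiderivations with prescribed values on generators. -/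

section Extension

universe u
variable {K A L : Type*} {S : Type u} [Field K] [Ring S] [Algebra K S]
  [Ring A] [Algebra K A] [AddCommGroup L] [Module K L] [Module A L]
  {𝒜 : ℤ → Submodule K A} {ℒ : ℤ → Submodule K L} {sc : A →ₐ[K] S} {vc : L →ₗ[K] S}
  {𝒮 : ℤ → Submodule K S} {E : ℤ} {β : List (ℤ × (A ⊕ L)) → S}

/-- Fixing the first generator. -/
theorem IsGenDer.cons [GradedAlgebra 𝒜] [SetLike.GradedSMul 𝒜 ℒ]
    (hβ : IsGenDer 𝒜 ℒ sc vc 𝒮 E β) {v : ℤ × (A ⊕ L)} (hv : v ∈ homGen 𝒜 ℒ) :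
    IsGenDer 𝒜 ℒ sc vc 𝒮 (v.1 + E) fun g => β (v :: g) where
  symm := hβ.symm.cons hv
  degree g hg := by
    have := hβ.degree (v :: g) (List.forall_mem_cons.mpr ⟨hv, hg⟩)
    rw [ldeg_cons] at this
    convert this using 2
    ring
  scalar_add d a a' g ha ha' hg := by
    have hg' := List.forall_mem_cons.mpr ⟨hv, hg⟩
    rw [hβ.symm.swap hv (y := (d, Sum.inl (a + a'))) (add_mem ha ha') hg,
      hβ.symm.swap hv (y := (d, Sum.inl a)) ha hg, hβ.symm.swap hv (y := (d, Sum.inl a')) ha' hg,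
      hβ.scalar_add d a a' _ ha ha' hg', smul_add]
  vector_add d a a' g ha ha' hg := by
    have hg' := List.forall_mem_cons.mpr ⟨hv, hg⟩
    rw [hβ.symm.swap hv (y := (d, Sum.inr (a + a'))) (add_mem ha ha') hg,
      hβ.symm.swap hv (y := (d, Sum.inr a)) ha hg, hβ.symm.swap hv (y := (d, Sum.inr a')) ha' hg,
      hβ.vector_add d a a' _ ha ha' hg', smul_add]
  scalar_smul d a r g ha hg := by
    have hg' := List.forall_mem_cons.mpr ⟨hv, hg⟩
    rw [hβ.symm.swap hv (y := (d, Sum.inl (r • a))) (Submodule.smul_mem _ r ha) hg,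
      hβ.symm.swap hv (y := (d, Sum.inl a)) ha hg, hβ.scalar_smul d a r _ ha hg', smul_comm r]
  vector_smul d a r g ha hg := by
    have hg' := List.forall_mem_cons.mpr ⟨hv, hg⟩
    rw [hβ.symm.swap hv (y := (d, Sum.inr (r • a))) (Submodule.smul_mem _ r ha) hg,
      hβ.symm.swap hv (y := (d, Sum.inr a)) ha hg, hβ.vector_smul d a r _ ha hg', smul_comm r]
  mul b a c a' g ha ha' hg := by
    have hg' := List.forall_mem_cons.mpr ⟨hv, hg⟩
    rw [hβ.symm.swap hv (y := (b + c, Sum.inl (a * a')))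
        (show a * a' ∈ 𝒜 (b + c) from SetLike.mul_mem_graded ha ha') hg,
      hβ.symm.swap hv (y := (b, Sum.inl a)) ha hg, hβ.symm.swap hv (y := (c, Sum.inl a')) ha' hg,
      hβ.mul b a c a' _ ha ha' hg']
    simp only [smul_add, negOnePow_smul_smul, mul_smul_comm, smul_mul_assoc, ldeg_cons]
    refine congrArg₂ _ ?_ ?_ <;> apply negOnePow_smul_eq <;> simp only [parity_simps] <;> grind
  smul b a c a' g ha ha' hg := by
    have hg' := List.forall_mem_cons.mpr ⟨hv, hg⟩
    rw [hβ.symm.swap hv (y := (b + c, Sum.inr (a • a')))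
        (show a • a' ∈ ℒ (b + c) from SetLike.GradedSMul.smul_mem ha ha') hg,
      hβ.symm.swap hv (y := (b, Sum.inl a)) ha hg, hβ.symm.swap hv (y := (c, Sum.inr a')) ha' hg,
      hβ.smul b a c a' _ ha ha' hg']
    simp only [smul_add, negOnePow_smul_smul, mul_smul_comm, smul_mul_assoc, ldeg_cons]
    refine congrArg₂ _ ?_ ?_ <;> apply negOnePow_smul_eq <;> simp only [parity_simps] <;> grind

/-- A derivation with values in multiderivations that is symmetric on generators is a
multiderivation. -/
theorem IsSymAlg.isDerMap_uncurryLeft (hS : IsSymAlg 𝒜 ℒ sc vc 𝒮) [GradedAlgebra 𝒜]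
    (hA : GradedComm 𝒜) {n : ℕ} (hβ : LSymm (homGen 𝒜 ℒ) β)
    {δ : S →ₗ[K] MultilinearMap K (fun _ : Fin n => S) S}
    (hδ : ∀ b, ∀ x ∈ 𝒮 b, ∀ c, ∀ y ∈ 𝒮 c, δ (x * y) =
        (E * b).negOnePow • x • δ y + ((E + b) * c).negOnePow • y • δ x)
    (h : ∀ v ∈ homGen 𝒜 ℒ, IsDerMap 𝒮 (v.1 + E) (δ (ofGen sc vc v.2)))
    (hg : ∀ g, g.length = n + 1 → (∀ p ∈ g, p ∈ homGen 𝒜 ℒ) →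
      lev (LinearMap.uncurryLeft δ) (ofGens sc vc g) = β g) :
    IsDerMap 𝒮 E (LinearMap.uncurryLeft δ) := by
  have := hS.gradedMonoid
  have hcomm : ∀ {b c : ℤ} {x y : S}, x ∈ 𝒮 b → y ∈ 𝒮 c →
      x * y = (b * c).negOnePow • (y * x) := fun hx hy => hS.mul_comm_of_mem hA hx hy
  have hc : ∀ (x : ℤ × S) l, lev (LinearMap.uncurryLeft δ) (x :: l) = lev (δ x.2) l := by
    intro x l
    rw [lev_cons]
    congr 1
  -- Multiderivations are stable under sums and under multiplication by tensors, so the Leibniz rule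
  -- of `δ` carries the property from generators to all tensors.
  have hD : ∀ {b : ℤ} {x : S}, x ∈ 𝒮 b → IsDerMap 𝒮 (b + E) (δ x) := by
    intro b x hx
    refine hS.grading_induction (p := fun b x => IsDerMap 𝒮 (b + E) (δ x))
      (fun b a ha => h (b, Sum.inl a) ha) (fun b ξ hξ => h (b, Sum.inr ξ) hξ) ?_ ?_ ?_ hx
    · intro b x hx c y hy h1 h2
      rw [hδ b x hx c y hy]
      refine IsDerMap.add ?_ ?_
      · rw [add_assoc]; exact (h2.mul_left hcomm hx).negOnePow_smul _
      · rw [add_comm b, add_assoc]; exact (h1.mul_left hcomm hy).negOnePow_smul _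
    · intro b
      rw [map_zero]
      have := (h (b, Sum.inl 0) (zero_mem (𝒜 b))).smul (0 : K)
      rwa [zero_smul] at this
    · intro b x _ y _ h1 h2
      rw [map_add]
      exact h1.add h2
  have hleib : ∀ b x c y l, x ∈ 𝒮 b → y ∈ 𝒮 c → (∀ p ∈ l, p ∈ homog 𝒮) →
      lev (LinearMap.uncurryLeft δ) ((b + c, x * y) :: l) =
        (E * b).negOnePow • (x * lev (LinearMap.uncurryLeft δ) ((c, y) :: l)) +
      (c * ldeg l).negOnePow • (lev (LinearMap.uncurryLeft δ) ((b, x) :: l) * y) := by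
    intro b x c y l hx hy hl
    simp only [hc]
    rw [hδ b x hx c y hy, lev_add, lev_smul, lev_smul, lev_smul, lev_smul, smul_eq_mul,
      smul_eq_mul, hcomm hy ((hD hx).degree l hl), negOnePow_smul_smul]
    congr 1
    apply negOnePow_smul_eq
    simp only [parity_simps]; grind
  refine ⟨fun l hl => ?_, ?_, fun d x y l _ _ _ => lev_add_cons _ d x y l, hleib⟩
  · cases l with
    | nil => rw [lev_of_ne _ (by simp)]; exact zero_mem _
    | cons x l =>
      rw [List.forall_mem_cons] at hl
      rw [hc, ldeg_cons]
      convert (hD hl.1).degree l hl.2 using 2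
      ring
  -- The symmetry of the first two entries is the only point left. As functions of `y`, both sides
  -- obey the same Leibniz rule, by that of `δ x` and by `hleib` respectively, so `y` may be taken
  -- to be a generator.
  · have key : ∀ x ∈ homog 𝒮, ∀ l, (∀ p ∈ l, p ∈ homog 𝒮) →
        (∀ v ∈ homGen 𝒜 ℒ, lev (δ x.2) ((v.1, ofGen sc vc v.2) :: l) =
          (x.1 * v.1).negOnePow • lev (LinearMap.uncurryLeft δ)
            ((v.1, ofGen sc vc v.2) :: x :: l)) →
        ∀ y ∈ homog 𝒮, lev (δ x.2) (y :: l) =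
          (x.1 * y.1).negOnePow • lev (LinearMap.uncurryLeft δ) (y :: x :: l) := by
      intro x hx l hl hv y hy
      have hxl := List.forall_mem_cons.mpr ⟨hx, hl⟩
      refine hS.leibniz_ext (P := fun y => lev (δ x.2) (y :: l))
        (Q := fun y => (x.1 * y.1).negOnePow • lev (LinearMap.uncurryLeft δ) (y :: x :: l))
        (fun b y c z p q => ((x.1 + E) * b).negOnePow • (y * q) +
          (c * ldeg l).negOnePow • (p * z)) ?_ ?_ ?_ ?_ hv hy
      · intro b y c z hy hz
        exact (hD hx).der.leib b y c z l hy hz hl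
      · intro b y c z hy hz
        simp only
        rw [hleib b y c z _ hy hz hxl]
        simp only [smul_add, negOnePow_smul_smul, mul_smul_comm, smul_mul_assoc, ldeg_cons]
        refine congrArg₂ _ ?_ ?_ <;> apply negOnePow_smul_eq <;> simp only [parity_simps] <;> grind
      · intro b y z _ _
        exact lev_add_cons _ _ _ _ _
      · intro b y z _ _
        simp only
        rw [lev_add_cons, smul_add]
    refine LSymm.of_cons (fun x hx => ?_) fun x hx y hy l hl => ?_
    · simp only [hc]
      exact (hD hx).der.symm
    · rw [hc]
      refine key x hx l hl (fun v hv => ?_) y hy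
      have hv' := ofGen_mem hS hv
      -- With the second entry a generator `v`, the same reduction applies to the first entry `x`.
      -- Once both are generators, the remaining entries are reduced to generators by
      -- `IsMultiDer.ext`, and there `β` is symmetric.
      have h1 := key (v.1, ofGen sc vc v.2) hv' l hl (fun w hw => ?_) x hx
      · rw [hc, h1, hc, negOnePow_smul_smul, mul_comm, ← two_mul, Int.negOnePow_two_mul, one_smul]
      · have hw' := ofGen_mem hS hw
        rw [hc]
        refine IsMultiDer.ext hS ((hD hv').der.cons (z := (w.1, ofGen sc vc w.2)) hw')
          (G := fun l => (v.1 * w.1).negOnePow •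
            lev (δ (ofGen sc vc w.2)) ((v.1, ofGen sc vc v.2) :: l)) ?_ (fun g hgm => ?_) l hl
        · rw [add_left_comm]
          exact ((hD hw').der.cons (z := (v.1, ofGen sc vc v.2)) hv').negOnePow_smul _
        · rcases eq_or_ne (g.length + 1) n with hn | hn
          · have e1 := hg (v :: w :: g) (by simpa using hn)
              (List.forall_mem_cons.mpr ⟨hv, List.forall_mem_cons.mpr ⟨hw, hgm⟩⟩)
            have e2 := hg (w :: v :: g) (by simpa using hn)
              (List.forall_mem_cons.mpr ⟨hw, List.forall_mem_cons.mpr ⟨hv, hgm⟩⟩)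
            simp only [ofGens, List.map_cons, hc] at e1 e2
            simp only [ofGens]
            rw [e1, e2, hβ.swap hv hw hgm]
          · rw [lev_of_ne _ (by simpa [ofGens] using hn), lev_of_ne _ (by simpa [ofGens] using hn),
              smul_zero]

/-- Multiderivations of the graded symmetric algebra can be prescribed on generators. -/
theorem IsSymAlg.exists_isDerMap (hS : IsSymAlg 𝒜 ℒ sc vc 𝒮) [GradedAlgebra 𝒜]
    (hA : GradedComm 𝒜) [Decomposition ℒ] [SetLike.GradedSMul 𝒜 ℒ] [Decomposition 𝒮]
    (n : ℕ) (hβ : IsGenDer 𝒜 ℒ sc vc 𝒮 E β) :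
    ∃ F : MultilinearMap K (fun _ : Fin n => S) S, IsDerMap 𝒮 E F ∧
      ∀ g, g.length = n → (∀ p ∈ g, p ∈ homGen 𝒜 ℒ) → lev F (ofGens sc vc g) = β g := by
  have := hS.gradedMonoid
  have hcomm : ∀ {b c : ℤ} {x y : S}, x ∈ 𝒮 b → y ∈ 𝒮 c →
      x * y = (b * c).negOnePow • (y * x) := fun hx hy => hS.mul_comm_of_mem hA hx hy
  induction n generalizing E β with
  | zero =>
    have hl : ∀ (x : ℤ × S) l,
      lev (MultilinearMap.constOfIsEmpty K (fun _ : Fin 0 => S) (β [])) (x :: l) = 0 :=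
      fun x l => lev_of_ne _ (by simp)
    refine ⟨MultilinearMap.constOfIsEmpty K _ (β []), ⟨fun l hl => ?_, ?_, ?_, ?_⟩,
      fun g hg _ => ?_⟩
    · cases l with
      | nil => rw [lev_nil _ Fin.elim0]; exact hβ.degree [] (by simp)
      | cons x l => rw [lev_zero_cons]; exact zero_mem _
    · intro pre x y post _
      rw [lev_of_ne _ (by simp), lev_of_ne _ (by simp), smul_zero]
    · intro d x y l _ _ _
      rw [hl, hl, hl, add_zero]
    · intro b x c y l _ _ _
      rw [hl, hl, hl]; simp
    · rw [List.length_eq_zero_iff] at hg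
      subst hg
      exact lev_nil _ Fin.elim0
  | succ n ih =>
    -- Inserting a first generator lowers the number of entries by one; the resulting maps are the
    -- values on generators of the derivation sought.
    choose Φ hΦ1 hΦ2 using fun (v : ℤ × (A ⊕ L)) (hv : v ∈ homGen 𝒜 ℒ) => ih (hβ.cons hv)
    have hD : ∀ (d : ℤ) (x : A ⊕ L) (hx : (d, x) ∈ homGen 𝒜 ℒ), IsDerMap 𝒮 (d + E) (Φ (d, x) hx) :=
      fun d x hx => hΦ1 (d, x) hx
    have : IsScalarTower K S (MultilinearMap K (fun _ : Fin n => S) S) :=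
      ⟨fun r s F => MultilinearMap.ext fun v => smul_assoc r s (F v)⟩
    have hl : ∀ {d : ℤ} {a : A}, a ∈ 𝒜 d → (d, Sum.inl a) ∈ homGen 𝒜 ℒ := fun h => h
    have hr : ∀ {d : ℤ} {ξ : L}, ξ ∈ ℒ d → (d, Sum.inr ξ) ∈ homGen 𝒜 ℒ := fun h => h
    -- The maps `Φ` were chosen separately for each generator; linearity in the generator comes from
    -- the fact that multiderivations are determined by generators.
    let α : A →ₗ[K] MultilinearMap K (fun _ : Fin n => S) S := homLift 𝒜 fun d =>
      { toFun := fun a => Φ (d, Sum.inl a) (hl a.2)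
        map_add' := fun a b => by
          refine IsDerMap.eq_of_gens hS (hD _ _ _) ((hD _ _ _).add (hD _ _ _))
            fun g hn hg => ?_
          rw [lev_add, hΦ2 _ _ g hn hg, hΦ2 _ _ g hn hg, hΦ2 _ _ g hn hg]
          exact hβ.scalar_add d a b g a.2 b.2 hg
        map_smul' := fun r a => by
          refine IsDerMap.eq_of_gens hS (hD _ _ _) ((hD _ _ _).smul r) fun g hn hg => ?_
          rw [lev_smul, hΦ2 _ _ g hn hg, hΦ2 _ _ g hn hg]
          exact hβ.scalar_smul d a r g a.2 hg }
    let γ : L →ₗ[K] MultilinearMap K (fun _ : Fin n => S) S := homLift ℒ fun d =>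
      { toFun := fun a => Φ (d, Sum.inr a) (hr a.2)
        map_add' := fun a b => by
          refine IsDerMap.eq_of_gens hS (hD _ _ _) ((hD _ _ _).add (hD _ _ _))
            fun g hn hg => ?_
          rw [lev_add, hΦ2 _ _ g hn hg, hΦ2 _ _ g hn hg, hΦ2 _ _ g hn hg]
          exact hβ.vector_add d a b g a.2 b.2 hg
        map_smul' := fun r a => by
          refine IsDerMap.eq_of_gens hS (hD _ _ _) ((hD _ _ _).smul r) fun g hn hg => ?_
          rw [lev_smul, hΦ2 _ _ g hn hg, hΦ2 _ _ g hn hg]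
          exact hβ.vector_smul d a r g a.2 hg }
    have hα : ∀ {d : ℤ} {a : A} (ha : a ∈ 𝒜 d), α a = Φ (d, Sum.inl a) (hl ha) :=
      fun ha => homLift_apply 𝒜 _ ha
    have hγ : ∀ {d : ℤ} {a : L} (ha : a ∈ ℒ d), γ a = Φ (d, Sum.inr a) (hr ha) :=
      fun ha => homLift_apply ℒ _ ha
    -- Both sides are multiderivations of the same degree, so a Leibniz rule between values on
    -- generators is one between maps.
    have rel : ∀ {b c : ℤ} {x y : S} {F G H : MultilinearMap K (fun _ : Fin n => S) S},
        x ∈ 𝒮 b → y ∈ 𝒮 c → IsDerMap 𝒮 (b + E) F → IsDerMap 𝒮 (c + E) G →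
        IsDerMap 𝒮 (b + c + E) H → (∀ g, g.length = n → (∀ p ∈ g, p ∈ homGen 𝒜 ℒ) →
          lev H (ofGens sc vc g) = (E * b).negOnePow • (x * lev G (ofGens sc vc g)) +
            (c * ldeg g).negOnePow • (lev F (ofGens sc vc g) * y)) →
        H = (E * b).negOnePow • x • G + ((E + b) * c).negOnePow • y • F := by
      intro b c x y F G H hx hy hF hG hH h
      refine IsDerMap.eq_of_gens hS hH (IsDerMap.add ?_ ?_) fun g hn hg => ?_
      · rw [add_assoc]; exact (hG.mul_left hcomm hx).negOnePow_smul _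
      · rw [add_comm b, add_assoc]; exact (hF.mul_left hcomm hy).negOnePow_smul _
      · rw [h g hn hg, lev_add, lev_smul, lev_smul, lev_smul, lev_smul, smul_eq_mul, smul_eq_mul,
          hcomm hy (hF.degree _ (ofGens_mem hS hg)), negOnePow_smul_smul, ldeg_ofGens]
        congr 1
        apply negOnePow_smul_eq
        simp only [parity_simps]; grind
    obtain ⟨δ, hδ1, hδ2, hδ3⟩ := hS.exists_derivation hA E α γ
      (fun b a ha c a' ha' => by
        rw [hα (SetLike.mul_mem_graded ha ha'), hα ha, hα ha']
        refine rel (hS.sc_mem ha) (hS.sc_mem ha') (hD _ _ _) (hD _ _ _) (hD _ _ _) fun g hn hg => ?_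
        rw [hΦ2 _ _ g hn hg, hΦ2 _ _ g hn hg, hΦ2 _ _ g hn hg]
        exact hβ.mul b a c a' g ha ha' hg)
      (fun b a ha c ξ hξ => by
        rw [hγ (show a • ξ ∈ ℒ (b + c) from SetLike.GradedSMul.smul_mem ha hξ), hα ha, hγ hξ]
        refine rel (hS.sc_mem ha) (hS.vc_mem hξ) (hD _ _ _) (hD _ _ _) (hD _ _ _) fun g hn hg => ?_
        rw [hΦ2 _ _ g hn hg, hΦ2 _ _ g hn hg, hΦ2 _ _ g hn hg]
        exact hβ.smul b a c ξ g ha hξ hg)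
    have hδ : ∀ (v : ℤ × (A ⊕ L)) (hv : v ∈ homGen 𝒜 ℒ), δ (ofGen sc vc v.2) = Φ v hv := by
      rintro ⟨d, a | ξ⟩ hv
      · exact (hδ1 a).trans (hα hv)
      · exact (hδ2 ξ).trans (hγ hv)
    have hg : ∀ g, g.length = n + 1 → (∀ p ∈ g, p ∈ homGen 𝒜 ℒ) →
        lev (LinearMap.uncurryLeft δ) (ofGens sc vc g) = β g := by
      intro g hn hg
      cases g with
      | nil => simp at hn
      | cons v g =>
        rw [List.forall_mem_cons] at hg
        rw [← hΦ2 v hg.1 g (by simpa using hn) hg.2, ← hδ, ofGens, List.map_cons, lev_cons]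
        congr 1
    exact ⟨_, hS.isDerMap_uncurryLeft hA hβ.symm hδ3 (fun v hv => by
      rw [hδ v hv]; exact hΦ1 v hv) hg, hg⟩

end Extension

/-! ### Families of multilinear maps as functions of lists of any length. -/

section Families

variable {K V W : Type*} [Field K] [AddCommGroup V] [Module K V] [AddCommGroup W] [Module K W]
  {F : (n : ℕ) → MultilinearMap K (fun _ : Fin n => V) W} {𝒱 : ℤ → Submodule K V}
  {𝒲 : ℤ → Submodule K W}

theorem shuf_map {V V' M : Type*} [AddCommGroup M] (j : V → V') (l : List (ℤ × V))
    (f : List (ℤ × V') → List (ℤ × V') → M) :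
    shuf (l.map fun x => (x.1, j x.2)) f = shuf l fun a b =>
      f (a.map fun x => (x.1, j x.2)) (b.map fun x => (x.1, j x.2)) := by
  induction l generalizing f with
  | nil => rfl
  | cons x l ih => simp only [List.map_cons, shuf_cons, ih, ldeg_map]

theorem shuf_mem {V : Type*} {p : Submodule K W} {l : List (ℤ × V)}
    {f : List (ℤ × V) → List (ℤ × V) → W}
    (h : ∀ a b, a ⊆ l → b ⊆ l → ldeg a + ldeg b = ldeg l → a.length + b.length = l.length →
      f a b ∈ p) : shuf l f ∈ p := by
  induction l generalizing f with
  | nil => exact h [] [] (by simp) (by simp) (by simp) rfl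
  | cons x l ih =>
    refine add_mem (ih fun a b ha hb hd hl => h _ _ (List.cons_subset_cons x ha)
      (List.subset_cons_of_subset x hb) (by simp only [ldeg_cons]; omega)
      (by simp only [List.length_cons]; omega)) (ih fun a b ha hb hd hl => ?_)
    rw [Units.smul_def]
    exact zsmul_mem (h _ _ (List.subset_cons_of_subset x ha) (List.cons_subset_cons x hb)
      (by simp only [ldeg_cons]; omega) (by simp only [List.length_cons]; omega)) _

/-- The value of a family of multilinear maps on a list. -/
def fev (F : (n : ℕ) → MultilinearMap K (fun _ : Fin n => V) W) (l : List (ℤ × V)) : W :=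
  lev (F l.length) l

theorem fev_eq_lev {l : List (ℤ × V)} {m : ℕ} (h : l.length = m) : fev F l = lev (F m) l := by
  subst h; rfl

theorem fev_ofFn {n : ℕ} (w : Fin n → ℤ × V) : fev F (List.ofFn w) = F n fun i => (w i).2 := by
  rw [fev_eq_lev (List.length_ofFn), lev_ofFn]

theorem fev_cons (x : ℤ × V) (l : List (ℤ × V)) : fev F (x :: l) = lev (F (l.length + 1)) (x :: l) :=
  rfl

theorem fev_symm (h : ∀ n, GradedSymm 𝒱 (F n)) : LSymm (homog 𝒱) (fev F) := by
  intro pre x y post hm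
  have e : (pre ++ y :: x :: post).length = (pre ++ x :: y :: post).length := by simp
  rw [fev_eq_lev e]
  exact gradedSymm_iff.mp (h _) pre x y post hm

theorem fev_mem {e : ℤ} (h : ∀ n, HasDegree 𝒱 𝒲 e (F n)) {l : List (ℤ × V)}
    (hl : ∀ p ∈ l, p ∈ homog 𝒱) : fev F l ∈ 𝒲 (e + ldeg l) :=
  hasDegree_iff.mp (h _) l hl

theorem fev_add_cons (d : ℤ) (x y : V) (l : List (ℤ × V)) :
    fev F ((d, x + y) :: l) = fev F ((d, x) :: l) + fev F ((d, y) :: l) := lev_add_cons _ _ _ _ _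

theorem fev_smul_cons (d : ℤ) (r : K) (x : V) (l : List (ℤ × V)) :
    fev F ((d, r • x) :: l) = r • fev F ((d, x) :: l) := lev_smul_cons _ _ _ _ _

theorem fev_eq_zero {l : List (ℤ × V)} {d : ℤ} (h : (d, 0) ∈ l) : fev F l = 0 := by
  obtain ⟨w, hw⟩ := exists_eq_ofFn l rfl
  rw [hw, List.mem_ofFn] at h
  obtain ⟨i, hi⟩ := h
  rw [hw, fev_ofFn]
  exact (F _).map_coord_zero i (by rw [hi])

theorem fev_ofFn_cons {n : ℕ} (x : ℤ × V) (w : Fin n → ℤ × V) :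
    fev F (x :: List.ofFn w) = F (n + 1) (Fin.cons x.2 fun i => (w i).2) := by
  rw [← List.ofFn_cons, fev_ofFn]
  congr 1
  funext i
  refine Fin.cases ?_ (fun i => ?_) i <;> simp

theorem fev_ofFn_snoc {n : ℕ} (x : ℤ × V) (w : Fin n → ℤ × V) :
    fev F (List.ofFn w ++ [x]) = F (n + 1) (Fin.snoc (fun i => (w i).2) x.2) := by
  have h : List.ofFn w ++ [x] = List.ofFn (Fin.snoc w x : Fin (n + 1) → ℤ × V) := by
    rw [List.ofFn_succ', List.concat_eq_append]
    simp
  rw [h, fev_ofFn]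
  congr 1
  funext i
  refine Fin.lastCases ?_ (fun i => ?_) i <;> simp

end Families

/-! ### Brackets and anchors as admissible values on generators. -/

section BracketsOnGenerators

variable {K A L : Type*} [Field K] [Ring A] [Algebra K A]
  [AddCommGroup L] [Module K L] [Module A L]
  {𝒜 : ℤ → Submodule K A} {ℒ : ℤ → Submodule K L} (X : LRInfinityAlgebra 𝒜 ℒ)
  {S : Type*} [Ring S] [Algebra K S] (sc : A →ₐ[K] S) (vc : L →ₗ[K] S) {𝒮 : ℤ → Submodule K S}

/-- The vector components of a list of generators. -/
def vecPart (g : List (ℤ × (A ⊕ L))) : List (ℤ × L) :=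
  g.map fun x => (x.1, Sum.elim (fun _ => 0) id x.2)

/-- The scalar component of a list consisting of one generator. -/
def scalarPart : List (ℤ × (A ⊕ L)) → A
  | [x] => Sum.elim id (fun _ => 0) x.2
  | _ => 0

/-- The values on generators of the extension of an `LR_∞[1]` structure. -/
def genBracket (g : List (ℤ × (A ⊕ L))) : S :=
  vc (fev X.bracket (vecPart g)) +
    sc (shuf g fun a b => fev X.anchor (vecPart a) (scalarPart b))

theorem vecPart_mem {g : List (ℤ × (A ⊕ L))} (hg : ∀ p ∈ g, p ∈ homGen 𝒜 ℒ) :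
    ∀ p ∈ vecPart g, p ∈ homog ℒ := by
  intro p hp
  obtain ⟨⟨d, a | ξ⟩, hq, rfl⟩ := List.mem_map.mp hp
  · exact zero_mem (ℒ d)
  · exact hg _ hq

theorem vecPart_vecs (l : List (ℤ × L)) : vecPart (vecs (A := A) l) = l := by
  simp [vecPart, vecs, Function.comp_def]

theorem ldeg_vecPart (g : List (ℤ × (A ⊕ L))) : ldeg (vecPart g) = ldeg g := ldeg_map _ _

theorem scalarPart_cons_of_ne (x : ℤ × (A ⊕ L)) {g : List (ℤ × (A ⊕ L))} (hg : g ≠ []) :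
    scalarPart (x :: g) = 0 := by
  obtain ⟨y, g, rfl⟩ := List.exists_cons_of_ne_nil hg
  rfl

/-- The vector part of a scalar is `0`, so multilinearity kills every term in which the scalar is an
entry of a bracket or an anchor. What remains is the splitting with the scalar alone in the second
block. -/
theorem genBracket_scalar (d : ℤ) (a : A) (g : List (ℤ × (A ⊕ L))) :
    genBracket X sc vc ((d, Sum.inl a) :: g) =
      (d * ldeg g).negOnePow • sc (fev X.anchor (vecPart g) a) := by
  have h0 : ∀ g' : List (ℤ × (A ⊕ L)), (d, (0 : L)) ∈ vecPart ((d, Sum.inl a) :: g') := fun g' => by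
    simp [vecPart]
  rw [genBracket, fev_eq_zero (h0 g), map_zero, zero_add, shuf_cons]
  rw [shuf_eq_zero fun a b _ _ _ _ => by rw [fev_eq_zero (h0 a), LinearMap.zero_apply], zero_add,
    shuf_of_right_nil]
  · rw [Units.smul_def, map_zsmul]
    rfl
  · intro a b _ hb
    rw [scalarPart_cons_of_ne _ hb, map_zero, smul_zero]

theorem genBracket_vector (d : ℤ) (ξ : L) (g : List (ℤ × (A ⊕ L))) :
    genBracket X sc vc ((d, Sum.inr ξ) :: g) = vc (fev X.bracket ((d, ξ) :: vecPart g)) +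
      sc (shuf g fun a b => fev X.anchor ((d, ξ) :: vecPart a) (scalarPart b)) := by
  rw [genBracket, shuf_cons]
  congr 2
  refine add_eq_left.mpr (shuf_eq_zero fun a b _ _ _ _ => ?_)
  rcases eq_or_ne b [] with rfl | hb
  · simp [scalarPart]
  · rw [scalarPart_cons_of_ne _ hb, map_zero, smul_zero]

theorem genBracket_vecs (l : List (ℤ × L)) :
    genBracket X sc vc (vecs l) = vc (fev X.bracket l) := by
  rw [genBracket, vecPart_vecs, vecs, shuf_map, shuf_eq_zero, map_zero, add_zero]
  intro a b _ _ _ _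
  have : scalarPart (A := A) (b.map fun x => (x.1, Sum.inr x.2)) = 0 := by
    match b with
    | [] => rfl
    | [x] => rfl
    | x :: y :: b => rfl
  rw [this, map_zero]

/-- `bracket_leibniz` concerns the last entry; symmetry transfers it to the head of the list, where
the recursions act. -/
theorem LRInfinityAlgebra.bracket_cons_smul (X : LRInfinityAlgebra 𝒜 ℒ)
    [SetLike.GradedSMul 𝒜 ℒ] {b c : ℤ} {a : A} {ξ : L} {l : List (ℤ × L)}
    (ha : a ∈ 𝒜 b) (hξ : ξ ∈ ℒ c) (hl : ∀ p ∈ l, p ∈ homog ℒ) :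
    fev X.bracket ((b + c, a • ξ) :: l) = b.negOnePow • a • fev X.bracket ((c, ξ) :: l) +
      ((b + c) * ldeg l).negOnePow • fev X.anchor l a • ξ := by
  have hs := fev_symm X.bracket_symm
  have haξ : a • ξ ∈ ℒ (b + c) := SetLike.GradedSMul.smul_mem ha hξ
  rw [hs.cons_eq haξ hl, hs.cons_eq (x := (c, ξ)) hξ hl]
  obtain ⟨w, hw⟩ := exists_eq_ofFn l rfl
  generalize l.length = n at w hw
  subst hw
  rw [forall_ofFn_mem] at hl
  rw [fev_ofFn_snoc, fev_ofFn_snoc, fev_ofFn,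
    X.bracket_leibniz n (fun i => (w i).1) (fun i => (w i).2) hl b a ha ξ, ← ldeg_ofFn]
  simp only [smul_add, negOnePow_smul_smul, smul_comm a (_ : ℤˣ)]
  rw [add_comm]
  congr 1
  apply negOnePow_smul_eq
  simp only [parity_simps]; grind

theorem LRInfinityAlgebra.anchor_cons_smul (X : LRInfinityAlgebra 𝒜 ℒ)
    {b c d : ℤ} {a : A} {ξ : L} {l : List (ℤ × L)}
    (ha : a ∈ 𝒜 b) (hξ : ξ ∈ ℒ c) (hl : ∀ p ∈ l, p ∈ homog ℒ) (a' : A) :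
    fev X.anchor ((d, a • ξ) :: l) a' = b.negOnePow • (a * fev X.anchor ((c, ξ) :: l) a') := by
  have := (X.anchor_linear (l.length + 1) a').lev_cons (x := (c, ξ)) hξ hl (d' := d) ha
  rw [lev_comp, lev_comp, one_mul] at this
  exact this

theorem LRInfinityAlgebra.anchor_mul (X : LRInfinityAlgebra 𝒜 ℒ)
    {c : ℤ} {a b : A} {l : List (ℤ × L)} (ha : a ∈ 𝒜 c) (hl : ∀ p ∈ l, p ∈ homog ℒ) :
    fev X.anchor l (a * b) = ((1 + ldeg l) * c).negOnePow • (a * fev X.anchor l b) +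
      fev X.anchor l a * b := by
  obtain ⟨w, hw⟩ := exists_eq_ofFn l rfl
  generalize l.length = n at w hw
  subst hw
  rw [forall_ofFn_mem] at hl
  rw [fev_ofFn, X.anchor_derivation n (fun i => (w i).1) (fun i => (w i).2) hl c a ha b, ← ldeg_ofFn]

theorem LRInfinityAlgebra.anchor_mem (X : LRInfinityAlgebra 𝒜 ℒ)
    {c : ℤ} {a : A} {l : List (ℤ × L)} (ha : a ∈ 𝒜 c) (hl : ∀ p ∈ l, p ∈ homog ℒ) :
    fev X.anchor l a ∈ 𝒜 (1 + ldeg l + c) :=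
  fev_mem X.anchor_degree hl c a ha

theorem scalarPart_mem {g : List (ℤ × (A ⊕ L))} (hg : ∀ p ∈ g, p ∈ homGen 𝒜 ℒ) :
    scalarPart g ∈ 𝒜 (ldeg g) := by
  match g with
  | [] => exact zero_mem _
  | x :: y :: g => exact zero_mem _
  | [(d, Sum.inl a)] =>
    have : a ∈ 𝒜 d := hg _ (List.mem_singleton_self _)
    simpa [scalarPart] using this
  | [(d, Sum.inr ξ)] => exact zero_mem _

/-- The relation `mul` is the derivation property of the anchors. The relation `smul` combines the
Leibniz rule of the brackets, for the vector component, with the `A`-linearity of the anchors, for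
the scalar component. -/
theorem isGenDer_genBracket {sc : A →ₐ[K] S} {vc : L →ₗ[K] S} (hS : IsSymAlg 𝒜 ℒ sc vc 𝒮)
    [GradedAlgebra 𝒜] [SetLike.GradedSMul 𝒜 ℒ] :
    IsGenDer 𝒜 ℒ sc vc 𝒮 1 (genBracket X sc vc) where
  symm := by
    have hv : ∀ x ∈ homGen 𝒜 ℒ, (x.1, Sum.elim (fun _ => 0) id x.2) ∈ homog ℒ := by
      rintro ⟨d, a | ξ⟩ hx
      · exact zero_mem (ℒ d)
      · exact hx
    refine LSymm.add (((fev_symm X.bracket_symm).comap _ hv).map vc) (LSymm.map sc ?_)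
    refine shuf_lsymm (fun b _ => ?_) fun a _ => ?_
    · exact ((fev_symm X.anchor_symm).comap _ hv).map (LinearMap.applyₗ (R := K) (scalarPart b))
    · refine LSymm.map (fev X.anchor (vecPart a)) ?_
      intro pre x y post _
      have h : ∀ x y : ℤ × (A ⊕ L), scalarPart (pre ++ x :: y :: post) = 0 := by
        intro x y
        match pre with
        | [] => rfl
        | [z] => rfl
        | z :: z' :: pre => rfl
      rw [h, h, smul_zero]
  degree g hg := by
    have hm := fev_mem X.bracket_degree (vecPart_mem hg)
    rw [ldeg_vecPart] at hm
    refine add_mem (hS.vc_mem hm) (hS.sc_mem ?_)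
    refine shuf_mem fun a b ha hb hd _ => ?_
    have ha' := X.anchor_mem (scalarPart_mem fun p hp => hg p (hb hp))
      (vecPart_mem fun p hp => hg p (ha hp))
    rw [ldeg_vecPart] at ha'
    rwa [← hd, ← add_assoc]
  scalar_add d a a' g _ _ _ := by
    simp only [genBracket_scalar, map_add, smul_add]
  vector_add d ξ ζ g _ _ _ := by
    simp only [genBracket_vector, fev_add_cons, map_add, LinearMap.add_apply, shuf_add]
    abel
  scalar_smul d a r g _ _ := by
    simp only [genBracket_scalar, map_smul]
    rw [smul_comm]
  vector_smul d ξ r g _ _ := by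
    have h : (shuf g fun a b => (r • fev X.anchor ((d, ξ) :: vecPart a)) (scalarPart b)) =
        r • shuf g fun a b => fev X.anchor ((d, ξ) :: vecPart a) (scalarPart b) :=
      (map_shuf (DistribSMul.toAddMonoidHom A r) g _).symm
    simp only [genBracket_vector, fev_smul_cons, map_smul, h, smul_add]
  mul b a c a' g ha _ hg := by
    simp only [genBracket_scalar]
    rw [X.anchor_mul ha (vecPart_mem hg), ldeg_vecPart]
    simp only [map_add, Units.smul_def, map_zsmul, map_mul]
    simp only [← Units.smul_def, smul_add, negOnePow_smul_smul, mul_smul_comm, smul_mul_assoc]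
    refine congrArg₂ _ ?_ ?_ <;> apply negOnePow_smul_eq <;> simp only [parity_simps] <;> grind
  smul b a c ξ g ha hξ hg := by
    simp only [genBracket_vector, genBracket_scalar]
    have h : (shuf g fun a' b' => fev X.anchor ((b + c, a • ξ) :: vecPart a') (scalarPart b')) =
        b.negOnePow • (a * shuf g fun a' b' => fev X.anchor ((c, ξ) :: vecPart a') (scalarPart b')) := by
      rw [← AddMonoidHom.coe_mulLeft, map_shuf, ← shuf_negOnePow_smul]
      refine shuf_congr fun a' b' ha' _ _ _ => ?_
      exact X.anchor_cons_smul ha hξ (vecPart_mem fun p hp => hg p (ha' hp)) _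
    rw [X.bracket_cons_smul ha hξ (vecPart_mem hg), h, ldeg_vecPart]
    simp only [map_add, Units.smul_def, map_zsmul, map_mul, hS.vc_smul]
    simp only [← Units.smul_def, smul_add, mul_add, negOnePow_smul_smul, smul_mul_assoc, one_mul]
    rw [add_right_comm]
    congr 1
    apply negOnePow_smul_eq
    simp only [parity_simps]; grind

end BracketsOnGenerators

/-! ### The Jacobiator is a multiderivation. -/

section Jacobi

variable {K S : Type*} [Field K] [Ring S] [Algebra K S]
  {𝒮 : ℤ → Submodule K S}

namespace IsMultiDer

variable {R : Type*} [Ring R] [Algebra K R] {ρ : S →ₐ[K] R} {E : ℤ} {F : List (ℤ × S) → R}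

theorem zero : IsMultiDer 𝒮 ρ E fun _ => 0 where
  symm := LSymm.zero
  add := by simp
  leib := by simp

theorem zero_cons (hF : IsMultiDer 𝒮 ρ E F) (d : ℤ) {l : List (ℤ × S)}
    (hl : ∀ p ∈ l, p ∈ homog 𝒮) : F ((d, 0) :: l) = 0 := by
  have := hF.add d 0 0 l (zero_mem _) (zero_mem _) hl
  rwa [add_zero, left_eq_add] at this

/-- `IsMultiDer` assumes additivity only, which is enough for the factor `-1`. -/
theorem negOnePow_smul_cons (hF : IsMultiDer 𝒮 ρ E F) {d : ℤ} (e : ℤ) {x : S} {l : List (ℤ × S)}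
    (hx : x ∈ 𝒮 d) (hl : ∀ p ∈ l, p ∈ homog 𝒮) :
    F ((d, e.negOnePow • x) :: l) = e.negOnePow • F ((d, x) :: l) := by
  rcases Int.even_or_odd e with he | he
  · rw [Int.negOnePow_even e he, one_smul, one_smul]
  · rw [Int.negOnePow_odd e he, Units.neg_smul, Units.neg_smul, one_smul, one_smul,
      eq_neg_iff_add_eq_zero, ← hF.add d (-x) x l (neg_mem hx) hx hl, neg_add_cancel,
      hF.zero_cons d hl]

end IsMultiDer

theorem mul_shuf {V R : Type*} [Ring R] (r : R) (l : List (ℤ × V))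
    (f : List (ℤ × V) → List (ℤ × V) → R) : r * shuf l f = shuf l fun a b => r * f a b :=
  map_shuf (AddMonoidHom.mulLeft r) l f

theorem shuf_mul {V R : Type*} [Ring R] (r : R) (l : List (ℤ × V))
    (f : List (ℤ × V) → List (ℤ × V) → R) : shuf l f * r = shuf l fun a b => f a b * r :=
  map_shuf (AddMonoidHom.mulRight r) l f

variable {F : List (ℤ × S) → S}

/-- The Jacobiator of a multibracket of degree `1`. -/
def jacobiator (F : List (ℤ × S) → S) (l : List (ℤ × S)) : S :=
  shuf l fun a b => F ((1 + ldeg a, F a) :: b)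

/-- The Jacobiator is half the graded commutator of an odd multiderivation with itself, and
commutators of derivations are derivations: the second-order terms cancel. -/
theorem isMultiDer_jacobiator [SetLike.GradedMonoid 𝒮] (hF : IsMultiDer 𝒮 (AlgHom.id K S) 1 F)
    (hd : ∀ l, (∀ p ∈ l, p ∈ homog 𝒮) → F l ∈ 𝒮 (1 + ldeg l)) :
    IsMultiDer 𝒮 (AlgHom.id K S) 2 (jacobiator F) where
  symm := by
    refine shuf_lsymm (fun b hb => ?_) fun a ha => hF.symm.cons (hd a ha)
    intro pre x y post h
    have h' : ∀ p ∈ pre ++ y :: x :: post, p ∈ homog 𝒮 := fun p hp => h p (by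
      simp only [List.mem_append, List.mem_cons] at hp ⊢; tauto)
    have e : ldeg (pre ++ x :: y :: post) = ldeg (pre ++ y :: x :: post) := by
      simp only [ldeg_append, ldeg_cons]; ring
    simp only
    rw [hF.symm pre x y post h, e, hF.negOnePow_smul_cons _ (hd _ h') hb]
  add d x y l hx hy hl := by
    simp only [jacobiator, shuf_cons, ← shuf_add]
    refine shuf_congr fun a b ha hb _ _ => ?_
    have ha' : ∀ p ∈ a, p ∈ homog 𝒮 := fun p hp => hl p (ha hp)
    have hb' : ∀ p ∈ b, p ∈ homog 𝒮 := fun p hp => hl p (hb hp)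
    have hx' := hd ((d, x) :: a) (List.forall_mem_cons.mpr ⟨hx, ha'⟩)
    have hy' := hd ((d, y) :: a) (List.forall_mem_cons.mpr ⟨hy, ha'⟩)
    rw [hF.add d x y a hx hy ha', (hF.cons (z := (1 + ldeg a, F a)) (hd a ha')).add d x y b hx hy hb']
    simp only [ldeg_cons] at hx' hy' ⊢
    rw [hF.add _ _ _ _ hx' hy' hb', smul_add]
    abel
  leib b x c y l hx hy hl := by
    -- Expanding the inner and then the outer bracket yields products of a value containing `x` with
    -- a value containing `y`. Each occurs twice; after exchanging the blocks in one of the sums,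
    -- the signs are opposite because `F` is odd.
    have cross : shuf l (fun α β => ((c * ldeg α + 1 + b + ldeg α).negOnePow •
        (F ((b, x) :: α) * F ((c, y) :: β)))) +
        shuf l (fun α β => ((b + (1 + c + ldeg α) * ldeg β).negOnePow •
        (F ((b, x) :: β) * F ((c, y) :: α)))) = 0 := by
      rw [shuf_comm l fun α β => (b + (1 + c + ldeg α) * ldeg β).negOnePow •
        (F ((b, x) :: β) * F ((c, y) :: α)), ← shuf_add]
      refine shuf_eq_zero fun α β _ _ _ _ => ?_
      rw [negOnePow_smul_smul, negOnePow_smul_eq (b := 1 + (ldeg α * ldeg β + (b + (1 + c + ldeg β) * ldeg α)))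
        (by simp only [parity_simps]; tauto), Int.negOnePow_add, mul_smul]
      simp
    refine Eq.trans ?_ (add_zero _)
    rw [← cross]
    simp only [jacobiator, shuf_cons, AlgHom.id_apply, mul_add, add_mul, mul_shuf, shuf_mul,
      ← shuf_negOnePow_smul, ← shuf_add]
    refine shuf_congr fun α β hα hβ hdeg _ => ?_
    have hα' : ∀ p ∈ α, p ∈ homog 𝒮 := fun p hp => hl p (hα hp)
    have hβ' : ∀ p ∈ β, p ∈ homog 𝒮 := fun p hp => hl p (hβ hp)
    have hx' := hd ((b, x) :: α) (List.forall_mem_cons.mpr ⟨hx, hα'⟩)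
    have hy' := hd ((c, y) :: α) (List.forall_mem_cons.mpr ⟨hy, hα'⟩)
    have h1 : x * F ((c, y) :: α) ∈ 𝒮 (b + (1 + (c + ldeg α))) := SetLike.mul_mem_graded hx hy'
    have h2 : F ((b, x) :: α) * y ∈ 𝒮 (1 + (b + ldeg α) + c) := SetLike.mul_mem_graded hx' hy
    have e1 : b + (1 + (c + ldeg α)) = 1 + (b + c + ldeg α) := by ring
    have e2 : 1 + (b + ldeg α) + c = 1 + (b + c + ldeg α) := by ring
    have h1' := e1 ▸ h1
    have h2' := e2 ▸ h2
    have e3 := hF.add _ _ _ β (Submodule.smul_of_tower_mem _ (1 * b).negOnePow h1')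
      (Submodule.smul_of_tower_mem _ (c * ldeg α).negOnePow h2') hβ'
    rw [hF.negOnePow_smul_cons _ h1' hβ', hF.negOnePow_smul_cons _ h2' hβ'] at e3
    have l1 := hF.leib _ _ _ _ β hx hy' hβ'
    have l2 := hF.leib _ _ _ _ β hx' hy hβ'
    simp only [ldeg_cons] at l1 l2
    rw [e1] at l1
    rw [e2] at l2
    rw [l1, l2] at e3
    have e4 := (hF.cons (z := (1 + ldeg α, F α)) (hd α hα')).leib b x c y β hx hy hβ'
    have e5 := hF.leib b x c y α hx hy hα'
    simp only [AlgHom.id_apply] at e3 e4 e5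
    simp only [ldeg_cons, e5, e3, e4]
    simp only [smul_add, negOnePow_smul_smul, mul_smul_comm, smul_mul_assoc, ← hdeg]
    rw [show ∀ p1 p2 p3 p4 p5 p6 : S, p1 + p2 + (p3 + p4) + (p5 + p6) =
      p1 + p5 + (p4 + p6) + (p3 + p2) from fun _ _ _ _ _ _ => by abel]
    refine congrArg₂ _ (congrArg₂ _ (congrArg₂ _ ?_ ?_) (congrArg₂ _ ?_ ?_)) (congrArg₂ _ ?_ ?_) <;>
      apply negOnePow_smul_eq <;> simp only [parity_simps] <;> grind

end Jacobi

/-! ### Sums over subsets compared with sums over splittings. -/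

section Bridge

variable {K V W M : Type*} [Field K] [AddCommGroup V] [Module K V] [AddCommGroup W] [Module K W]
  [AddCommGroup M]

/-- Nested brackets as sums over splittings. -/
theorem shuf_ofFn_bracket (F : (n : ℕ) → MultilinearMap K (fun _ : Fin n => V) W)
    (G : (n : ℕ) → MultilinearMap K (fun _ : Fin n => V) V) (e : ℤ) {n : ℕ} (d : Fin n → ℤ)
    (v : Fin n → V) :
    (shuf (List.ofFn fun i => (d i, v i)) fun a b => fev F ((e + ldeg a, fev G a) :: b)) =
      ∑ I : Finset (Fin n), unshuffleSign d I •
        F (Iᶜ.card + 1) (Fin.cons (G I.card (sub v I)) (sub v Iᶜ)) := by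
  rw [← sum_unshuffleSign]
  refine Finset.sum_congr rfl fun I _ => ?_
  rw [fev_ofFn_cons, fev_ofFn]
  rfl

theorem ldeg_sub {n : ℕ} (d : Fin n → ℤ) (v : Fin n → V) (I : Finset (Fin n)) :
    ldeg (List.ofFn (sub (fun i => (d i, v i)) I)) = ∑ i ∈ I, d i := by
  rw [ldeg_ofFn]
  have := Finset.sum_coe_sort I d
  rw [← this, ← (I.orderIsoOfFin rfl).toEquiv.sum_comp]
  rfl

end Bridge

/-! ### The Jacobi identity of the extension. -/

section Poisson

variable {K A L : Type*} [Field K] [Ring A] [Algebra K A]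
  [AddCommGroup L] [Module K L] [Module A L]
  {𝒜 : ℤ → Submodule K A} {ℒ : ℤ → Submodule K L}

theorem LRInfinityAlgebra.shuf_bracket_bracket (X : LRInfinityAlgebra 𝒜 ℒ) {l : List (ℤ × L)}
    (hl : ∀ p ∈ l, p ∈ homog ℒ) :
    (shuf l fun a b => fev X.bracket ((1 + ldeg a, fev X.bracket a) :: b)) = 0 := by
  obtain ⟨w, hw⟩ := exists_eq_ofFn l rfl
  rw [hw, forall_ofFn_mem] at hl
  rw [hw]
  exact (shuf_ofFn_bracket _ _ _ _ _).trans (X.jacobi_bracket _ _ _ hl)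

theorem LRInfinityAlgebra.shuf_anchor_anchor (X : LRInfinityAlgebra 𝒜 ℒ) {l : List (ℤ × L)}
    (hl : ∀ p ∈ l, p ∈ homog ℒ) (x : A) :
    (shuf l fun a b => (ldeg a).negOnePow • fev X.anchor a (fev X.anchor b x) +
      fev X.anchor ((1 + ldeg a, fev X.bracket a) :: b) x) = 0 := by
  obtain ⟨w, hw⟩ := exists_eq_ofFn l rfl
  rw [hw, forall_ofFn_mem] at hl
  rw [hw, ← sum_unshuffleSign, ← X.jacobi_anchor _ (fun i => (w i).1) (fun i => (w i).2) hl x]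
  refine Finset.sum_congr rfl fun I _ => ?_
  have h := ldeg_sub (fun i => (w i).1) (fun i => (w i).2) I
  rw [fev_ofFn_cons, fev_ofFn, fev_ofFn, fev_ofFn, ← h]
  rfl

variable (X : LRInfinityAlgebra 𝒜 ℒ) {S : Type*} [Ring S] [Algebra K S] {sc : A →ₐ[K] S}
  {vc : L →ₗ[K] S} {𝒮 : ℤ → Submodule K S} {F : List (ℤ × S) → S}

theorem genBracket_vector_vecs (d : ℤ) (ξ : L) (l : List (ℤ × L)) :
    genBracket X sc vc ((d, Sum.inr ξ) :: vecs l) = vc (fev X.bracket ((d, ξ) :: l)) :=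
  genBracket_vecs X sc vc ((d, ξ) :: l)

theorem genBracket_scalar_scalar (d d' : ℤ) (a a' : A) (g : List (ℤ × (A ⊕ L))) :
    genBracket X sc vc ((d, Sum.inl a) :: (d', Sum.inl a') :: g) = 0 := by
  rw [genBracket_scalar, fev_eq_zero (d := d')]
  · simp
  · simp [vecPart]

/-- The multibracket `F` is a multiderivation of degree `1` extending the brackets and anchors
of `X`. -/
structure IsExtension (X : LRInfinityAlgebra 𝒜 ℒ) (sc : A →ₐ[K] S)
    (vc : L →ₗ[K] S) (𝒮 : ℤ → Submodule K S) (F : List (ℤ × S) → S) : Prop where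
  der : IsMultiDer 𝒮 (AlgHom.id K S) 1 F
  degree : ∀ l, (∀ p ∈ l, p ∈ homog 𝒮) → F l ∈ 𝒮 (1 + ldeg l)
  gens : ∀ g, (∀ p ∈ g, p ∈ homGen 𝒜 ℒ) → F (ofGens sc vc g) = genBracket X sc vc g

namespace IsExtension

/-- With two scalars fixed, a multiderivation in the other entries remains, and it vanishes on
generators. -/
theorem scalar_scalar (hS : IsSymAlg 𝒜 ℒ sc vc 𝒮) [GradedAlgebra 𝒜]
    (hF : IsExtension X sc vc 𝒮 F) {b b' : ℤ} {a a' : A} (ha : a ∈ 𝒜 b) (ha' : a' ∈ 𝒜 b')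
    {l : List (ℤ × S)} (hl : ∀ p ∈ l, p ∈ homog 𝒮) : F ((b, sc a) :: (b', sc a') :: l) = 0 := by
  have := hS.gradedMonoid
  refine IsMultiDer.ext hS ((hF.der.cons (z := (b, sc a)) (hS.sc_mem ha)).cons
    (z := (b', sc a')) (hS.sc_mem ha')) IsMultiDer.zero (fun g hg => ?_) l hl
  exact (hF.gens ((b, Sum.inl a) :: (b', Sum.inl a') :: g) (List.forall_mem_cons.mpr
    ⟨ha, List.forall_mem_cons.mpr ⟨ha', hg⟩⟩)).trans (genBracket_scalar_scalar X _ _ _ _ _)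

theorem jacobiator_eq_zero (hS : IsSymAlg 𝒜 ℒ sc vc 𝒮) [GradedAlgebra 𝒜]
    (hF : IsExtension X sc vc 𝒮 F) {l : List (ℤ × S)} (hl : ∀ p ∈ l, p ∈ homog 𝒮) :
    jacobiator F l = 0 := by
  have := hS.gradedMonoid
  have hJ := isMultiDer_jacobiator hF.der hF.degree
  refine IsMultiDer.ext hS hJ IsMultiDer.zero (fun g hg => ?_) l hl
  refine gens_ext (F := fun g => jacobiator F (ofGens sc vc g)) (G := fun _ => 0)
    (hJ.symm.comap _ fun x hx => ofGen_mem hS hx) LSymm.zero ?_ ?_ ?_ hg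
  · intro l hl
    have hl' := vecs_mem (𝒜 := 𝒜).mpr hl
    have : ∀ a ⊆ vecs l, F (ofGens sc vc a) = genBracket X sc vc a := fun a ha =>
      hF.gens a fun p hp => hl' p (ha hp)
    rw [jacobiator, ofGens, shuf_map, vecs, shuf_map,
      ← map_zero vc, ← X.shuf_bracket_bracket hl, map_shuf]
    refine shuf_congr fun a b ha hb _ _ => ?_
    have hva : ∀ p ∈ vecs a, p ∈ homGen 𝒜 ℒ := vecs_mem.mpr fun p hp => hl p (ha hp)
    have hvb : ∀ p ∈ vecs b, p ∈ homGen 𝒜 ℒ := vecs_mem.mpr fun p hp => hl p (hb hp)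
    change F ((1 + ldeg (ofGens sc vc (vecs a)), F (ofGens sc vc (vecs a))) ::
      ofGens sc vc (vecs b)) = _
    rw [hF.gens _ hva, genBracket_vecs, ldeg_ofGens, ldeg_vecs, ← genBracket_vector_vecs X]
    refine hF.gens ((_, Sum.inr _) :: _) (List.forall_mem_cons.mpr ⟨?_, hvb⟩)
    exact fev_mem X.bracket_degree fun p hp => hl p (ha hp)
  · intro l c x hl hx
    have hscal : ∀ {d : ℤ} {a : A} {l : List (ℤ × L)}, a ∈ 𝒜 d → (∀ p ∈ l, p ∈ homog ℒ) →
        F ((d, sc a) :: ofGens sc vc (vecs l)) =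
          (d * ldeg l).negOnePow • sc (fev X.anchor l a) := by
      intro d a l ha hl
      have := hF.gens ((d, Sum.inl a) :: vecs l) (List.forall_mem_cons.mpr ⟨ha, vecs_mem.mpr hl⟩)
      rwa [genBracket_scalar, ldeg_vecs, vecPart_vecs] at this
    have h0 := congrArg (fun y => (c * ldeg l).negOnePow • sc y) (X.shuf_anchor_anchor hl x)
    simp only [map_zero, smul_zero] at h0
    rw [← h0, map_shuf, ← shuf_negOnePow_smul]
    simp only [map_add, smul_add, shuf_add]
    -- In the Jacobiator the block `a` sits in the inner bracket, whereas in the identity of the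
    -- anchors the inner anchor has the block `b`. The blocks are therefore exchanged in the
    -- anchor-anchor terms; these match the splittings with the scalar inside, the anchor-bracket
    -- terms those with the scalar outside.
    rw [shuf_comm l fun a b => (c * ldeg l).negOnePow • sc (_ • _), ofGens, List.map_cons,
      jacobiator, shuf_cons, shuf_map, vecs, shuf_map, shuf_map, shuf_map]
    congr 1
    · refine shuf_congr fun a b ha hb hd _ => ?_
      have ha' : ∀ p ∈ a, p ∈ homog ℒ := fun p hp => hl p (ha hp)
      have hb' : ∀ p ∈ b, p ∈ homog ℒ := fun p hp => hl p (hb hp)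
      change F ((1 + ldeg ((c, sc x) :: ofGens sc vc (vecs a)), F ((c, sc x) :: ofGens sc vc (vecs a))) ::
        ofGens sc vc (vecs b)) = _
      have hm := X.anchor_mem hx ha'
      rw [hscal hx ha', ldeg_cons, ldeg_ofGens, ldeg_vecs, hF.der.negOnePow_smul_cons]
      · rw [show 1 + (c + ldeg a) = 1 + ldeg a + c by ring, hscal hm hb']
        simp only [Units.smul_def, map_zsmul]
        simp only [← Units.smul_def, negOnePow_smul_smul, ← hd]
        apply negOnePow_smul_eq
        simp only [parity_simps]; grind
      · convert hS.sc_mem hm using 2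
        ring
      · exact ofGens_mem hS (vecs_mem.mpr hb')
    · refine shuf_congr fun a b ha hb hd _ => ?_
      have ha' : ∀ p ∈ a, p ∈ homog ℒ := fun p hp => hl p (ha hp)
      have hb' : ∀ p ∈ b, p ∈ homog ℒ := fun p hp => hl p (hb hp)
      have hm := fev_mem X.bracket_degree ha'
      have hob := ofGens_mem hS (sc := sc) (vecs_mem (𝒜 := 𝒜).mpr hb')
      change (c * ldeg (ofGens sc vc (vecs a))).negOnePow •
        F ((1 + ldeg (ofGens sc vc (vecs a)), F (ofGens sc vc (vecs a))) :: (c, sc x) ::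
        ofGens sc vc (vecs b)) = _
      rw [hF.gens _ (vecs_mem.mpr ha'), genBracket_vecs, ldeg_ofGens, ldeg_vecs,
        hF.der.symm.swap (x := (1 + ldeg a, _)) (hS.vc_mem hm) (y := (c, sc x)) (hS.sc_mem hx) hob]
      have := hscal hx (l := (1 + ldeg a, fev X.bracket a) :: b)
        (List.forall_mem_cons.mpr ⟨hm, hb'⟩)
      change F ((c, sc x) :: (1 + ldeg a, vc (fev X.bracket a)) :: ofGens sc vc (vecs b)) = _ at this
      rw [this, ldeg_cons, negOnePow_smul_smul, negOnePow_smul_smul, ← hd]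
      apply negOnePow_smul_eq
      simp only [parity_simps]; grind
  · intro g b a b' a' hg ha ha'
    have hscal : ∀ {d : ℤ} {a : A} {g : List (ℤ × (A ⊕ L))}, a ∈ 𝒜 d →
        (∀ p ∈ g, p ∈ homGen 𝒜 ℒ) → ∃ x ∈ 𝒜 (1 + (d + ldeg g)),
          F ((d, sc a) :: ofGens sc vc g) = sc x := by
      intro d a g ha hg
      refine ⟨(d * ldeg g).negOnePow • fev X.anchor (vecPart g) a, ?_, ?_⟩
      · refine Submodule.smul_of_tower_mem _ _ ?_
        have := X.anchor_mem ha (vecPart_mem hg)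
        rw [ldeg_vecPart] at this
        convert this using 2
        ring
      · have := hF.gens ((d, Sum.inl a) :: g) (List.forall_mem_cons.mpr ⟨ha, hg⟩)
        rw [genBracket_scalar] at this
        rw [Units.smul_def, map_zsmul]
        exact this
    -- With one scalar inside, the inner value is again a scalar, so the outer bracket has two. With
    -- both scalars inside or both outside, that bracket vanishes directly.
    have hz : ∀ {d : ℤ} {a : A} {b : ℤ} {a' : A} {g : List (ℤ × (A ⊕ L))} {l : List (ℤ × S)},
        a ∈ 𝒜 d → a' ∈ 𝒜 b → (∀ p ∈ g, p ∈ homGen 𝒜 ℒ) → (∀ p ∈ l, p ∈ homog 𝒮) →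
        F ((1 + (d + ldeg g), F ((d, sc a) :: ofGens sc vc g)) :: (b, sc a') :: l) = 0 := by
      intro d a b a' g l ha ha' hg hl
      obtain ⟨x, hx, h⟩ := hscal ha hg
      rw [h]
      exact scalar_scalar X hS hF hx ha' hl
    rw [ofGens, List.map_cons, List.map_cons, jacobiator, shuf_cons, shuf_cons, shuf_cons,
      shuf_map, shuf_map, shuf_map, shuf_map, ← shuf_add, ← shuf_add, ← shuf_add]
    refine shuf_eq_zero fun x y hx hy _ _ => ?_
    have hx' : ∀ p ∈ x, p ∈ homGen 𝒜 ℒ := fun p hp => hg p (hx hp)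
    have hy' : ∀ p ∈ ofGens sc vc y, p ∈ homog 𝒮 := ofGens_mem hS fun p hp => hg p (hy hp)
    have hxo := ofGens_mem hS (sc := sc) hx'
    have h1 : F ((b, sc a) :: (b', sc a') :: ofGens sc vc x) = 0 :=
      scalar_scalar X hS hF ha ha' hxo
    have h2 := hz ha ha' hx' hy'
    have h3 := hz ha' ha hx' hy'
    have hm := hF.degree _ hxo
    have h4 : F ((1 + ldeg (ofGens sc vc x), F (ofGens sc vc x)) :: (b, sc a) :: (b', sc a') ::
        ofGens sc vc y) = 0 := by
      rw [hF.der.symm.swap (x := (1 + ldeg (ofGens sc vc x), _)) hm (y := (b, sc a)) (hS.sc_mem ha)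
        (List.forall_mem_cons.mpr ⟨hS.sc_mem ha', hy'⟩),
        (hF.der.symm.cons (x := (b, sc a)) (hS.sc_mem ha)).swap
          (x := (1 + ldeg (ofGens sc vc x), _)) hm (y := (b', sc a')) (hS.sc_mem ha') hy',
        scalar_scalar X hS hF ha ha' (List.forall_mem_cons.mpr ⟨hm, hy'⟩), smul_zero, smul_zero]
    have h5 := hF.der.zero_cons (1 + ldeg ((b, sc a) :: (b', sc a') :: ofGens sc vc x)) hy'
    simp only [ofGen, Sum.elim_inl, ofGens, ldeg_cons, ldeg_map] at h1 h2 h3 h4 h5 ⊢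
    simp only [h1, h2, h3, h4, h5, smul_zero, add_zero]

end IsExtension

end Poisson

/-! ### Vanishing of multilinear maps on spans. -/

section Spans

variable {K V W : Type*} [Field K] [AddCommGroup V] [Module K V] [AddCommGroup W] [Module K W]

/-- A multilinear map that vanishes on tuples with entries in given sets vanishes on tuples with
entries in their spans. -/
theorem multilinearMap_eq_zero_of_span {n : ℕ} (f : MultilinearMap K (fun _ : Fin n => V) W)
    (T : Fin n → Set V) (h : ∀ v : Fin n → V, (∀ i, v i ∈ T i) → f v = 0) (u : Fin n → V)
    (hu : ∀ i, u i ∈ Submodule.span K (T i)) : f u = 0 := by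
  -- The set `s` holds the places not yet reduced from the span to the spanning set.
  suffices ∀ (s : Finset (Fin n)) (u : Fin n → V), (∀ i ∈ s, u i ∈ Submodule.span K (T i)) →
      (∀ i ∉ s, u i ∈ T i) → f u = 0 from
    this Finset.univ u (fun i _ => hu i) fun i hi => absurd (Finset.mem_univ i) hi
  intro s
  induction s using Finset.induction_on with
  | empty => exact fun u _ h' => h u fun i => h' i (Finset.notMem_empty i)
  | insert j s hj ih =>
    intro u h1 h2
    rw [← Function.update_eq_self j u]
    have hj' := h1 j (Finset.mem_insert_self j s)
    generalize u j = x at hj'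
    induction hj' using Submodule.span_induction with
    | zero => exact f.map_update_zero u j
    | add x y _ _ hx hy => rw [f.map_update_add, hx, hy, add_zero]
    | smul r x _ hx => rw [f.map_update_smul, hx, smul_zero]
    | mem x hx =>
      refine ih _ (fun i hi => ?_) fun i hi => ?_
      · have hij : i ≠ j := fun h => hj (h ▸ hi)
        rw [Function.update_of_ne hij]
        exact h1 i (Finset.mem_insert_of_mem hi)
      · rcases eq_or_ne i j with rfl | hij
        · rwa [Function.update_self]
        · rw [Function.update_of_ne hij]
          exact h2 i fun h => (Finset.mem_insert.mp h).elim hij hi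

theorem mem_span_homogeneous (𝒱 : ℤ → Submodule K V) [Decomposition 𝒱] (x : V) :
    x ∈ Submodule.span K {y | ∃ d, y ∈ 𝒱 d} := by
  induction x using DirectSum.Decomposition.inductionOn 𝒱 with
  | zero => exact zero_mem _
  | add x y hx hy => exact add_mem hx hy
  | @homogeneous d x => exact Submodule.subset_span ⟨d, x.2⟩

end Spans

/-! ### Existence and uniqueness of the `P_∞[1]` extension. -/

section Poisson

variable {K A L : Type*} [Field K] [Ring A] [Algebra K A]
  [AddCommGroup L] [Module K L] [Module A L]
  {𝒜 : ℤ → Submodule K A} {ℒ : ℤ → Submodule K L} (X : LRInfinityAlgebra 𝒜 ℒ)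

section
variable {S : Type*} [Ring S] [Algebra K S] {𝒮 : ℤ → Submodule K S}

theorem PInfinityAlgebra.isMultiDer (Λ : PInfinityAlgebra 𝒮) [SetLike.GradedMonoid 𝒮] :
    IsMultiDer 𝒮 (AlgHom.id K S) 1 (fev Λ.bracket) where
  symm := fev_symm Λ.bracket_symm
  add d x y l _ _ _ := fev_add_cons d x y l
  leib b x c y l hx hy hl := by
    have hs := fev_symm Λ.bracket_symm
    have hxy : x * y ∈ 𝒮 (b + c) := SetLike.mul_mem_graded hx hy
    rw [hs.cons_eq hxy hl, hs.cons_eq (x := (c, y)) hy hl, hs.cons_eq (x := (b, x)) hx hl]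
    obtain ⟨w, hw⟩ := exists_eq_ofFn l rfl
    generalize l.length = n at w hw
    subst hw
    rw [forall_ofFn_mem] at hl
    rw [fev_ofFn_snoc, fev_ofFn_snoc, fev_ofFn_snoc,
      Λ.bracket_leibniz n (fun i => (w i).1) (fun i => (w i).2) hl b x hx y, ← ldeg_ofFn]
    simp only [smul_add, negOnePow_smul_smul, mul_smul_comm, smul_mul_assoc, AlgHom.id_apply]
    refine congrArg₂ _ ?_ ?_ <;> apply negOnePow_smul_eq <;> simp only [parity_simps] <;> grind

theorem PInfinityAlgebra.fev_mem (Λ : PInfinityAlgebra 𝒮) (l : List (ℤ × S))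
    (hl : ∀ p ∈ l, p ∈ homog 𝒮) : fev Λ.bracket l ∈ 𝒮 (1 + ldeg l) :=
  SHLR.fev_mem Λ.bracket_degree hl

variable {sc : A →ₐ[K] S} {vc : L →ₗ[K] S}

/-- Two extensions agree. -/
theorem IsExtension.eq {X : LRInfinityAlgebra 𝒜 ℒ} (hS : IsSymAlg 𝒜 ℒ sc vc 𝒮) [GradedAlgebra 𝒜]
    [Decomposition 𝒮] {Λ Λ' : PInfinityAlgebra 𝒮} (h : IsExtension X sc vc 𝒮 (fev Λ.bracket))
    (h' : IsExtension X sc vc 𝒮 (fev Λ'.bracket)) : Λ = Λ' := by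
  refine PInfinityAlgebra.ext (funext fun n => ext_lev (𝒱 := 𝒮) fun l hn hl => ?_)
  rw [← fev_eq_lev hn, ← fev_eq_lev hn]
  exact IsMultiDer.ext hS h.der h'.der (fun g hg => (h.gens g hg).trans (h'.gens g hg).symm) l hl

/-- A `P_∞[1]` structure with the prescribed values is an extension. -/
theorem PInfinityAlgebra.isExtension {X : LRInfinityAlgebra 𝒜 ℒ} (hS : IsSymAlg 𝒜 ℒ sc vc 𝒮)
    [GradedAlgebra 𝒜] [SetLike.GradedSMul 𝒜 ℒ] (Λ : PInfinityAlgebra 𝒮)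
    (vector : ∀ (k : ℕ) (ξ : Fin k → L), Λ.bracket k (fun i => vc (ξ i)) = vc (X.bracket k ξ))
    (scalar : ∀ (n : ℕ) (ξ : Fin n → L) (a : A),
      Λ.bracket (n + 1) (Fin.snoc (fun i => vc (ξ i)) (sc a)) = sc (X.anchor n ξ a))
    (scalar_scalar : ∀ (k : ℕ) (u : Fin k → S) (i j : Fin k), i ≠ j →
      u i ∈ Set.range sc → u j ∈ Set.range sc → Λ.bracket k u = 0) :
    IsExtension X sc vc 𝒮 (fev Λ.bracket) := by
  have := hS.gradedMonoid
  refine ⟨Λ.isMultiDer, Λ.fev_mem, fun g hg => ?_⟩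
  have hs := fev_symm Λ.bracket_symm
  have hofFn : ∀ {n : ℕ} (w : Fin n → ℤ × L),
      ofGens sc vc (vecs (List.ofFn w)) = List.ofFn fun i => ((w i).1, vc (w i).2) := by
    intro n w
    simp only [ofGens, vecs, List.map_ofFn]
    rfl
  refine gens_ext (F := fun g => fev Λ.bracket (ofGens sc vc g)) (hs.comap _ fun x hx =>
    ofGen_mem hS hx) (isGenDer_genBracket X hS).symm (fun l _ => ?_) (fun l b a hl ha => ?_)
    (fun g b a b' a' hg ha ha' => ?_) hg
  · obtain ⟨w, hw⟩ := exists_eq_ofFn l rfl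
    generalize l.length = n at w hw
    subst hw
    rw [genBracket_vecs, hofFn, fev_ofFn, fev_ofFn]
    exact vector _ _
  · have hl' := ofGens_mem hS (sc := sc) (vecs_mem (𝒜 := 𝒜).mpr hl)
    have h := hs.cons_eq (x := (b, sc a)) (hS.sc_mem ha) hl'
    rw [genBracket_scalar, vecPart_vecs, ldeg_vecs]
    rw [ldeg_ofGens, ldeg_vecs] at h
    refine h.trans ?_
    congr 1
    obtain ⟨w, hw⟩ := exists_eq_ofFn l rfl
    generalize l.length = n at w hw
    subst hw
    rw [hofFn, fev_ofFn_snoc, fev_ofFn]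
    exact scalar _ _ _
  · rw [genBracket_scalar_scalar]
    obtain ⟨w, hw⟩ := exists_eq_ofFn (ofGens sc vc ((b, Sum.inl a) :: (b', Sum.inl a') :: g)) rfl
    obtain ⟨n, hn⟩ : ∃ n, (ofGens sc vc ((b, Sum.inl a) :: (b', Sum.inl a') :: g)).length = n + 2 :=
      ⟨g.length, by simp [ofGens]⟩
    generalize (ofGens sc vc ((b, Sum.inl a) :: (b', Sum.inl a') :: g)).length = m at w hw hn
    subst hn
    have h0 : w 0 = (b, sc a) := by
      have := congrArg (fun l => l[0]?) hw
      simp only [ofGens, List.map_cons, List.getElem?_cons_zero] at this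
      simp at this
      exact this.symm
    have h1 : w 1 = (b', sc a') := by
      have := congrArg (fun l => l[1]?) hw
      simp only [ofGens, List.map_cons, List.getElem?_cons_succ, List.getElem?_cons_zero] at this
      simp at this
      exact this.symm
    rw [hw, fev_ofFn]
    refine scalar_scalar _ _ 0 1 (by simp) ⟨a, ?_⟩ ⟨a', ?_⟩
    · rw [h0]
    · rw [h1]

/-- `IsExtension` speaks of homogeneous entries only; multilinearity and the decomposition of `L`
remove the restriction. -/
theorem IsExtension.vector {X : LRInfinityAlgebra 𝒜 ℒ} [Decomposition ℒ] {Λ : PInfinityAlgebra 𝒮}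
    (h : IsExtension X sc vc 𝒮 (fev Λ.bracket)) (k : ℕ) (ξ : Fin k → L) :
    Λ.bracket k (fun i => vc (ξ i)) = vc (X.bracket k ξ) := by
  have : (Λ.bracket k).compLinearMap (fun _ => vc) = vc.compMultilinearMap (X.bracket k) := by
    refine ext_homogeneous ℒ fun d v hv => ?_
    have := h.gens (vecs (List.ofFn fun i => (d i, v i))) (vecs_mem.mpr (forall_ofFn_mem.mpr hv))
    rw [genBracket_vecs, fev_ofFn] at this
    simp only [ofGens, vecs, List.map_ofFn] at this
    rw [fev_ofFn] at this
    exact this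
  exact congrArg (fun f => f ξ) this

theorem IsExtension.scalar {X : LRInfinityAlgebra 𝒜 ℒ} (hS : IsSymAlg 𝒜 ℒ sc vc 𝒮)
    [GradedAlgebra 𝒜] [Decomposition ℒ] {Λ : PInfinityAlgebra 𝒮}
    (h : IsExtension X sc vc 𝒮 (fev Λ.bracket)) (n : ℕ) (ξ : Fin n → L) (a : A) :
    Λ.bracket (n + 1) (Fin.snoc (fun i => vc (ξ i)) (sc a)) = sc (X.anchor n ξ a) := by
  induction a using DirectSum.Decomposition.inductionOn 𝒜 with
  | zero =>
    rw [map_zero, map_zero, map_zero]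
    refine (Λ.bracket (n + 1)).map_coord_zero (Fin.last n) ?_
    rw [Fin.snoc_last]
  | add a a' h h' =>
    have := (Λ.bracket (n + 1)).map_update_add (Fin.snoc (fun i => vc (ξ i)) 0) (Fin.last n)
      (sc a) (sc a')
    simp only [Fin.update_snoc_last] at this
    rw [map_add, this, h, h', map_add, map_add]
  | @homogeneous b a =>
    have : (LinearMap.applyₗ (sc a)).compMultilinearMap
        ((Λ.bracket (n + 1)).curryRight.compLinearMap (fun _ => vc)) =
        sc.toLinearMap.compMultilinearMap
          ((LinearMap.applyₗ (a : A)).compMultilinearMap (X.anchor n)) := by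
      refine ext_homogeneous ℒ fun d v hv => ?_
      have hl : ∀ p ∈ List.ofFn (fun i => (d i, v i)), p ∈ homog ℒ := forall_ofFn_mem.mpr hv
      have hl' := ofGens_mem hS (sc := sc) (vecs_mem (𝒜 := 𝒜).mpr hl)
      have h1 := h.gens ((b, Sum.inl a) :: vecs (List.ofFn fun i => (d i, v i)))
        (List.forall_mem_cons.mpr ⟨a.2, vecs_mem.mpr hl⟩)
      have h2 := (fev_symm Λ.bracket_symm).cons_eq (x := (b, sc a)) (hS.sc_mem a.2) hl'
      rw [genBracket_scalar, vecPart_vecs, ldeg_vecs] at h1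
      rw [ldeg_ofGens, ldeg_vecs] at h2
      have h3 := smul_left_cancel _ (h2.symm.trans h1)
      rw [fev_ofFn] at h3
      simp only [ofGens, vecs, List.map_ofFn] at h3
      rw [fev_ofFn_snoc] at h3
      exact h3
    exact congrArg (fun f => f ξ) this

/-- Multilinearity reduces to homogeneous entries, and graded symmetry moves the two scalars to the
front, where `scalar_scalar` applies. -/
theorem IsExtension.bracket_eq_zero {X : LRInfinityAlgebra 𝒜 ℒ} (hS : IsSymAlg 𝒜 ℒ sc vc 𝒮)
    [GradedAlgebra 𝒜] [Decomposition 𝒮] {Λ : PInfinityAlgebra 𝒮}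
    (h : IsExtension X sc vc 𝒮 (fev Λ.bracket)) (k : ℕ) (u : Fin k → S) (i j : Fin k)
    (hij : i ≠ j) (hi : u i ∈ Set.range sc) (hj : u j ∈ Set.range sc) : Λ.bracket k u = 0 := by
  classical
  have hrange : ∀ x ∈ Set.range sc, x ∈ Submodule.span K {y | ∃ d, ∃ a ∈ 𝒜 d, y = sc a} := by
    rintro _ ⟨a, rfl⟩
    induction a using DirectSum.Decomposition.inductionOn 𝒜 with
    | zero => rw [map_zero]; exact zero_mem _
    | add x y hx hy => rw [map_add]; exact add_mem hx hy
    | @homogeneous d x => exact Submodule.subset_span ⟨d, x, x.2, rfl⟩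
  refine multilinearMap_eq_zero_of_span _ (fun t => if t = i ∨ t = j then
    {y | ∃ d, ∃ a ∈ 𝒜 d, y = sc a} else {y | ∃ d, y ∈ 𝒮 d}) (fun v hv => ?_) u fun t => ?_
  · obtain ⟨n, rfl⟩ : ∃ n, k = n + 2 := by
      match k, i, j, hij with
      | 0, i, _, _ => exact i.elim0
      | 1, i, j, hij => exact absurd (Subsingleton.elim i j) hij
      | n + 2, _, _, _ => exact ⟨n, rfl⟩
    have hvi := hv i
    have hvj := hv j
    simp only [true_or, or_true, if_true] at hvi hvj
    obtain ⟨b, a, ha, hvi⟩ := hvi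
    obtain ⟨b', a', ha', hvj⟩ := hvj
    -- Degrees are not unique, since `0` has every degree; at `i` and `j` those of the given scalars
    -- are imposed.
    have hv' : ∀ t, ∃ d, v t ∈ 𝒮 d ∧ (t = i → d = b) ∧ (t = j → d = b') := by
      intro t
      by_cases hti : t = i
      · subst hti
        exact ⟨b, hvi ▸ hS.sc_mem ha, fun _ => rfl, fun h => absurd h hij⟩
      · by_cases htj : t = j
        · subst htj
          exact ⟨b', hvj ▸ hS.sc_mem ha', fun h => absurd h hti, fun _ => rfl⟩
        · have := hv t
          rw [if_neg (by tauto)] at this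
          obtain ⟨d, hd⟩ := this
          exact ⟨d, hd, fun h => absurd h hti, fun h => absurd h htj⟩
    choose d hd hdi hdj using hv'
    -- A permutation with `0 ↦ i` and `1 ↦ j`; the right factor anticipates where the left one sends
    -- `j`.
    let σ : Equiv.Perm (Fin (n + 2)) := Equiv.swap 0 i * Equiv.swap 1 (Equiv.swap 0 i j)
    have hσ0 : σ 0 = i := by
      have h1 : (0 : Fin (n + 2)) ≠ Equiv.swap 0 i j := fun h => hij (by
        simpa using congrArg (Equiv.swap 0 i) h)
      simp only [σ, Equiv.Perm.mul_apply]
      rw [Equiv.swap_apply_of_ne_of_ne (by simp) h1, Equiv.swap_apply_left]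
    have hσ1 : σ 1 = j := by simp [σ, Equiv.Perm.mul_apply]
    have h1 := Λ.bracket_symm (n + 2) d v hd σ
    have h2 : Λ.bracket (n + 2) (fun t => v (σ t)) = 0 := by
      have h3 := fev_ofFn (F := Λ.bracket) fun t => (d (σ t), v (σ t))
      rw [← h3, List.ofFn_succ, List.ofFn_succ]
      have hl : ∀ p ∈ (List.ofFn fun t : Fin n => (d (σ t.succ.succ), v (σ t.succ.succ))),
        p ∈ homog 𝒮 := forall_ofFn_mem.mpr fun t => hd _
      rw [← h.scalar_scalar X hS ha ha' hl, show Fin.succ 0 = (1 : Fin (n + 2)) from rfl, hσ0, hσ1,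
        hvi, hvj, hdi i rfl, hdj j rfl]
    rw [h2] at h1
    exact (smul_eq_zero_iff_eq _).mp h1.symm
  · split_ifs with ht
    · rcases ht with rfl | rfl
      · exact hrange _ hi
      · exact hrange _ hj
    · exact mem_span_homogeneous 𝒮 _

end

universe u
variable {S : Type u} [Ring S] [Algebra K S] {𝒮 : ℤ → Submodule K S}
  {sc : A →ₐ[K] S} {vc : L →ₗ[K] S}

/-- The `P_∞[1]` structure on the graded symmetric algebra extending an `LR_∞[1]` structure. -/
theorem IsSymAlg.exists_isExtension (hS : IsSymAlg 𝒜 ℒ sc vc 𝒮) [GradedAlgebra 𝒜]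
    (hA : GradedComm 𝒜) [Decomposition ℒ] [SetLike.GradedSMul 𝒜 ℒ] [Decomposition 𝒮] :
    ∃ Λ : PInfinityAlgebra 𝒮, IsExtension X sc vc 𝒮 (fev Λ.bracket) := by
  have := hS.gradedMonoid
  choose F hF hg using fun n : ℕ => hS.exists_isDerMap hA n (isGenDer_genBracket X hS)
  -- The component without entries is set to zero, as `bracket_zero` demands. This agrees with the
  -- prescribed value on the empty list because `X.bracket 0 = 0`.
  let G : (n : ℕ) → MultilinearMap K (fun _ : Fin n => S) S
    | 0 => 0
    | n + 1 => F (n + 1)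
  have hG : ∀ n, IsDerMap 𝒮 1 (G n) := by
    intro n
    cases n with
    | zero => simpa [G] using (hF 0).smul (0 : K)
    | succ n => exact hF (n + 1)
  have hext : IsExtension X sc vc 𝒮 (fev G) := by
    refine ⟨⟨fev_symm fun n => gradedSymm_iff.mpr (hG n).der.symm,
      fun d x y l _ _ _ => fev_add_cons d x y l,
      fun b x c y l => (hG (l.length + 1)).der.leib b x c y l⟩,
      fun l hl => fev_mem (fun n => hasDegree_iff.mpr (hG n).degree) hl, fun g hgm => ?_⟩
    cases g with
    | nil =>
      have : fev G (ofGens sc vc ([] : List (ℤ × (A ⊕ L)))) = 0 :=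
        lev_zero (K := K) (m := 0) ([] : List (ℤ × S))
      rw [this, genBracket]
      have h0 : fev X.bracket (vecPart ([] : List (ℤ × (A ⊕ L)))) = 0 := by
        have : fev X.bracket (vecPart ([] : List (ℤ × (A ⊕ L)))) = lev (X.bracket 0) [] := rfl
        rw [this, X.bracket_zero, lev_zero]
      rw [h0, shuf_nil]
      simp [scalarPart]
    | cons x g =>
      rw [fev_eq_lev (m := g.length + 1) (by simp [ofGens])]
      exact hg (g.length + 1) _ rfl hgm
  refine ⟨⟨G, rfl, fun n => hasDegree_iff.mpr (hG n).degree,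
    fun n => gradedSymm_iff.mpr (hG n).der.symm, fun n d u hu c v hv w => ?_,
    fun k d u hu => ?_⟩, hext⟩
  · induction w using DirectSum.Decomposition.inductionOn 𝒮 with
    | zero =>
      have h0 : G (n + 1) (Fin.snoc u 0) = 0 := (G (n + 1)).map_coord_zero (Fin.last n) (by simp)
      simp [h0]
    | add w w' h h' =>
      have hadd : ∀ x y : S, G (n + 1) (Fin.snoc u (x + y)) =
          G (n + 1) (Fin.snoc u x) + G (n + 1) (Fin.snoc u y) := by
        intro x y
        have := (G (n + 1)).map_update_add (Fin.snoc u 0) (Fin.last n) x y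
        simpa only [Fin.update_snoc_last] using this
      rw [mul_add, hadd, hadd, h, h']
      simp only [mul_add, smul_add]
      abel
    | @homogeneous e w =>
      have hl : ∀ p ∈ List.ofFn (fun i => (d i, u i)), p ∈ homog 𝒮 := forall_ofFn_mem.mpr hu
      have hs := hext.der.symm
      have hvw : v * w ∈ 𝒮 (c + e) := SetLike.mul_mem_graded hv w.2
      have key := hext.der.leib c v e w _ hv w.2 hl
      rw [hs.cons_eq hvw hl, hs.cons_eq (x := (e, (w : S))) w.2 hl,
        hs.cons_eq (x := (c, v)) hv hl, fev_ofFn_snoc, fev_ofFn_snoc, fev_ofFn_snoc] at key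
      have key' := congrArg
        (fun x => ((c + e) * ldeg (List.ofFn fun i => (d i, u i))).negOnePow • x) key
      simp only [smul_add, negOnePow_smul_smul, mul_smul_comm, smul_mul_assoc,
        AlgHom.id_apply] at key'
      rw [← two_mul, Int.negOnePow_two_mul, one_smul] at key'
      rw [key', ldeg_ofFn]
      congr 1
      · apply negOnePow_smul_eq
        simp only [parity_simps]; grind
      · rw [negOnePow_smul_eq (b := 0), Int.negOnePow_zero, one_smul]
        simp only [parity_simps]; grind
  · exact (shuf_ofFn_bracket _ _ _ _ _).symm.trans
      (hext.jacobiator_eq_zero X hS (forall_ofFn_mem.mpr hu))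

end Poisson

/-! ### Nested graded commutators in a ring. -/

section NestedCommutators

variable {R : Type*} [Ring R]

/-- The nested graded commutator of `T`, of degree `e`, with the entries of a list. -/
def ncl (e : ℤ) (T : R) : List (ℤ × R) → R
  | [] => T
  | x :: l => ncl (e + x.1) (T * x.2 - (e * x.1).negOnePow • (x.2 * T)) l

theorem ncl_cons (e : ℤ) (T : R) (x : ℤ × R) (l : List (ℤ × R)) : ncl e T (x :: l) =
    ncl (e + x.1) (T * x.2 - (e * x.1).negOnePow • (x.2 * T)) l := rfl

theorem nestedComm_eq_ncl {K W : Type*} [Field K] [AddCommGroup W] [Module K W] {n : ℕ} (e : ℤ)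
    (T : Module.End K W) (d : Fin n → ℤ) (U : Fin n → Module.End K W) :
    nestedComm e T d U = ncl e T (List.ofFn fun i => (d i, U i)) := by
  induction n generalizing e T with
  | zero => rfl
  | succ n ih => rw [nestedComm, ih, List.ofFn_succ, ncl_cons, gradedComm]

theorem ncl_add (e : ℤ) (S T : R) (l : List (ℤ × R)) : ncl e (S + T) l = ncl e S l + ncl e T l := by
  induction l generalizing e S T with
  | nil => rfl
  | cons x l ih =>
    rw [ncl_cons, ncl_cons, ncl_cons, ← ih]
    congr 1
    rw [add_mul, mul_add, smul_add]
    abel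

@[simp] theorem ncl_zero (e : ℤ) (l : List (ℤ × R)) : ncl e (0 : R) l = 0 := by
  have := ncl_add e (0 : R) 0 l
  rwa [add_zero, left_eq_add] at this

/-- Nested commutators depend additively on the operator. -/
def nclHom (e : ℤ) (l : List (ℤ × R)) : R →+ R where
  toFun T := ncl e T l
  map_zero' := ncl_zero e l
  map_add' S T := ncl_add e S T l

theorem ncl_negOnePow_smul (e k : ℤ) (T : R) (l : List (ℤ × R)) :
    ncl e (k.negOnePow • T) l = k.negOnePow • ncl e T l := by
  rw [Units.smul_def, Units.smul_def]
  exact map_zsmul (nclHom e l) _ T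

theorem ncl_sum {ι : Type*} (s : Finset ι) (e : ℤ) (T : ι → R) (l : List (ℤ × R)) :
    ncl e (∑ i ∈ s, T i) l = ∑ i ∈ s, ncl e (T i) l :=
  map_sum (nclHom e l) T s

theorem ncl_append (e : ℤ) (T : R) (l l' : List (ℤ × R)) :
    ncl e T (l ++ l') = ncl (e + ldeg l) (ncl e T l) l' := by
  induction l generalizing e T with
  | nil => simp [ncl]
  | cons x l ih => rw [List.cons_append, ncl_cons, ncl_cons, ih, ldeg_cons, add_assoc]

/-- Nested commutators of a product. -/
theorem ncl_mul (p q : ℤ) (S T : R) (l : List (ℤ × R)) :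
    ncl (p + q) (S * T) l = shuf l fun a b => (q * ldeg a).negOnePow • (ncl p S a * ncl q T b) := by
  induction l generalizing p q S T with
  | nil => simp [ncl, shuf_nil]
  | cons x l ih =>
    -- The commutator with `x` is a graded derivation, so each successive entry acts on one of the
    -- two factors: this is the recursion of `shuf`.
    have h : S * T * x.2 - ((p + q) * x.1).negOnePow • (x.2 * (S * T)) =
        S * (T * x.2 - (q * x.1).negOnePow • (x.2 * T)) +
        (q * x.1).negOnePow • ((S * x.2 - (p * x.1).negOnePow • (x.2 * S)) * T) := by
      simp only [mul_sub, sub_mul, smul_sub, mul_smul_comm, smul_mul_assoc, negOnePow_smul_smul,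
        mul_assoc]
      rw [add_mul, add_comm (p * x.1)]
      abel
    rw [ncl_cons, h, ncl_add, ncl_negOnePow_smul, add_assoc, ih, ← add_assoc, add_right_comm, ih,
      shuf_cons, add_comm, ← shuf_negOnePow_smul]
    congr 1 <;> refine shuf_congr fun a b _ _ _ _ => ?_ <;>
      simp only [ncl_cons, negOnePow_smul_smul, ldeg_cons] <;> apply negOnePow_smul_eq <;>
      simp only [parity_simps] <;> grind

/-- Operators with degrees commute in the graded sense. -/
def GradedCommute (x y : ℤ × R) : Prop := x.2 * y.2 = (x.1 * y.1).negOnePow • (y.2 * x.2)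

theorem ncl_eq_zero {e : ℤ} {T : R} {x : ℤ × R} {l : List (ℤ × R)} (h : GradedCommute (e, T) x) :
    ncl e T (x :: l) = 0 := by
  rw [ncl_cons, show T * x.2 = _ from h, sub_self, ncl_zero]

/-- By the graded Jacobi identity, commutators with `x` and with `y` commute up to the commutator of
`x` and `y`, which is zero. -/
theorem ncl_swap {e : ℤ} {T : R} {x y : ℤ × R} (h : GradedCommute x y) (l : List (ℤ × R)) :
    ncl e T (x :: y :: l) = (x.1 * y.1).negOnePow • ncl e T (y :: x :: l) := by
  rw [ncl_cons, ncl_cons, ncl_cons, ncl_cons, ← ncl_negOnePow_smul, add_right_comm]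
  congr 1
  have h' : x.2 * y.2 = (x.1 * y.1).negOnePow • (y.2 * x.2) := h
  simp only [mul_sub, sub_mul, smul_sub, mul_smul_comm, smul_mul_assoc, negOnePow_smul_smul]
  rw [mul_assoc T, h', ← mul_assoc y.2 x.2, ← mul_assoc x.2 y.2, h']
  simp only [mul_smul_comm, smul_mul_assoc, negOnePow_smul_smul, mul_assoc]
  rw [sub_sub_sub_comm]
  refine congrArg₂ _ (congrArg₂ _ rfl ?_) (congrArg₂ _ ?_ ?_) <;>
    apply negOnePow_smul_eq <;> simp only [parity_simps] <;> grind

theorem ncl_lsymm {Hm : Set (ℤ × R)} (h : ∀ x ∈ Hm, ∀ y ∈ Hm, GradedCommute x y) (e : ℤ) (T : R) :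
    LSymm Hm (ncl e T) := by
  intro pre x y post hp
  rw [ncl_append, ncl_append, ncl_swap]
  exact h x (hp x (by simp)) y (hp y (by simp))

/-- Nested commutators as multiderivations. -/
theorem isMultiDer_ncl {K S : Type*} [Field K] [Ring S] [Algebra K S] [Algebra K R]
    {𝒮 : ℤ → Submodule K S} [SetLike.GradedMonoid 𝒮] {ρ : S →ₐ[K] R}
    (h𝒮 : ∀ {b c : ℤ} {x y : S}, x ∈ 𝒮 b → y ∈ 𝒮 c → x * y = (b * c).negOnePow • (y * x))
    (e : ℤ) (T : R) :
    IsMultiDer 𝒮 ρ e fun l => ncl e T (l.map fun x => (x.1, ρ x.2)) := by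
  have hρ : ∀ x ∈ homog 𝒮, ∀ y ∈ homog 𝒮, GradedCommute (x.1, ρ x.2) (y.1, ρ y.2) := by
    intro x hx y hy
    rw [GradedCommute, ← map_mul, h𝒮 hx hy, Units.smul_def, map_zsmul, map_mul, Units.smul_def]
  -- The factors `ρ x` and `ρ y` of a product commute with all later entries. In the expansion by
  -- `ncl_mul` these must therefore all fall on the factor that contains `T`.
  have hz : ∀ (x : ℤ × S) (l : List (ℤ × S)), x ∈ homog 𝒮 → (∀ p ∈ l, p ∈ homog 𝒮) →
      ∀ l' ⊆ l.map (fun x => (x.1, ρ x.2)), l' ≠ [] → ncl x.1 (ρ x.2) l' = 0 := by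
    intro x l hx hl l' hl' hne
    obtain ⟨y, l', rfl⟩ := List.exists_cons_of_ne_nil hne
    obtain ⟨z, hz, rfl⟩ := List.mem_map.mp (hl' List.mem_cons_self)
    exact ncl_eq_zero (hρ x hx z (hl z hz))
  refine ⟨?_, fun d x y l _ _ _ => ?_, fun b x c y l hx hy hl => ?_⟩
  · refine LSymm.comap (Hm' := {y | ∃ x ∈ homog 𝒮, y = (x.1, ρ x.2)}) (ncl_lsymm ?_ e T) ρ
      fun x hx => ⟨x, hx, rfl⟩
    rintro _ ⟨x, hx, rfl⟩ _ ⟨y, hy, rfl⟩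
    exact hρ x hx y hy
  · simp only [List.map_cons, ncl_cons]
    rw [← ncl_add]
    congr 1
    rw [map_add, mul_add, add_mul, smul_add]
    abel
  · simp only [List.map_cons, ncl_cons]
    have h : T * ρ (x * y) - (e * (b + c)).negOnePow • (ρ (x * y) * T) =
        (e * b).negOnePow • (ρ x * (T * ρ y - (e * c).negOnePow • (ρ y * T))) +
        (T * ρ x - (e * b).negOnePow • (ρ x * T)) * ρ y := by
      simp only [map_mul, mul_sub, sub_mul, smul_sub, mul_smul_comm, smul_mul_assoc,
        negOnePow_smul_smul, mul_assoc, mul_add]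
      abel
    rw [h, ncl_add, ncl_negOnePow_smul]
    congr 1
    · rw [show e + (b + c) = b + (e + c) by ring, ncl_mul, shuf_of_left_nil]
      · simp [ncl]
      · intro a b' ha ha'
        rw [hz (b, x) l hx hl a ha ha', zero_mul, smul_zero]
    · rw [← add_assoc, ncl_mul, shuf_of_right_nil]
      · simp [ncl]
      · intro a b' ha ha'
        rw [hz (c, y) l hy hl b' ha ha', mul_zero, smul_zero]

end NestedCommutators

/-! ### The Chevalley–Eilenberg formula on lists. -/

section Operators

variable {K A L P : Type*} [Field K] [Ring A] [Algebra K A]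
  [AddCommGroup L] [Module K L] [Module A L]
  [AddCommGroup P] [Module K P] [Module A P] [IsScalarTower K A P]
  {𝒜 : ℤ → Submodule K A} {ℒ : ℤ → Submodule K L} {ℳ : ℤ → Submodule K P}

theorem lev_eq_ite {V W : Type*} [AddCommGroup V] [Module K V] [AddCommGroup W] [Module K W]
    (F : (n : ℕ) → MultilinearMap K (fun _ : Fin n => V) W) (n : ℕ) (l : List (ℤ × V)) :
    lev (F n) l = if l.length = n then fev F l else 0 := by
  split_ifs with h
  · rw [fev_eq_lev h]
  · exact lev_of_ne _ h

/-- The Chevalley–Eilenberg formula of degree `e`, with the connection `f` and the bracket `g`, on a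
form `φ` of degree `c`. -/
def ceForm (e c : ℤ) (f : List (ℤ × L) → Module.End K P) (g : List (ℤ × L) → L)
    (φ : List (ℤ × L) → P) (l : List (ℤ × L)) : P :=
  (shuf l fun a b => (c * ldeg a).negOnePow • f a (φ b)) -
    shuf l fun a b => (e * c).negOnePow • φ ((ldeg a + e, g a) :: b)

theorem ceForm_congr {e c : ℤ} {f f' : List (ℤ × L) → Module.End K P} {g g' : List (ℤ × L) → L}
    {φ φ' : List (ℤ × L) → P} {l : List (ℤ × L)} (hl : ∀ p ∈ l, p ∈ homog ℒ)
    (hf : ∀ a, (∀ p ∈ a, p ∈ homog ℒ) → f a = f' a) (hg : ∀ a, (∀ p ∈ a, p ∈ homog ℒ) → g a = g' a)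
    (hg' : ∀ a, (∀ p ∈ a, p ∈ homog ℒ) → g a ∈ ℒ (ldeg a + e))
    (hφ : ∀ a, (∀ p ∈ a, p ∈ homog ℒ) → φ a = φ' a) :
    ceForm e c f g φ l = ceForm e c f' g' φ' l := by
  refine congrArg₂ _ (shuf_congr fun a b ha hb _ _ => ?_) (shuf_congr fun a b ha hb _ _ => ?_) <;>
    have ha' : ∀ p ∈ a, p ∈ homog ℒ := fun p hp => hl p (ha hp) <;>
    have hb' : ∀ p ∈ b, p ∈ homog ℒ := fun p hp => hl p (hb hp)
  · rw [hf a ha', hφ b hb']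
  · rw [hφ _ (List.forall_mem_cons.mpr ⟨hg' a ha', hb'⟩), hg a ha']

theorem ceForm_neg (e c : ℤ) (f : List (ℤ × L) → Module.End K P) (g : List (ℤ × L) → L)
    (Ψ : Cochain K L P) (l : List (ℤ × L)) :
    ceForm e c (fun a => -f a) (fun a => -g a) (fev Ψ) l = -ceForm e c f g (fev Ψ) l := by
  have h : ∀ d x b, fev Ψ ((d, -x) :: b) = -fev Ψ ((d, x) :: b) := fun d x b => by
    rw [← neg_one_smul K x, fev_smul_cons, neg_one_smul]
  simp only [ceForm, h, LinearMap.neg_apply, smul_neg, shuf_neg]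
  abel

/-- The Chevalley–Eilenberg formula with one entry split off. -/
theorem ceForm_cons {e c : ℤ} (f : List (ℤ × L) → Module.End K P) {g : List (ℤ × L) → L}
    {φ : List (ℤ × L) → P} (hφ : LSymm (homog ℒ) φ)
    (hg : ∀ a, (∀ p ∈ a, p ∈ homog ℒ) → g a ∈ ℒ (ldeg a + e)) {ξ : ℤ × L} (hξ : ξ ∈ homog ℒ)
    {l : List (ℤ × L)} (hl : ∀ p ∈ l, p ∈ homog ℒ) :
    ceForm e c f g φ (ξ :: l) = ceForm e (c + ξ.1) f g (fun b => φ (ξ :: b)) l +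
      (c * ξ.1).negOnePow • ceForm (e + ξ.1) c (fun a => f (ξ :: a)) (fun a => g (ξ :: a)) φ l := by
  simp only [ceForm, shuf_cons, smul_sub, ← shuf_negOnePow_smul, negOnePow_smul_smul]
  -- The terms are grouped by the place of `ξ`: an argument of the form (`q` and `s`), or of the
  -- connection or bracket (`p` and `r`).
  rw [show ∀ p q r s : P, p + q - (r + s) = (q - s) + (p - r) from fun _ _ _ _ => by abel]
  refine congrArg₂ _ (congrArg₂ _ ?_ ?_) (congrArg₂ _ ?_ ?_) <;>
    refine shuf_congr fun a b ha hb _ _ => ?_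
  · apply negOnePow_smul_eq
    simp only [parity_simps]; grind
  · rw [hφ.swap (x := (ldeg a + e, g a)) (hg a fun p hp => hl p (ha hp)) hξ
      (fun p hp => hl p (hb hp)), negOnePow_smul_smul]
    apply negOnePow_smul_eq
    simp only [parity_simps]; grind
  · apply negOnePow_smul_eq
    simp only [ldeg_cons, parity_simps]; grind
  · rw [ldeg_cons, show ξ.1 + ldeg a + e = ldeg a + (e + ξ.1) by ring]
    apply negOnePow_smul_eq
    simp only [parity_simps]; grind

theorem mem_homForms_iff [GradedAlgebra 𝒜] [SetLike.GradedSMul 𝒜 ℒ] {n : ℕ} {c : ℤ}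
    {Ω : MultilinearMap K (fun _ : Fin n => L) P} : Ω ∈ homForms 𝒜 ℒ ℳ n c ↔
      (∀ l, (∀ p ∈ l, p ∈ homog ℒ) → lev Ω l ∈ ℳ (c + ldeg l)) ∧ LSymm (homog ℒ) (lev Ω) ∧
      ∀ (d : ℤ) (x : L) (l : List (ℤ × L)), x ∈ ℒ d → (∀ p ∈ l, p ∈ homog ℒ) →
        ∀ (b : ℤ), ∀ a ∈ 𝒜 b,
          lev Ω ((b + d, a • x) :: l) = (c * b).negOnePow • a • lev Ω ((d, x) :: l) := by
  constructor
  · rintro ⟨h1, h2, h3⟩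
    exact ⟨hasDegree_iff.mp h1, gradedSymm_iff.mp h2,
      fun d x l hx hl b a ha => h3.lev_cons (x := (d, x)) hx hl ha⟩
  · rintro ⟨h1, h2, h3⟩
    exact ⟨hasDegree_iff.mpr h1, gradedSymm_iff.mpr h2,
      gradedALinear_of_cons (gradedSymm_iff.mpr h2) h3⟩

section Cochains

variable {Ψ : Cochain K L P} {c : ℤ}

theorem fev_mem_of_homForms (h : ∀ n, Ψ n ∈ homForms 𝒜 ℒ ℳ n c) {l : List (ℤ × L)}
    (hl : ∀ p ∈ l, p ∈ homog ℒ) : fev Ψ l ∈ ℳ (c + ldeg l) := fev_mem (fun n => (h n).1) hl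

theorem fev_lsymm_of_homForms (h : ∀ n, Ψ n ∈ homForms 𝒜 ℒ ℳ n c) : LSymm (homog ℒ) (fev Ψ) :=
  fev_symm fun n => (h n).2.1

theorem fev_smul_of_homForms (h : ∀ n, Ψ n ∈ homForms 𝒜 ℒ ℳ n c) {d b d' : ℤ} {x : L} {a : A}
    {l : List (ℤ × L)} (hx : x ∈ ℒ d) (hl : ∀ p ∈ l, p ∈ homog ℒ) (ha : a ∈ 𝒜 b) :
    fev Ψ ((d', a • x) :: l) = (c * b).negOnePow • a • fev Ψ ((d, x) :: l) :=
  (h (l.length + 1)).2.2.lev_cons (x := (d, x)) hx hl ha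

theorem homForms_of_fev [GradedAlgebra 𝒜] [SetLike.GradedSMul 𝒜 ℒ]
    (h1 : ∀ l, (∀ p ∈ l, p ∈ homog ℒ) → fev Ψ l ∈ ℳ (c + ldeg l)) (h2 : LSymm (homog ℒ) (fev Ψ))
    (h3 : ∀ (d : ℤ) (x : L) (l : List (ℤ × L)), x ∈ ℒ d → (∀ p ∈ l, p ∈ homog ℒ) →
        ∀ (b : ℤ), ∀ a ∈ 𝒜 b,
          fev Ψ ((b + d, a • x) :: l) = (c * b).negOnePow • a • fev Ψ ((d, x) :: l)) (n : ℕ) :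
    Ψ n ∈ homForms 𝒜 ℒ ℳ n c := by
  refine mem_homForms_iff.mpr ⟨fun l hl => ?_, fun pre x y post hp => ?_,
    fun d x l hx hl b a ha => ?_⟩
  · rw [lev_eq_ite Ψ]
    split_ifs
    · exact h1 l hl
    · exact zero_mem _
  · rw [lev_eq_ite Ψ, lev_eq_ite Ψ, h2 pre x y post hp,
      show (pre ++ y :: x :: post).length = (pre ++ x :: y :: post).length by simp]
    split_ifs <;> simp
  · rw [lev_eq_ite Ψ, lev_eq_ite Ψ, h3 d x l hx hl b a ha]
    simp only [List.length_cons]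
    split_ifs <;> simp

theorem ext_fev [Decomposition ℒ] {Ψ Ψ' : Cochain K L P}
    (h : ∀ l, (∀ p ∈ l, p ∈ homog ℒ) → fev Ψ l = fev Ψ' l) : Ψ = Ψ' := by
  refine funext fun n => ext_lev (𝒱 := ℒ) fun l hn hl => ?_
  rw [← fev_eq_lev hn, ← fev_eq_lev hn, h l hl]

variable [Decomposition ℒ] [Decomposition ℳ]

theorem twist_component {e : ℤ} {n : ℕ} (h : HasDegree ℒ ℳ c (Ψ n)) :
    twist ℒ ℳ e Ψ n = (e * c).negOnePow • Ψ n := by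
  have h1 := congrFun (twist_apply ℒ ℳ (e := e) h) n
  rw [Pi.smul_apply, Pi.single_eq_same] at h1
  rw [← h1]
  change (gsign ℳ e).compMultilinearMap ((Ψ n).compLinearMap fun _ => gsign ℒ e) =
    (gsign ℳ e).compMultilinearMap (((Pi.single n (Ψ n) : Cochain K L P) n).compLinearMap
      fun _ => gsign ℒ e)
  rw [Pi.single_eq_same]

theorem fev_contract {d : ℤ} {ξ : L} (hξ : ξ ∈ ℒ d) (h : ∀ n, HasDegree ℒ ℳ c (Ψ n))
    (l : List (ℤ × L)) :
    fev (contract ℒ ℳ ξ Ψ) l = (d * c).negOnePow • fev Ψ ((d, ξ) :: l) := by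
  have : contract ℒ ℳ ξ Ψ l.length = (twist ℒ ℳ d Ψ (l.length + 1)).curryLeft ξ := by
    rw [contract, LinearMap.comp_apply, LinearEquiv.coe_coe, decomposeLinearEquiv_apply,
      decompose_of_mem ℒ hξ, ← lof_eq_of K, toModule_lof]
    rfl
  rw [fev, this, twist_component (h _), fev_cons, lev_cons, ← lev_smul]
  rfl

/-- The restrictions on the cardinality of the subsets are absorbed by `lev`, which is zero on lists
of the wrong length; then the bracket entry of the form is `0`. -/
theorem fev_ceOp {X : LRInfinityAlgebra 𝒜 ℒ} (N : LeftConnection X ℳ) (m : ℕ)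
    (h : ∀ n, HasDegree ℒ ℳ c (Ψ n)) {l : List (ℤ × L)} (hl : ∀ p ∈ l, p ∈ homog ℒ) :
    fev (N.ceOp m Ψ) l = ceForm 1 c (lev (N.conn m)) (lev (X.bracket (m + 1))) (fev Ψ) l := by
  obtain ⟨w, hw⟩ := exists_eq_ofFn l rfl
  generalize l.length = n at w hw
  subst hw
  rw [forall_ofFn_mem] at hl
  have h1 : N.ceOp m Ψ n (fun i => (w i).2) = _ :=
    gradedExt_apply ℒ _ (fun i => (w i).1) (fun i => (w i).2) hl
  rw [fev_ofFn, h1, ceForm, ← sum_unshuffleSign, ← sum_unshuffleSign]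
  simp only [_root_.sub_apply, _root_.sum_apply, _root_.smul_apply, connTerm_apply,
    bracketTerm_apply, twist_component (h _)]
  have hd := ldeg_sub (fun i => (w i).1) (fun i => (w i).2)
  congr 1
  · rw [Finset.sum_filter]
    refine Finset.sum_congr rfl fun I _ => ?_
    rw [lev_eq_ite N.conn, List.length_ofFn]
    split_ifs with hI
    · have h2 : ldeg (List.ofFn (sub w I)) = ∑ i ∈ I, (w i).1 := hd I
      rw [fev_ofFn, fev_ofFn, h2, mul_comm c, Units.smul_def, Units.smul_def, Units.smul_def,
        map_zsmul]
      rfl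
    · simp
  · rw [Finset.sum_filter]
    refine Finset.sum_congr rfl fun I _ => ?_
    rw [lev_eq_ite X.bracket, List.length_ofFn]
    split_ifs with hI
    · rw [fev_ofFn, fev_ofFn_cons]
      rfl
    · rw [fev_eq_zero (d := ldeg (List.ofFn (sub w I)) + 1) (by simp), smul_zero, smul_zero]

end Cochains

end Operators

/-! ### The operators `D_k` preserve symmetric `A`-multilinear forms. -/

section Preservation

/-- Transpositions preserve the total degree, so signs depending on it may be treated as constants.
-/
theorem LSymm.of_ldeg {V M : Type*} [AddCommGroup M] {Hm : Set (ℤ × V)}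
    {G : ℤ → List (ℤ × V) → M} (h : ∀ k, LSymm Hm (G k)) : LSymm Hm fun l => G (ldeg l) l := by
  intro pre x y post hp
  have : ldeg (pre ++ x :: y :: post) = ldeg (pre ++ y :: x :: post) := by
    simp only [ldeg_append, ldeg_cons]; ring
  simp only [this]
  exact h _ pre x y post hp

theorem fev_negOnePow_smul_cons {K V W : Type*} [Field K] [AddCommGroup V] [Module K V]
    [AddCommGroup W] [Module K W] {F : (n : ℕ) → MultilinearMap K (fun _ : Fin n => V) W} (d e : ℤ)
    (x : V) (l : List (ℤ × V)) :
    fev F ((d, e.negOnePow • x) :: l) = e.negOnePow • fev F ((d, x) :: l) :=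
  lev_negOnePow_smul_cons _ d e x l

variable {K A L P : Type*} [Field K] [Ring A] [Algebra K A]
  [AddCommGroup L] [Module K L] [Module A L]
  [AddCommGroup P] [Module K P] [Module A P] [IsScalarTower K A P]
  {𝒜 : ℤ → Submodule K A} {ℒ : ℤ → Submodule K L} {ℳ : ℤ → Submodule K P}
  {X : LRInfinityAlgebra 𝒜 ℒ}

theorem LRInfinityAlgebra.lev_bracket_mem (X : LRInfinityAlgebra 𝒜 ℒ) (m : ℕ) {l : List (ℤ × L)}
    (hl : ∀ p ∈ l, p ∈ homog ℒ) : lev (X.bracket m) l ∈ ℒ (ldeg l + 1) := by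
  rw [add_comm]
  exact hasDegree_iff.mp (X.bracket_degree m) l hl

theorem LeftConnection.lev_conn_smul (N : LeftConnection X ℳ) (m : ℕ) {b : ℤ} {a : A}
    {l : List (ℤ × L)} (ha : a ∈ 𝒜 b) (hl : ∀ p ∈ l, p ∈ homog ℒ) (p : P) :
    lev (N.conn m) l (a • p) = ((1 + ldeg l) * b).negOnePow • a • lev (N.conn m) l p +
      lev (X.anchor m) l a • p := by
  rcases eq_or_ne l.length m with h | h
  · obtain ⟨w, rfl⟩ := exists_eq_ofFn l h
    rw [forall_ofFn_mem] at hl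
    rw [lev_ofFn, lev_ofFn, N.conn_leibniz m (fun i => (w i).1) (fun i => (w i).2) hl b a ha p,
      ← ldeg_ofFn]
  · simp [lev_of_ne _ h]

theorem LeftConnection.lev_conn_cons_smul (N : LeftConnection X ℳ) (m : ℕ) {b d d' : ℤ} {a : A}
    {x : L} {l : List (ℤ × L)} (ha : a ∈ 𝒜 b) (hx : x ∈ ℒ d) (hl : ∀ p ∈ l, p ∈ homog ℒ) (p : P) :
    lev (N.conn m) ((d', a • x) :: l) p = b.negOnePow • a • lev (N.conn m) ((d, x) :: l) p := by
  have := (N.conn_linear m p).lev_cons (x := (d, x)) hx hl (d' := d') ha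
  rw [lev_comp, lev_comp, one_mul] at this
  exact this

theorem LRInfinityAlgebra.lev_bracket_cons_smul (X : LRInfinityAlgebra 𝒜 ℒ) (m : ℕ)
    [SetLike.GradedSMul 𝒜 ℒ] {b c : ℤ} {a : A} {ξ : L} {l : List (ℤ × L)}
    (ha : a ∈ 𝒜 b) (hξ : ξ ∈ ℒ c) (hl : ∀ p ∈ l, p ∈ homog ℒ) :
    lev (X.bracket (m + 1)) ((b + c, a • ξ) :: l) =
      b.negOnePow • a • lev (X.bracket (m + 1)) ((c, ξ) :: l) +
      ((b + c) * ldeg l).negOnePow • lev (X.anchor m) l a • ξ := by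
  have := X.bracket_cons_smul ha hξ hl
  rw [lev_eq_ite X.bracket, lev_eq_ite X.bracket, lev_eq_ite X.anchor]
  simp only [List.length_cons, add_left_inj]
  split_ifs
  · exact this
  · simp

variable {Ψ : Cochain K L P} {c : ℤ}

theorem LeftConnection.ceForm_lsymm (N : LeftConnection X ℳ) (m : ℕ)
    (h : ∀ n, Ψ n ∈ homForms 𝒜 ℒ ℳ n c) : LSymm (homog ℒ)
      (ceForm 1 c (lev (N.conn m)) (lev (X.bracket (m + 1))) (fev Ψ)) := by
  have hφ := fev_lsymm_of_homForms h
  have hf := gradedSymm_iff.mp (N.conn_symm m)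
  have hg := gradedSymm_iff.mp (X.bracket_symm (m + 1))
  refine LSymm.sub (shuf_lsymm (fun b _ => ?_) fun a _ => ?_)
    (shuf_lsymm (fun b _ => ?_) fun a ha => ?_)
  · exact LSymm.of_ldeg (G := fun k a => (c * k).negOnePow • lev (N.conn m) a (fev Ψ b))
      fun k => (hf.map (LinearMap.applyₗ (R := K) (fev Ψ b))).smul _
  · exact (hφ.map (lev (N.conn m) a)).smul _
  · refine LSymm.of_ldeg (G := fun k a =>
      (1 * c).negOnePow • fev Ψ ((k + 1, lev (X.bracket (m + 1)) a) :: b)) fun k => ?_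
    exact (hg.map (AddMonoidHom.mk' (fun x => fev Ψ ((k + 1, x) :: b))
      fun x y => fev_add_cons _ _ _ _)).smul _
  · exact (hφ.cons (X.lev_bracket_mem (m + 1) ha)).smul _

theorem LeftConnection.ceForm_mem (N : LeftConnection X ℳ) (m : ℕ)
    (h : ∀ n, Ψ n ∈ homForms 𝒜 ℒ ℳ n c) {l : List (ℤ × L)} (hl : ∀ p ∈ l, p ∈ homog ℒ) :
    ceForm 1 c (lev (N.conn m)) (lev (X.bracket (m + 1))) (fev Ψ) l ∈ ℳ (1 + c + ldeg l) := by
  refine sub_mem (shuf_mem fun a b ha hb hd _ => ?_) (shuf_mem fun a b ha hb hd _ => ?_) <;>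
    have ha' : ∀ p ∈ a, p ∈ homog ℒ := fun p hp => hl p (ha hp) <;>
    have hb' : ∀ p ∈ b, p ∈ homog ℒ := fun p hp => hl p (hb hp) <;>
    rw [Units.smul_def] <;> refine zsmul_mem ?_ _
  · have := hasDegree_iff.mp (N.conn_degree m) a ha' _ _ (fev_mem_of_homForms h hb')
    rwa [show 1 + ldeg a + (c + ldeg b) = 1 + c + ldeg l by rw [← hd]; ring] at this
  · have := fev_mem_of_homForms h (l := (ldeg a + 1, lev (X.bracket (m + 1)) a) :: b)
      (List.forall_mem_cons.mpr ⟨X.lev_bracket_mem (m + 1) ha', hb'⟩)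
    rwa [ldeg_cons, show c + (ldeg a + 1 + ldeg b) = 1 + c + ldeg l by rw [← hd]; ring] at this

/-- The connection applied to `a Ω(x, β)` and the bracket with the entry `a x` both produce `σ(α |
a) Ω(x, β)`, up to sign. In the difference of the two sums these terms cancel, and everything else
is `A`-linear. -/
theorem LeftConnection.ceForm_cons_smul [GradedAlgebra 𝒜] [SetLike.GradedSMul 𝒜 ℒ]
    (N : LeftConnection X ℳ) (m : ℕ)
    (h : ∀ n, Ψ n ∈ homForms 𝒜 ℒ ℳ n c) {b d : ℤ} {a : A} {x : L} {l : List (ℤ × L)}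
    (ha : a ∈ 𝒜 b) (hx : x ∈ ℒ d) (hl : ∀ p ∈ l, p ∈ homog ℒ) :
    ceForm 1 c (lev (N.conn m)) (lev (X.bracket (m + 1))) (fev Ψ) ((b + d, a • x) :: l) =
      ((1 + c) * b).negOnePow • a •
        ceForm 1 c (lev (N.conn m)) (lev (X.bracket (m + 1))) (fev Ψ) ((d, x) :: l) := by
  have hφ := fev_lsymm_of_homForms h
  have hax : a • x ∈ ℒ (b + d) := SetLike.GradedSMul.smul_mem ha hx
  have hmap : ∀ y : P, ((1 + c) * b).negOnePow • a • y =
      (DistribSMul.toAddMonoidHom P ((1 + c) * b).negOnePow).comp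
        (DistribSMul.toAddMonoidHom P a) y := fun _ => rfl
  rw [hmap, ceForm, ceForm, shuf_cons, shuf_cons, shuf_cons, shuf_cons, ← shuf_add, ← shuf_add,
    ← shuf_add, ← shuf_add, ← shuf_sub, ← shuf_sub, map_shuf]
  refine shuf_congr fun α β hα hβ _ _ => ?_
  have hα' : ∀ p ∈ α, p ∈ homog ℒ := fun p hp => hl p (hα hp)
  have hβ' : ∀ p ∈ β, p ∈ homog ℒ := fun p hp => hl p (hβ hp)
  have hg := X.lev_bracket_mem (m + 1) hα'
  have hg' := X.lev_bracket_mem (m + 1) (l := (d, x) :: α) (List.forall_mem_cons.mpr ⟨hx, hα'⟩)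
  rw [ldeg_cons] at hg'
  have hσ : lev (X.anchor m) α a ∈ 𝒜 (1 + ldeg α + b) :=
    hasDegree_iff.mp (X.anchor_degree m) α hα' b a ha
  have e1 : fev Ψ ((b + d + ldeg α + 1, lev (X.bracket (m + 1)) ((b + d, a • x) :: α)) :: β) =
      (b + c * b).negOnePow • a • fev Ψ ((d + ldeg α + 1, lev (X.bracket (m + 1)) ((d, x) :: α)) :: β)
      + ((b + d) * ldeg α + c * (1 + ldeg α + b)).negOnePow • lev (X.anchor m) α a •
        fev Ψ ((d, x) :: β) := by
    rw [X.lev_bracket_cons_smul m ha hx hα', fev_add_cons, fev_negOnePow_smul_cons,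
      fev_negOnePow_smul_cons]
    rw [fev_smul_of_homForms h hg' hβ' ha, fev_smul_of_homForms h hx hβ' hσ,
      negOnePow_smul_smul, negOnePow_smul_smul]
  have e2 : fev Ψ ((ldeg α + 1, lev (X.bracket (m + 1)) α) :: (b + d, a • x) :: β) =
      ((ldeg α + 1) * b + c * b).negOnePow • a •
        fev Ψ ((ldeg α + 1, lev (X.bracket (m + 1)) α) :: (d, x) :: β) := by
    rw [hφ.swap (x := (ldeg α + 1, lev (X.bracket (m + 1)) α)) (y := (b + d, a • x)) hg hax hβ',
      fev_smul_of_homForms h hx (List.forall_mem_cons.mpr ⟨hg, hβ'⟩) ha,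
      hφ.swap (x := (d, x)) (y := (ldeg α + 1, lev (X.bracket (m + 1)) α)) hx hg hβ',
      smul_comm a, negOnePow_smul_smul, negOnePow_smul_smul]
    apply negOnePow_smul_eq
    simp only [parity_simps]; grind
  simp only [ldeg_cons, e1, e2, N.lev_conn_cons_smul m ha hx hα', fev_smul_of_homForms h hx hβ' ha,
    N.lev_conn_smul m ha hα', Units.smul_def, map_zsmul, AddMonoidHom.comp_apply,
    DistribSMul.toAddMonoidHom_apply]
  simp only [← Units.smul_def, smul_add, smul_sub, negOnePow_smul_smul, smul_comm a (_ : ℤˣ)]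
  have cancel : ((b + d) * ldeg α + (c * ldeg α + c * b)).negOnePow • lev (X.anchor m) α a •
      fev Ψ ((d, x) :: β) =
      (1 * c + ((b + d) * ldeg α + c * (1 + ldeg α + b))).negOnePow • lev (X.anchor m) α a •
      fev Ψ ((d, x) :: β) := by
    apply negOnePow_smul_eq
    simp only [parity_simps]; grind
  rw [← cancel, show ∀ p q r s t : P, p + (q + r) - (s + r + t) = p + q - (s + t)
    from fun _ _ _ _ _ => by abel]
  refine congrArg₂ _ (congrArg₂ _ ?_ ?_) (congrArg₂ _ ?_ ?_) <;> apply negOnePow_smul_eq <;>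
    simp only [parity_simps] <;> grind

variable [Decomposition ℒ] [Decomposition ℳ]

theorem LeftConnection.ceOp_mem_homForms [GradedAlgebra 𝒜] [SetLike.GradedSMul 𝒜 ℒ]
    (N : LeftConnection X ℳ) (m : ℕ)
    (h : ∀ n, Ψ n ∈ homForms 𝒜 ℒ ℳ n c) (n : ℕ) : N.ceOp m Ψ n ∈ homForms 𝒜 ℒ ℳ n (1 + c) := by
  have hd := fun n => (h n).1
  refine homForms_of_fev (fun l hl => ?_) (fun pre x y post hp => ?_)
    (fun d x l hx hl b a ha => ?_) n
  · rw [fev_ceOp N m hd hl]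
    exact N.ceForm_mem m h hl
  · have hp' : ∀ p ∈ pre ++ y :: x :: post, p ∈ homog ℒ := fun p hm => hp p (by
      simp only [List.mem_append, List.mem_cons] at hm ⊢; tauto)
    rw [fev_ceOp N m hd hp, fev_ceOp N m hd hp', N.ceForm_lsymm m h pre x y post hp]
  · have hax : a • x ∈ ℒ (b + d) := SetLike.GradedSMul.smul_mem ha hx
    rw [fev_ceOp N m hd (List.forall_mem_cons.mpr ⟨hax, hl⟩),
      fev_ceOp N m hd (List.forall_mem_cons.mpr ⟨hx, hl⟩), N.ceForm_cons_smul m h ha hx hl]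

theorem single_mem_homForms {n : ℕ} {Ω : MultilinearMap K (fun _ : Fin n => L) P}
    (hΩ : Ω ∈ homForms 𝒜 ℒ ℳ n c) (k : ℕ) :
    (Pi.single n Ω : Cochain K L P) k ∈ homForms 𝒜 ℒ ℳ k c := by
  rcases eq_or_ne k n with rfl | h
  · rwa [Pi.single_eq_same]
  · rw [Pi.single_eq_of_ne h]
    exact zero_mem _

theorem LeftConnection.ceOp_mem_symForms [GradedAlgebra 𝒜] [SetLike.GradedSMul 𝒜 ℒ]
    (N : LeftConnection X ℳ) (m : ℕ) {Ω : Cochain K L P} (hΩ : Ω ∈ SymForms 𝒜 ℒ ℳ) :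
    N.ceOp m Ω ∈ SymForms 𝒜 ℒ ℳ := by
  refine SymForms.induction 𝒜 ℒ ℳ (p := fun Ω => N.ceOp m Ω ∈ SymForms 𝒜 ℒ ℳ) hΩ
    (fun n e Ω h => ?_) (by simp) fun Ω Ω' h h' => by rw [map_add]; exact add_mem h h'
  have h' := single_mem_homForms h
  -- An `n`-form goes to an `(m + n)`-form: `m` entries enter the connection, or `m + 1` entries are
  -- replaced by one bracket. So the image has a single component and stays in the direct sum.
  have : N.ceOp m (Pi.single n Ω) = Pi.single (m + n) (N.ceOp m (Pi.single n Ω) (m + n)) := by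
    funext k
    rcases eq_or_ne k (m + n) with rfl | hk
    · rw [Pi.single_eq_same]
    · rw [Pi.single_eq_of_ne hk]
      refine ext_lev (𝒱 := ℒ) fun l hn hl => ?_
      have hz : ∀ b : List (ℤ × L), b.length ≠ n → fev (Pi.single n Ω : Cochain K L P) b = 0 := by
        intro b hb
        rw [fev, Pi.single_eq_of_ne hb, lev_zero]
      rw [← fev_eq_lev hn, fev_ceOp N m (fun k => (h' k).1) hl, lev_zero, ceForm, shuf_eq_zero,
        shuf_eq_zero, sub_zero]
      · intro a b _ _ _ hab
        rcases eq_or_ne a.length (m + 1) with ha | ha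
        · rw [hz _ (by rw [List.length_cons]; omega), smul_zero]
        · rw [lev_of_ne _ ha, fev_eq_zero (d := ldeg a + 1) List.mem_cons_self, smul_zero]
      · intro a b _ _ _ hab
        rcases eq_or_ne a.length m with ha | ha
        · rw [hz _ (by omega), map_zero, smul_zero]
        · rw [lev_of_ne _ ha, LinearMap.zero_apply, smul_zero]
  rw [this]
  exact homForms_le 𝒜 ℒ ℳ (N.ceOp_mem_homForms m h' _)

end Preservation

theorem LSymm.ite_length {V M : Type*} [AddCommGroup M] {Hm : Set (ℤ × V)}
    {F : List (ℤ × V) → M} (hF : LSymm Hm F) (k : ℕ) :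
    LSymm Hm fun l => if l.length = k then F l else 0 := by
  intro pre x y post hp
  have : (pre ++ x :: y :: post).length = (pre ++ y :: x :: post).length := by simp
  simp only [this]
  split_ifs
  · exact hF pre x y post hp
  · rw [smul_zero]

/-! ### Commutators of Chevalley–Eilenberg operators with insertions. -/

section FormOperators

variable {K A L P : Type*} [Field K] [Ring A] [Algebra K A]
  [AddCommGroup L] [Module K L] [Module A L]
  [AddCommGroup P] [Module K P] [Module A P] [IsScalarTower K A P]
  {𝒜 : ℤ → Submodule K A} {ℒ : ℤ → Submodule K L} {ℳ : ℤ → Submodule K P}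
  {X : LRInfinityAlgebra 𝒜 ℒ}

variable [Decomposition ℒ] [Decomposition ℳ]

/-- Elements of `SymForms` have finitely many nonzero components, so a condition on each component
is enough for membership in a sum of submodules. -/
theorem SymForms.mem_grading {Ω : SymForms 𝒜 ℒ ℳ} {e : ℤ} :
    Ω ∈ SymForms.grading 𝒜 ℒ ℳ e ↔ ∀ n, (Ω : Cochain K L P) n ∈ homForms 𝒜 ℒ ℳ n e := by
  constructor
  · intro h
    refine Submodule.iSup_induction _
      (motive := fun Ψ : Cochain K L P => ∀ n, Ψ n ∈ homForms 𝒜 ℒ ℳ n e) h (fun n Ψ hΨ => ?_)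
      (fun n => zero_mem _) fun Ψ Ψ' h h' n => add_mem (h n) (h' n)
    obtain ⟨Ω, hΩ, rfl⟩ := hΨ
    exact single_mem_homForms hΩ
  · intro h
    have hfin : ∃ N : ℕ, ∀ n, N ≤ n → (Ω : Cochain K L P) n = 0 := by
      refine SymForms.induction 𝒜 ℒ ℳ (p := fun Ψ => ∃ N : ℕ, ∀ n, N ≤ n → Ψ n = 0) Ω.2
        (fun n e Ω _ => ⟨n + 1, fun k hk => Pi.single_eq_of_ne (by omega) _⟩)
        ⟨0, fun _ _ => rfl⟩ ?_
      rintro Ψ Ψ' ⟨N, hN⟩ ⟨N', hN'⟩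
      refine ⟨max N N', fun n hn => ?_⟩
      rw [Pi.add_apply, hN n (le_trans (le_max_left _ _) hn),
        hN' n (le_trans (le_max_right _ _) hn), add_zero]
    obtain ⟨N, hN⟩ := hfin
    have hsum : (Ω : Cochain K L P) =
        ∑ n ∈ Finset.range N, LinearMap.single K _ n ((Ω : Cochain K L P) n) := by
      funext k
      rw [Finset.sum_apply]
      rcases lt_or_ge k N with hk | hk
      · rw [Finset.sum_eq_single k]
        · rw [LinearMap.single_apply, Pi.single_eq_same]
        · exact fun n _ hn => Pi.single_eq_of_ne hn.symm _
        · exact fun hk' => absurd (Finset.mem_range.mpr hk) hk'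
      · rw [hN k hk, Finset.sum_eq_zero]
        exact fun n hn => Pi.single_eq_of_ne (by have := Finset.mem_range.mp hn; omega) _
    rw [SymForms.grading, Submodule.mem_comap, Submodule.subtype_apply, hsum]
    exact sum_mem fun n _ => Submodule.mem_iSup_of_mem n ⟨_, h n, rfl⟩

theorem SymForms.end_ext_of_grading {S T : Module.End K (SymForms 𝒜 ℒ ℳ)}
    (h : ∀ (c : ℤ), ∀ Ω ∈ SymForms.grading 𝒜 ℒ ℳ c, S Ω = T Ω) : S = T :=
  SymForms.end_ext 𝒜 ℒ ℳ fun _ e _ hΩ => congrArg Subtype.val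
    (h e _ (SymForms.mem_grading.mpr fun k => single_mem_homForms hΩ k))

theorem mul_mem_endDeg {W : Type*} [AddCommGroup W] [Module K W] {𝒲 : ℤ → Submodule K W} {p q : ℤ}
    {S T : Module.End K W} (hS : S ∈ endDeg 𝒲 p) (hT : T ∈ endDeg 𝒲 q) :
    S * T ∈ endDeg 𝒲 (p + q) := fun c w hw => by
  rw [add_assoc]
  exact hS _ _ (hT c w hw)

theorem gradedComm_mem_endDeg {W : Type*} [AddCommGroup W] [Module K W] {𝒲 : ℤ → Submodule K W}
    {p q : ℤ} {S T : Module.End K W} (hS : S ∈ endDeg 𝒲 p) (hT : T ∈ endDeg 𝒲 q) :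
    S * T - (p * q).negOnePow • (T * S) ∈ endDeg 𝒲 (p + q) := by
  refine sub_mem (mul_mem_endDeg hS hT) ?_
  rw [Units.smul_def, add_comm]
  exact zsmul_mem (mul_mem_endDeg hT hS) _

theorem ncl_mem_endDeg {W : Type*} [AddCommGroup W] [Module K W] {𝒲 : ℤ → Submodule K W}
    {e : ℤ} {T : Module.End K W} (hT : T ∈ endDeg 𝒲 e) {l : List (ℤ × Module.End K W)}
    (hl : ∀ x ∈ l, x.2 ∈ endDeg 𝒲 x.1) : ncl e T l ∈ endDeg 𝒲 (e + ldeg l) := by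
  induction l generalizing e T with
  | nil => simpa [ncl] using hT
  | cons x l ih =>
    rw [List.forall_mem_cons] at hl
    rw [ncl_cons, ldeg_cons, ← add_assoc]
    exact ih (gradedComm_mem_endDeg hT hl.1) hl.2

theorem LeftConnection.ce_mem_endDeg [GradedAlgebra 𝒜] [SetLike.GradedSMul 𝒜 ℒ]
    (N : LeftConnection X ℳ) (hD : ∀ m, ∀ Ω ∈ SymForms 𝒜 ℒ ℳ, N.ceOp m Ω ∈ SymForms 𝒜 ℒ ℳ)
    (m : ℕ) : N.ce hD m ∈ endDeg (SymForms.grading 𝒜 ℒ ℳ) 1 := fun _ _ hΩ =>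
  SymForms.mem_grading.mpr (N.ceOp_mem_homForms m (SymForms.mem_grading.mp hΩ))

theorem scalarOp_mem_endDeg [GradedAlgebra 𝒜] [SetLike.GradedSMul 𝒜 ℳ] (hA : GradedComm 𝒜)
    {b : ℤ} {a : A} (ha : a ∈ 𝒜 b) :
    scalarOp 𝒜 ℒ ℳ hA a ∈ endDeg (SymForms.grading 𝒜 ℒ ℳ) b := fun _ _ hΩ =>
  SymForms.mem_grading.mpr fun n =>
    smul_mem_homForms 𝒜 ℒ ℳ hA (SymForms.mem_grading.mp hΩ n) ha

theorem vectorOp_mem_endDeg {b : ℤ} {ξ : L} (hξ : ξ ∈ ℒ b) :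
    vectorOp 𝒜 ℒ ℳ ξ ∈ endDeg (SymForms.grading 𝒜 ℒ ℳ) b := fun c Ω hΩ =>
  SymForms.mem_grading.mpr fun n => by
    have h := SymForms.mem_grading.mp hΩ
    have : contract ℒ ℳ ξ (Ω : Cochain K L P) n =
        (b * c).negOnePow • ((Ω : Cochain K L P) (n + 1)).curryLeft ξ := by
      rw [contract, LinearMap.comp_apply, LinearEquiv.coe_coe, decomposeLinearEquiv_apply,
        decompose_of_mem ℒ hξ, ← lof_eq_of K, toModule_lof]
      change (twist ℒ ℳ b (Ω : Cochain K L P) (n + 1)).curryLeft ξ = _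
      rw [twist_component (h _).1]
      rfl
    rw [vectorOp_coe, this, Units.smul_def]
    exact zsmul_mem (curryLeft_mem_homForms 𝒜 ℒ ℳ (h _) hξ) _

theorem IsSymAlg.map_mem_endDeg {S : Type*} [Ring S] [Algebra K S] {sc : A →ₐ[K] S}
    {vc : L →ₗ[K] S} {𝒮 : ℤ → Submodule K S} (hS : IsSymAlg 𝒜 ℒ sc vc 𝒮) [GradedAlgebra 𝒜]
    [SetLike.GradedSMul 𝒜 ℳ] (hA : GradedComm 𝒜)
    {ρ : S →ₐ[K] Module.End K (SymForms 𝒜 ℒ ℳ)} (hsc : ∀ a, ρ (sc a) = scalarOp 𝒜 ℒ ℳ hA a)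
    (hvc : ∀ ξ, ρ (vc ξ) = vectorOp 𝒜 ℒ ℳ ξ) {e : ℤ} {u : S} (hu : u ∈ 𝒮 e) :
    ρ u ∈ endDeg (SymForms.grading 𝒜 ℒ ℳ) e := by
  refine hS.grading_induction (p := fun e u => ρ u ∈ endDeg (SymForms.grading 𝒜 ℒ ℳ) e)
    (fun b a ha => ?_) (fun b ξ hξ => ?_) (fun b x hx c y hy h h' => ?_) (fun b => ?_)
    (fun b x hx y hy h h' => ?_) hu
  · rw [hsc]; exact scalarOp_mem_endDeg hA ha
  · rw [hvc]; exact vectorOp_mem_endDeg hξ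
  · rw [map_mul]; exact mul_mem_endDeg h h'
  · rw [map_zero]; exact zero_mem _
  · rw [map_add]; exact add_mem h h'

theorem ceForm_negOnePow_smul (e c k : ℤ) (f : List (ℤ × L) → Module.End K P)
    (g : List (ℤ × L) → L) (φ : List (ℤ × L) → P) (l : List (ℤ × L)) :
    ceForm e c f g (fun b => k.negOnePow • φ b) l = k.negOnePow • ceForm e c f g φ l := by
  rw [ceForm, ceForm, smul_sub, ← shuf_negOnePow_smul, ← shuf_negOnePow_smul]
  refine congrArg₂ _ ?_ ?_ <;> refine shuf_congr fun a b _ _ _ _ => ?_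
  · rw [Units.smul_def k.negOnePow, map_zsmul, ← Units.smul_def, smul_comm]
  · rw [smul_comm]

theorem fev_coe_sub_negOnePow_smul (k : ℤ) (Ω Ω' : SymForms 𝒜 ℒ ℳ) (l : List (ℤ × L)) :
    fev ((Ω - k.negOnePow • Ω' : SymForms 𝒜 ℒ ℳ) : Cochain K L P) l =
      fev (Ω : Cochain K L P) l - k.negOnePow • fev (Ω' : Cochain K L P) l := by
  have : ((Ω - k.negOnePow • Ω' : SymForms 𝒜 ℒ ℳ) : Cochain K L P) l.length =
      (Ω : Cochain K L P) l.length + (-k.negOnePow) • (Ω' : Cochain K L P) l.length := by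
    rw [Units.neg_smul, ← sub_eq_add_neg]; rfl
  rw [fev, this, lev_add, lev_smul, Units.neg_smul, ← sub_eq_add_neg]
  rfl

/-- The operator `T` of degree `e` on forms is given by the Chevalley–Eilenberg formula. -/
structure IsCE (T : Module.End K (SymForms 𝒜 ℒ ℳ)) (e : ℤ) (f : List (ℤ × L) → Module.End K P)
    (g : List (ℤ × L) → L) : Prop where
  degree : T ∈ endDeg (SymForms.grading 𝒜 ℒ ℳ) e
  mem : ∀ a, (∀ p ∈ a, p ∈ homog ℒ) → g a ∈ ℒ (ldeg a + e)
  apply : ∀ (c : ℤ), ∀ Ω ∈ SymForms.grading 𝒜 ℒ ℳ c, ∀ l, (∀ p ∈ l, p ∈ homog ℒ) →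
    fev (T Ω : Cochain K L P) l = ceForm e c f g (fev (Ω : Cochain K L P)) l

theorem LeftConnection.isCE_ce [GradedAlgebra 𝒜] [SetLike.GradedSMul 𝒜 ℒ]
    (N : LeftConnection X ℳ) (hD : ∀ m, ∀ Ω ∈ SymForms 𝒜 ℒ ℳ, N.ceOp m Ω ∈ SymForms 𝒜 ℒ ℳ)
    (m : ℕ) : IsCE (N.ce hD m) 1 (lev (N.conn m)) (lev (X.bracket (m + 1))) where
  degree := N.ce_mem_endDeg hD m
  mem _ ha := X.lev_bracket_mem (m + 1) ha
  apply _ _ hΩ _ hl := fev_ceOp N m (fun n => (SymForms.mem_grading.mp hΩ n).1) hl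

namespace IsCE

variable {T : Module.End K (SymForms 𝒜 ℒ ℳ)} {e : ℤ} {f f' : List (ℤ × L) → Module.End K P}
  {g g' : List (ℤ × L) → L}

theorem congr (h : IsCE T e f g) (hf : ∀ a, (∀ p ∈ a, p ∈ homog ℒ) → f a = f' a)
    (hg : ∀ a, (∀ p ∈ a, p ∈ homog ℒ) → g a = g' a) : IsCE T e f' g' :=
  ⟨h.degree, fun a ha => hg a ha ▸ h.mem a ha, fun c Ω hΩ l hl => (h.apply c Ω hΩ l hl).trans
    (ceForm_congr hl hf hg h.mem fun _ _ => rfl)⟩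

/-- In the commutator the terms with `ξ` as an argument of the form cancel, by `ceForm_cons`. The
operator that remains has the same shape, with `ξ` as an entry of `f` and `g`; this makes iteration
possible. -/
theorem vectorOp (h : IsCE T e f g) {ξ : ℤ × L} (hξ : ξ ∈ homog ℒ) :
    IsCE (T * vectorOp 𝒜 ℒ ℳ ξ.2 - (e * ξ.1).negOnePow • (vectorOp 𝒜 ℒ ℳ ξ.2 * T)) (e + ξ.1)
      (fun a => -f (ξ :: a)) (fun a => -g (ξ :: a)) where
  degree := gradedComm_mem_endDeg h.degree (vectorOp_mem_endDeg hξ)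
  mem a ha := neg_mem (by
    have := h.mem (ξ :: a) (List.forall_mem_cons.mpr ⟨hξ, ha⟩)
    rwa [ldeg_cons, show ξ.1 + ldeg a + e = ldeg a + (e + ξ.1) by ring] at this)
  apply c Ω hΩ l hl := by
    have hd := fun n => (SymForms.mem_grading.mp hΩ n).1
    have hTd := fun n => (SymForms.mem_grading.mp (h.degree c Ω hΩ) n).1
    have h1 : fev (T (SHLR.vectorOp 𝒜 ℒ ℳ ξ.2 Ω) : Cochain K L P) l =
        (ξ.1 * c).negOnePow •
          ceForm e (c + ξ.1) f g (fun b => fev (Ω : Cochain K L P) (ξ :: b)) l := by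
      have hi : ∀ b, fev (SHLR.vectorOp 𝒜 ℒ ℳ ξ.2 Ω : Cochain K L P) b =
          (ξ.1 * c).negOnePow • fev (Ω : Cochain K L P) (ξ :: b) := fun b => fev_contract hξ hd b
      rw [h.apply (c + ξ.1) _ (by rw [add_comm]; exact vectorOp_mem_endDeg hξ c Ω hΩ) l hl]
      rw [funext hi, ceForm_negOnePow_smul]
    have h2 : fev (SHLR.vectorOp 𝒜 ℒ ℳ ξ.2 (T Ω) : Cochain K L P) l =
        (ξ.1 * (e + c)).negOnePow • fev (T Ω : Cochain K L P) (ξ :: l) := fev_contract hξ hTd l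
    have h4 := fev_lsymm_of_homForms (SymForms.mem_grading.mp hΩ)
    rw [ceForm_neg, LinearMap.sub_apply, Module.End.mul_apply]
    refine (fev_coe_sub_negOnePow_smul _ _ _ _).trans ?_
    rw [h1, Module.End.mul_apply, h2, h.apply c Ω hΩ _ (List.forall_mem_cons.mpr ⟨hξ, hl⟩),
      ceForm_cons f h4 h.mem hξ hl]
    simp only [smul_add, negOnePow_smul_smul]
    have key : ∀ {p q r s : P}, p = q → r = s → p - (q + r) = -s := by
      rintro p _ r _ rfl rfl
      abel
    refine key (negOnePow_smul_eq ?_ _) ((negOnePow_smul_eq (b := 0) ?_ _).trans ?_)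
    · simp only [parity_simps]; grind
    · simp only [parity_simps]; grind
    · rw [Int.negOnePow_zero, one_smul]

/-- The terms with `g` commute with multiplication by `a`, and so does the `A`-linear part of `f`.
What survives is the symbol `s` of `f`, acting by multiplication. -/
theorem scalarOp [GradedAlgebra 𝒜] [SetLike.GradedSMul 𝒜 ℳ] (hA : GradedComm 𝒜)
    (h : IsCE T e f g) {b : ℤ} {a : A} (ha : a ∈ 𝒜 b) {s : List (ℤ × L) → A}
    (hf : ∀ α, (∀ p ∈ α, p ∈ homog ℒ) → ∀ p,
      f α (a • p) = ((e + ldeg α) * b).negOnePow • a • f α p + s α • p) :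
    IsCE (T * scalarOp 𝒜 ℒ ℳ hA a - (e * b).negOnePow • (scalarOp 𝒜 ℒ ℳ hA a * T)) (e + b)
      (fun α => (b * ldeg α).negOnePow • Algebra.lsmul K K P (s α)) (fun _ => 0) where
  degree := gradedComm_mem_endDeg h.degree (scalarOp_mem_endDeg hA ha)
  mem _ _ := zero_mem _
  apply c Ω hΩ l hl := by
    have h1 : ∀ (Ψ : SymForms 𝒜 ℒ ℳ) (l : List (ℤ × L)),
        fev (SHLR.scalarOp 𝒜 ℒ ℳ hA a Ψ : Cochain K L P) l = a • fev (Ψ : Cochain K L P) l :=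
      fun Ψ l => lev_smul a _ l
    rw [LinearMap.sub_apply, Module.End.mul_apply]
    refine (fev_coe_sub_negOnePow_smul _ _ _ _).trans ?_
    rw [Module.End.mul_apply, h1, h.apply c Ω hΩ l hl,
      h.apply (b + c) _ (scalarOp_mem_endDeg hA ha c Ω hΩ) l hl]
    have hmap : ∀ y : P, (e * b).negOnePow • a • y =
        (DistribSMul.toAddMonoidHom P (e * b).negOnePow).comp
          (DistribSMul.toAddMonoidHom P a) y := fun _ => rfl
    rw [hmap]
    simp only [ceForm]
    rw [← shuf_sub, ← shuf_sub, ← shuf_sub, map_shuf, ← shuf_sub]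
    refine shuf_congr fun α β hα hβ _ _ => ?_
    rw [h1, h1, hf α fun p hp => hl p (hα hp)]
    rw [fev_eq_zero (d := ldeg α + (e + b)) List.mem_cons_self]
    simp only [AddMonoidHom.comp_apply, DistribSMul.toAddMonoidHom_apply, smul_zero, sub_zero,
      smul_add, smul_sub, negOnePow_smul_smul, smul_comm a (_ : ℤˣ)]
    have e1 : ((b + c) * ldeg α + (e + ldeg α) * b).negOnePow • a • f α (fev (Ω : Cochain K L P) β) =
        (e * b + c * ldeg α).negOnePow • a • f α (fev (Ω : Cochain K L P) β) := by
      apply negOnePow_smul_eq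
      simp only [parity_simps]; grind
    have e2 : (e * (b + c)).negOnePow • a • fev (Ω : Cochain K L P) ((ldeg α + e, g α) :: β) =
        (e * b + e * c).negOnePow • a • fev (Ω : Cochain K L P) ((ldeg α + e, g α) :: β) := by
      apply negOnePow_smul_eq
      simp only [parity_simps]; grind
    have e3 : (c * ldeg α).negOnePow • ((b * ldeg α).negOnePow • Algebra.lsmul K K P (s α))
        (fev (Ω : Cochain K L P) β) =
        ((b + c) * ldeg α).negOnePow • s α • fev (Ω : Cochain K L P) β := by
      rw [LinearMap.smul_apply, negOnePow_smul_smul, Algebra.lsmul_coe]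
      apply negOnePow_smul_eq
      simp only [parity_simps]; grind
    rw [e1, e2, e3]
    abel

theorem ncl_vectorOp (h : IsCE T e f g) {v : List (ℤ × L)} (hv : ∀ p ∈ v, p ∈ homog ℒ) :
    IsCE (ncl e T (v.map fun x => (x.1, SHLR.vectorOp 𝒜 ℒ ℳ x.2))) (e + ldeg v)
      (fun a => (v.length : ℤ).negOnePow • f (v ++ a))
      (fun a => (v.length : ℤ).negOnePow • g (v ++ a)) := by
  induction v generalizing e T f g with
  | nil => simpa [ncl] using h
  | cons x v ih =>
    rw [List.forall_mem_cons] at hv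
    rw [List.map_cons, ncl_cons, ldeg_cons, ← add_assoc]
    refine (ih (h.vectorOp hv.1) hv.2).congr (fun a _ => ?_) fun a _ => ?_ <;>
      rw [List.length_cons, Nat.cast_succ, Int.negOnePow_succ, Units.neg_smul, smul_neg,
        List.cons_append]

theorem eq_zero (h : IsCE T e (fun _ => 0) (fun _ => 0)) : T = 0 := by
  refine SymForms.end_ext_of_grading fun c Ω hΩ => Subtype.ext (ext_fev (ℒ := ℒ) fun l hl => ?_)
  rw [h.apply c Ω hΩ l hl, ceForm, shuf_eq_zero, shuf_eq_zero, sub_zero]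
  · exact (lev_zero l).symm
  · intro a b _ _ _ _
    rw [fev_eq_zero (d := ldeg a + e) List.mem_cons_self, smul_zero]
  · intro a b _ _ _ _
    rw [LinearMap.zero_apply, smul_zero]

/-- If all entries of `f` have been used up, only the splitting with empty first block contributes.
-/
theorem eq_scalarOp [GradedAlgebra 𝒜] [SetLike.GradedSMul 𝒜 ℳ] (hA : GradedComm 𝒜)
    (h : IsCE T e f (fun _ => 0)) (hf : ∀ x a, f (x :: a) = 0) {a : A}
    (ha : f [] = Algebra.lsmul K K P a) : T = SHLR.scalarOp 𝒜 ℒ ℳ hA a := by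
  refine SymForms.end_ext_of_grading fun c Ω hΩ => Subtype.ext (ext_fev (ℒ := ℒ) fun l hl => ?_)
  rw [h.apply c Ω hΩ l hl, ceForm, shuf_of_left_nil, shuf_eq_zero, sub_zero, ha, ldeg_nil, mul_zero,
    Int.negOnePow_zero, one_smul]
  · exact (lev_smul a _ l).symm
  · intro a b _ _ _ _
    rw [fev_eq_zero (d := ldeg a + e) List.mem_cons_self, smul_zero]
  · intro a b _ hne
    obtain ⟨x, a, rfl⟩ := List.exists_cons_of_ne_nil hne
    rw [hf, LinearMap.zero_apply, smul_zero]

/-- With the entries of `g` used up, the form merely receives `g []` as first argument; the sign is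
that of the bracket sum in `ceForm`. -/
theorem eq_vectorOp (h : IsCE T e (fun _ => 0) g) (hg : ∀ x a, g (x :: a) = 0) :
    T = -SHLR.vectorOp 𝒜 ℒ ℳ (g []) := by
  have hm : g [] ∈ ℒ e := by simpa using h.mem [] (by simp)
  refine SymForms.end_ext_of_grading fun c Ω hΩ => Subtype.ext (ext_fev (ℒ := ℒ) fun l hl => ?_)
  rw [h.apply c Ω hΩ l hl, ceForm, shuf_eq_zero, shuf_of_left_nil, zero_sub, ldeg_nil, zero_add,
    ← fev_contract hm (fun n => (SymForms.mem_grading.mp hΩ n).1)]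
  · have := lev_smul (-1 : K) (contract ℒ ℳ (g []) (Ω : Cochain K L P) l.length) l
    rw [neg_one_smul, neg_one_smul] at this
    exact this.symm
  · intro a b _ hne
    obtain ⟨x, a, rfl⟩ := List.exists_cons_of_ne_nil hne
    rw [hg, fev_eq_zero (d := ldeg (x :: a) + e) List.mem_cons_self, smul_zero]
  · intro a b _ _ _ _
    rw [LinearMap.zero_apply, smul_zero]

end IsCE

section Values

variable {S : Type*} [Ring S] [Algebra K S] {sc : A →ₐ[K] S} {vc : L →ₗ[K] S}
  {𝒮 : ℤ → Submodule K S}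

/-- The values of the nested commutators of the operators `D_k` with insertions. -/
theorem LeftConnection.ncl_ce_eq [GradedAlgebra 𝒜] [SetLike.GradedSMul 𝒜 ℒ]
    [SetLike.GradedSMul 𝒜 ℳ] (hA : GradedComm 𝒜) (hS : IsSymAlg 𝒜 ℒ sc vc 𝒮)
    {ρ : S →ₐ[K] Module.End K (SymForms 𝒜 ℒ ℳ)} (hsc : ∀ a, ρ (sc a) = scalarOp 𝒜 ℒ ℳ hA a)
    (hvc : ∀ ξ, ρ (vc ξ) = vectorOp 𝒜 ℒ ℳ ξ) {F : List (ℤ × S) → S}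
    (hF : IsExtension X sc vc 𝒮 F) (N : LeftConnection X ℳ)
    (hD : ∀ m, ∀ Ω ∈ SymForms 𝒜 ℒ ℳ, N.ceOp m Ω ∈ SymForms 𝒜 ℒ ℳ) {m : ℕ} {l : List (ℤ × S)}
    (hm : l.length = m + 1) (hl : ∀ p ∈ l, p ∈ homog 𝒮) :
    ncl 1 (N.ce hD m) (l.map fun x => (x.1, ρ x.2)) = (m : ℤ).negOnePow • ρ (F l) := by
  have := hS.gradedMonoid
  have hρF : IsMultiDer 𝒮 ρ 1 fun l => ρ (F l) :=
    ⟨hF.der.symm.map ρ, fun d x y l hx hy hl => by rw [hF.der.add d x y l hx hy hl, map_add],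
      fun b x c y l hx hy hl => by
        rw [hF.der.leib b x c y l hx hy hl]
        simp only [map_add, Units.smul_def, map_zsmul, map_mul, AlgHom.id_apply]⟩
  have h1 := isMultiDer_ncl (ρ := ρ) (fun hx hy => hS.mul_comm_of_mem hA hx hy) 1 (N.ce hD m)
  have h2 := hρF.negOnePow_smul (m : ℤ)
  refine IsMultiDer.eq_of_gens hS h1 h2 hl fun g hgl hg => ?_
  rw [hm] at hgl
  have hv : ∀ v : List (ℤ × L), (ofGens sc vc (vecs v)).map (fun x => (x.1, ρ x.2)) =
      v.map fun x => (x.1, vectorOp 𝒜 ℒ ℳ x.2) := by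
    intro v
    simp only [ofGens, vecs, List.map_map]
    refine List.map_congr_left fun x _ => ?_
    exact congrArg (Prod.mk x.1) (hvc x.2)
  -- The identity holds for lists of length `m + 1`, while `gens_ext` compares functions on lists of
  -- all lengths; both sides are cut off outside this length, which keeps them symmetric.
  have hsymm : ∀ {F : List (ℤ × S) → Module.End K (SymForms 𝒜 ℒ ℳ)}, LSymm (homog 𝒮) F →
      LSymm (homGen 𝒜 ℒ) fun g => if g.length = m + 1 then F (ofGens sc vc g) else 0 :=
    fun hF => (hF.comap (ofGen sc vc) fun x hx => ofGen_mem hS hx).ite_length (m + 1)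
  have key := gens_ext (hsymm h1.symm) (hsymm h2.symm) ?_ ?_ ?_ hg
  · rwa [if_pos hgl, if_pos hgl] at key
  · intro v hv'
    refine ite_congr rfl (fun hlen => ?_) fun _ => rfl
    have hlen' : v.length = m + 1 := by rwa [vecs, List.length_map] at hlen
    rw [hv, hF.gens _ (vecs_mem.mpr hv'), genBracket_vecs, hvc]
    -- After `m + 1` vectors the connection, which has only `m` entries, has dropped out, and the
    -- bracket is exactly filled.
    have h3 := ((N.isCE_ce hD m).ncl_vectorOp hv').congr (f' := fun _ => 0)
      (g' := fun a => (v.length : ℤ).negOnePow • lev (X.bracket (m + 1)) (v ++ a))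
      (fun a _ => by rw [lev_of_ne _ (by rw [List.length_append]; omega), smul_zero])
      fun _ _ => rfl
    rw [h3.eq_vectorOp fun x a => by
      rw [lev_of_ne _ (by rw [List.length_append, List.length_cons]; omega), smul_zero],
      List.append_nil, ← fev_eq_lev hlen', hlen', Nat.cast_succ, Int.negOnePow_succ, Units.neg_smul,
      map_neg]
    refine (neg_neg (G := Module.End K (SymForms 𝒜 ℒ ℳ)) _).trans ?_
    rw [Units.smul_def, map_zsmul, Units.smul_def]
  · intro v b a hv' ha
    refine ite_congr rfl (fun hlen => ?_) fun _ => rfl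
    have hlen' : v.length = m := by
      rwa [vecs, List.length_cons, List.length_map, add_left_inj] at hlen
    rw [hF.gens _ (List.forall_mem_cons.mpr ⟨ha, vecs_mem.mpr hv'⟩), genBracket_scalar,
      vecPart_vecs, ldeg_vecs]
    change ncl 1 (N.ce hD m) ((b, ρ (sc a)) :: (ofGens sc vc (vecs v)).map _) = _
    rw [hv, ncl_cons, hsc]
    -- The scalar comes first and leaves the anchor as symbol; the `m` vectors then fill its
    -- entries.
    have h3 := ((N.isCE_ce hD m).scalarOp hA ha fun α hα => N.lev_conn_smul m ha hα)
    have h4 := (h3.ncl_vectorOp hv').congr (g' := fun _ => 0) (fun _ _ => rfl)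
      fun _ _ => smul_zero _
    rw [h4.eq_scalarOp hA (a := (v.length : ℤ).negOnePow • (b * ldeg v).negOnePow •
      lev (X.anchor m) v a) (fun x α => ?_) ?_, ← fev_eq_lev hlen', hlen']
    · simp only [Units.smul_def, map_zsmul, hsc]
    · simp only [List.append_nil, Units.smul_def, map_zsmul]
    · rw [lev_of_ne _ (by rw [List.length_append, List.length_cons]; omega), LinearMap.zero_apply,
        map_zero, smul_zero, smul_zero]
  · intro g b a b' a' hg ha ha'
    refine ite_congr rfl (fun _ => ?_) fun _ => rfl
    rw [hF.gens _ (List.forall_mem_cons.mpr ⟨ha, List.forall_mem_cons.mpr ⟨ha', hg⟩⟩),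
      genBracket_scalar_scalar, map_zero, smul_zero]
    change ncl 1 (N.ce hD m) ((b, ρ (sc a)) :: (b', ρ (sc a')) :: _) = 0
    have h3 := (N.isCE_ce hD m).scalarOp hA ha fun α hα => N.lev_conn_smul m ha hα
    -- The first scalar leaves an operator of order zero, whose symbol is `0`, so the second scalar
    -- kills it.
    have h4 := (h3.scalarOp hA ha' (s := fun _ => 0) fun α hα p => ?_).congr
      (f' := fun _ => 0) (g' := fun _ => 0) (fun α _ => by rw [map_zero, smul_zero]) fun _ _ => rfl
    · rw [ncl_cons, ncl_cons, hsc, hsc, h4.eq_zero, ncl_zero]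
    · have hσ : lev (X.anchor m) α a ∈ 𝒜 (1 + ldeg α + b) :=
        hasDegree_iff.mp (X.anchor_degree m) α hα b a ha
      rw [zero_smul, add_zero, LinearMap.smul_apply, LinearMap.smul_apply]
      change (b * ldeg α).negOnePow • lev (X.anchor m) α a • a' • p =
        ((1 + b + ldeg α) * b').negOnePow • a' • (b * ldeg α).negOnePow • lev (X.anchor m) α a • p
      rw [smul_smul (lev (X.anchor m) α a), hA _ _ _ ha' _ hσ, Units.smul_def (b' * _).negOnePow, smul_assoc,
        ← Units.smul_def, mul_smul, smul_comm a' (_ : ℤˣ), negOnePow_smul_smul, negOnePow_smul_smul]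
      apply negOnePow_smul_eq
      simp only [parity_simps]; grind

end Values

end FormOperators

/-! ### Multilinearity of nested commutators. -/

section NestedMultilinear

variable {K W : Type*} [Field K] [AddCommGroup W] [Module K W]

theorem ncl_smul (r : K) (e : ℤ) (T : Module.End K W) (l : List (ℤ × Module.End K W)) :
    ncl e (r • T) l = r • ncl e T l := by
  induction l generalizing e T with
  | nil => rfl
  | cons x l ih =>
    rw [ncl_cons, ncl_cons, ← ih, smul_sub, smul_mul_assoc, smul_comm r, mul_smul_comm]

theorem nestedComm_add_left {n : ℕ} (e : ℤ) (S T : Module.End K W) (d : Fin n → ℤ)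
    (U : Fin n → Module.End K W) :
    nestedComm e (S + T) d U = nestedComm e S d U + nestedComm e T d U := by
  rw [nestedComm_eq_ncl, nestedComm_eq_ncl, nestedComm_eq_ncl, ncl_add]

theorem nestedComm_smul_left {n : ℕ} (r : K) (e : ℤ) (T : Module.End K W) (d : Fin n → ℤ)
    (U : Fin n → Module.End K W) : nestedComm e (r • T) d U = r • nestedComm e T d U := by
  rw [nestedComm_eq_ncl, nestedComm_eq_ncl, ncl_smul]

theorem update_succ_tail {α : Type*} {n : ℕ} (U : Fin (n + 1) → α) (i : Fin n) (x : α) :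
    (fun j : Fin n => Function.update U i.succ x j.succ) =
      Function.update (fun j : Fin n => U j.succ) i x := by
  funext j
  simp only [Function.update_apply, Fin.succ_inj]

theorem nestedComm_update_add {n : ℕ} (e : ℤ) (T : Module.End K W) (d : Fin n → ℤ)
    (U : Fin n → Module.End K W) (i : Fin n) (x y : Module.End K W) :
    nestedComm e T d (Function.update U i (x + y)) =
      nestedComm e T d (Function.update U i x) + nestedComm e T d (Function.update U i y) := by
  induction n generalizing e T with
  | zero => exact i.elim0
  | succ n ih =>
    refine Fin.cases ?_ (fun i => ?_) i
    · simp only [nestedComm, Function.update_self, Function.update_of_ne (Fin.succ_ne_zero _)]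
      rw [← nestedComm_add_left]
      congr 1
      simp only [gradedComm, mul_add, add_mul, smul_add]
      abel
    · simp only [nestedComm, update_succ_tail, Function.update_of_ne (Fin.succ_ne_zero i).symm]
      exact ih _ _ _ _ _

theorem nestedComm_update_smul {n : ℕ} (e : ℤ) (T : Module.End K W) (d : Fin n → ℤ)
    (U : Fin n → Module.End K W) (i : Fin n) (r : K) (x : Module.End K W) :
    nestedComm e T d (Function.update U i (r • x)) =
      r • nestedComm e T d (Function.update U i x) := by
  induction n generalizing e T with
  | zero => exact i.elim0
  | succ n ih =>
    refine Fin.cases ?_ (fun i => ?_) i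
    · simp only [nestedComm, Function.update_self, Function.update_of_ne (Fin.succ_ne_zero _)]
      rw [← nestedComm_smul_left]
      congr 1
      simp only [gradedComm, mul_smul_comm, smul_mul_assoc, smul_sub]
      rw [smul_comm r]
    · simp only [nestedComm, update_succ_tail, Function.update_of_ne (Fin.succ_ne_zero i).symm]
      exact ih _ _ _ _ _

/-- Nested commutators as multilinear maps. -/
def nestedMap {n : ℕ} (e : ℤ) (T : Module.End K W) (d : Fin n → ℤ) :
    MultilinearMap K (fun _ : Fin n => Module.End K W) (Module.End K W) where
  toFun U := nestedComm e T d U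
  map_update_add' := fun {inst} U i x y => by
    rw [Subsingleton.elim inst (instDecidableEqFin n)]
    exact nestedComm_update_add e T d U i x y
  map_update_smul' := fun {inst} U i r x => by
    rw [Subsingleton.elim inst (instDecidableEqFin n)]
    exact nestedComm_update_smul e T d U i r x

end NestedMultilinear

/-! ### The formal consequences of generating the bracket by nested commutators. -/

section LieDerivatives

variable {K S W : Type*} [Field K] [Ring S] [Algebra K S] [AddCommGroup W] [Module K W]
  {𝒮 : ℤ → Submodule K S} {𝒲 : ℤ → Submodule K W}

/-- The nested commutators of the `k`-th operator with the operators `ρ u`, for `u` in a list. -/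
def nestedIns (ρ : S →ₐ[K] Module.End K W) (D : ℕ → Module.End K W) (k : ℕ) (l : List (ℤ × S)) :
    Module.End K W :=
  ncl 1 (D k) (l.map fun x => (x.1, ρ x.2))

/-- The operators `D` of degree `1` on the representation `ρ` of `S` generate the bracket of `Λ`. -/
structure GeneratesBracket (𝒲 : ℤ → Submodule K W) (Λ : PInfinityAlgebra 𝒮)
    (ρ : S →ₐ[K] Module.End K W) (D : ℕ → Module.End K W) : Prop where
  comm : ∀ {b c : ℤ} {x y : S}, x ∈ 𝒮 b → y ∈ 𝒮 c → x * y = (b * c).negOnePow • (y * x)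
  map_mem : ∀ {e : ℤ} {u : S}, u ∈ 𝒮 e → ρ u ∈ endDeg 𝒲 e
  degree : ∀ n, D n ∈ endDeg 𝒲 1
  nested : ∀ {m : ℕ} {l : List (ℤ × S)}, l.length = m + 1 → (∀ p ∈ l, p ∈ homog 𝒮) →
    nestedIns ρ D m l = (m : ℤ).negOnePow • ρ (fev Λ.bracket l)

namespace GeneratesBracket

variable {Λ : PInfinityAlgebra 𝒮} {ρ : S →ₐ[K] Module.End K W} {D : ℕ → Module.End K W}

theorem isMultiDer [SetLike.GradedMonoid 𝒮] (h : GeneratesBracket 𝒲 Λ ρ D) (k : ℕ) :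
    IsMultiDer 𝒮 ρ 1 (nestedIns ρ D k) := isMultiDer_ncl h.comm 1 (D k)

theorem nestedIns_append (l l' : List (ℤ × S)) (k : ℕ) : nestedIns ρ D k (l ++ l') =
    ncl (1 + ldeg l) (nestedIns ρ D k l) (l'.map fun x => (x.1, ρ x.2)) := by
  rw [nestedIns, List.map_append, ncl_append, ldeg_map]
  rfl

theorem gradedCommute (h : GeneratesBracket 𝒲 Λ ρ D) {b c : ℤ} {x y : S} (hx : x ∈ 𝒮 b)
    (hy : y ∈ 𝒮 c) : ρ x * ρ y = (b * c).negOnePow • (ρ y * ρ x) := by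
  rw [← map_mul, h.comm hx hy, Units.smul_def, map_zsmul, map_mul, Units.smul_def]

/-- After `k + 1` commutators `D k` has become the action of a tensor, which commutes with the next
one. -/
theorem nested_eq_zero (h : GeneratesBracket 𝒲 Λ ρ D) {k : ℕ} {l : List (ℤ × S)}
    (hk : k + 1 < l.length) (hl : ∀ p ∈ l, p ∈ homog 𝒮) : nestedIns ρ D k l = 0 := by
  rw [← List.take_append_drop (k + 1) l, nestedIns_append,
    h.nested (by rw [List.length_take]; omega) fun p hp => hl p (List.mem_of_mem_take hp),
    ncl_negOnePow_smul]
  have hm : fev Λ.bracket (l.take (k + 1)) ∈ 𝒮 (1 + ldeg (l.take (k + 1))) :=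
    Λ.fev_mem _ fun p hp => hl p (List.mem_of_mem_take hp)
  obtain ⟨x, l', hx⟩ := List.exists_cons_of_ne_nil (l := l.drop (k + 1))
    (by rw [← List.length_pos_iff, List.length_drop]; omega)
  have hx' : x.2 ∈ 𝒮 x.1 := hl x (List.mem_of_mem_drop (hx ▸ List.mem_cons_self))
  rw [hx, List.map_cons, ncl_eq_zero, smul_zero]
  exact h.gradedCommute hm hx'

theorem fev_bracket_nil (Λ : PInfinityAlgebra 𝒮) : fev Λ.bracket [] = 0 := by
  rw [fev, List.length_nil, Λ.bracket_zero, lev_zero]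

/-- The nested commutators of `∑_{p + q = n} D_p D_q`, on a given splitting. -/
theorem sum_nestedIns_mul (h : GeneratesBracket 𝒲 Λ ρ D) {a b : List (ℤ × S)} {n : ℕ}
    (hn : a.length + b.length = n) (ha : ∀ p ∈ a, p ∈ homog 𝒮) (hb : ∀ p ∈ b, p ∈ homog 𝒮) :
    ∑ p ∈ Finset.HasAntidiagonal.antidiagonal n, nestedIns ρ D p.1 a * nestedIns ρ D p.2 b =
      nestedIns ρ D a.length a * nestedIns ρ D b.length b -
      ((a.length : ℤ).negOnePow • (ρ (fev Λ.bracket a) * nestedIns ρ D (b.length + 1) b) +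
      (b.length : ℤ).negOnePow • (nestedIns ρ D (a.length + 1) a * ρ (fev Λ.bracket b))) := by
  -- By `nested_eq_zero` a term needs `|a| ≤ p + 1` and `|b| ≤ q + 1`. As `p + q = |a| + |b|`, this
  -- leaves `p = |a|` and the two extreme cases `p + 1 = |a|` and `q + 1 = |b|`, in which one factor
  -- is a bracket.
  have key : ∀ p ∈ Finset.HasAntidiagonal.antidiagonal n,
      nestedIns ρ D p.1 a * nestedIns ρ D p.2 b =
        (if p = (a.length, b.length) then nestedIns ρ D a.length a * nestedIns ρ D b.length b else 0)
        - ((if p.1 + 1 = a.length then (a.length : ℤ).negOnePow •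
            (ρ (fev Λ.bracket a) * nestedIns ρ D (b.length + 1) b) else 0) +
          if p.2 + 1 = b.length then (b.length : ℤ).negOnePow •
            (nestedIns ρ D (a.length + 1) a * ρ (fev Λ.bracket b)) else 0) := by
    rintro ⟨p, q⟩ hpq
    rw [Finset.HasAntidiagonal.mem_antidiagonal] at hpq
    dsimp only at hpq ⊢
    rcases lt_trichotomy p a.length with hp | rfl | hp
    · rw [if_neg (by rw [Prod.mk.injEq]; omega), if_neg (c := q + 1 = b.length) (by omega)]
      split_ifs with hp'
      · rw [h.nested hp'.symm ha, show q = b.length + 1 by omega, ← hp', Nat.cast_succ,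
          Int.negOnePow_succ, Units.neg_smul, smul_mul_assoc]
        abel
      · rw [h.nested_eq_zero (by omega) ha]
        simp
    · rw [if_pos (by rw [Prod.mk.injEq]; omega), if_neg (by omega), if_neg (by omega),
        show q = b.length by omega]
      simp
    · rw [if_neg (by rw [Prod.mk.injEq]; omega), if_neg (by omega)]
      split_ifs with hq
      · rw [h.nested hq.symm hb, show p = a.length + 1 by omega, ← hq, Nat.cast_succ,
          Int.negOnePow_succ, Units.neg_smul, mul_smul_comm]
        abel
      · rw [h.nested_eq_zero (k := q) (by omega) hb]
        simp
  rw [Finset.sum_congr rfl key, Finset.sum_sub_distrib, Finset.sum_add_distrib]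
  refine congrArg₂ _ ?_ (congrArg₂ _ ?_ ?_)
  · rw [Finset.sum_ite_eq', if_pos]
    exact Finset.HasAntidiagonal.mem_antidiagonal.mpr hn
  -- No `p` satisfies `p + 1 = 0`; this is consistent because the bracket of the empty list is zero.
  · cases a with
    | nil => rw [fev_bracket_nil]; simp
    | cons x a =>
      rw [Finset.sum_eq_single (a.length, b.length + 1), if_pos (by simp)]
      · rintro ⟨p, q⟩ hpq hne
        rw [Finset.HasAntidiagonal.mem_antidiagonal] at hpq
        rw [List.length_cons] at hn
        rw [if_neg]
        intro hp
        rw [List.length_cons] at hp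
        exact hne (by rw [Prod.mk.injEq]; dsimp only at *; omega)
      · intro hne
        rw [List.length_cons] at hn
        exact absurd (Finset.HasAntidiagonal.mem_antidiagonal.mpr (by simpa using by omega)) hne
  · cases b with
    | nil => rw [fev_bracket_nil]; simp
    | cons x b =>
      rw [Finset.sum_eq_single (a.length + 1, b.length), if_pos (by simp)]
      · rintro ⟨p, q⟩ hpq hne
        rw [Finset.HasAntidiagonal.mem_antidiagonal] at hpq
        rw [List.length_cons] at hn
        rw [if_neg]
        intro hp
        rw [List.length_cons] at hp
        exact hne (by rw [Prod.mk.injEq]; dsimp only at *; omega)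
      · intro hne
        rw [List.length_cons] at hn
        exact absurd (Finset.HasAntidiagonal.mem_antidiagonal.mpr (by simpa using by omega)) hne

/-- Symmetry moves the bracket to the end of the list, where it is the outermost commutator and can
be expanded. -/
theorem nestedIns_bracket_cons [SetLike.GradedMonoid 𝒮] (h : GeneratesBracket 𝒲 Λ ρ D) (k : ℕ)
    {a b : List (ℤ × S)} (ha : ∀ p ∈ a, p ∈ homog 𝒮) (hb : ∀ p ∈ b, p ∈ homog 𝒮) :
    nestedIns ρ D k ((1 + ldeg a, fev Λ.bracket a) :: b) =
      (ldeg a).negOnePow • (ρ (fev Λ.bracket a) * nestedIns ρ D k b) +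
      ((1 + ldeg a) * ldeg b).negOnePow • (nestedIns ρ D k b * ρ (fev Λ.bracket a)) := by
  have hm : fev Λ.bracket a ∈ 𝒮 (1 + ldeg a) := Λ.fev_mem _ ha
  rw [(h.isMultiDer k).symm.cons_eq (x := (1 + ldeg a, fev Λ.bracket a)) hm hb, nestedIns_append,
    List.map_cons, ncl_cons, List.map_nil]
  simp only [ncl, smul_sub, negOnePow_smul_smul]
  refine (sub_eq_neg_add _ _).trans (congrArg₂ _ ?_ ?_)
  · rw [← Units.neg_smul, ← Int.negOnePow_succ]
    apply negOnePow_smul_eq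
    simp only [parity_simps]; grind
  · apply negOnePow_smul_eq
    simp only [parity_simps]

variable [CharZero K]

/-- For operators of degree `1` the graded commutator is the anticommutator, so the symmetric sum
counts every product twice. Here characteristic zero enters, through the factor `1 / 2`. -/
theorem halfSquare_eq (D : ℕ → Module.End K W) (n : ℕ) :
    halfSquare D n = ∑ p ∈ Finset.HasAntidiagonal.antidiagonal n, D p.1 * D p.2 := by
  have h1 : ∀ S T : Module.End K W, gradedComm 1 1 S T = S * T + T * S := by
    intro S T
    rw [gradedComm, mul_one, Int.negOnePow_one, Units.neg_smul, one_smul, sub_neg_eq_add]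
  have h2 := Finset.Nat.sum_antidiagonal_swap (n := n) (f := fun p => D p.1 * D p.2)
  simp only [Prod.fst_swap, Prod.snd_swap] at h2
  rw [halfSquare]
  simp only [h1, Finset.sum_add_distrib]
  rw [h2, ← two_smul K, smul_smul, one_div, inv_mul_cancel₀ two_ne_zero, one_smul]

/-- The nested commutators of the square of `D`. -/
theorem ncl_halfSquare [SetLike.GradedMonoid 𝒮] (h : GeneratesBracket 𝒲 Λ ρ D)
    {l : List (ℤ × S)} (hl : ∀ p ∈ l, p ∈ homog 𝒮) :
    ncl 2 (halfSquare D l.length) (l.map fun x => (x.1, ρ x.2)) =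
      (l.length : ℤ).negOnePow • shuf l fun a b =>
        ((b.length + 1 : ℕ) : ℤ).negOnePow •
          nestedIns ρ D (b.length + 1) ((1 + ldeg a, fev Λ.bracket a) :: b) +
        (ldeg a).negOnePow • ((a.length : ℤ).negOnePow • nestedIns ρ D a.length a *
          (b.length : ℤ).negOnePow • nestedIns ρ D b.length b) := by
  have h1 : ncl 2 (halfSquare D l.length) (l.map fun x => (x.1, ρ x.2)) = shuf l fun a b =>
      (ldeg a).negOnePow • ∑ p ∈ Finset.HasAntidiagonal.antidiagonal l.length,
        nestedIns ρ D p.1 a * nestedIns ρ D p.2 b := by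
    rw [halfSquare_eq, ncl_sum]
    simp only [Finset.smul_sum]
    rw [shuf_finsetSum]
    refine Finset.sum_congr rfl fun p _ => ?_
    rw [show (2 : ℤ) = 1 + 1 from rfl, ncl_mul, shuf_map]
    refine shuf_congr fun a b _ _ _ _ => ?_
    rw [ldeg_map, one_mul]
    rfl
  -- Products with the bracket on the right are rewritten with the blocks exchanged, so that `a` is
  -- the bracketed block in both extreme cases. The two products are then the halves of one
  -- commutator.
  have h2 : (shuf l fun a b => (ldeg a).negOnePow • (b.length : ℤ).negOnePow •
      (nestedIns ρ D (a.length + 1) a * ρ (fev Λ.bracket b))) = shuf l fun a b =>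
      (ldeg a * ldeg b + ldeg b + (a.length : ℤ)).negOnePow •
        (nestedIns ρ D (b.length + 1) b * ρ (fev Λ.bracket a)) := by
    rw [shuf_comm]
    simp only [negOnePow_smul_smul, add_assoc]
  rw [h1, ← shuf_negOnePow_smul]
  have hsplit : ∀ a b : List (ℤ × S), a ⊆ l → b ⊆ l → ldeg a + ldeg b = ldeg l →
      a.length + b.length = l.length →
      (ldeg a).negOnePow • ∑ p ∈ Finset.HasAntidiagonal.antidiagonal l.length,
        nestedIns ρ D p.1 a * nestedIns ρ D p.2 b =
      (ldeg a).negOnePow • (nestedIns ρ D a.length a * nestedIns ρ D b.length b) -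
      ((ldeg a).negOnePow • (a.length : ℤ).negOnePow •
        (ρ (fev Λ.bracket a) * nestedIns ρ D (b.length + 1) b) +
      (ldeg a).negOnePow • (b.length : ℤ).negOnePow •
        (nestedIns ρ D (a.length + 1) a * ρ (fev Λ.bracket b))) := by
    intro a b ha hb _ hn
    rw [h.sum_nestedIns_mul hn (fun p hp => hl p (ha hp)) fun p hp => hl p (hb hp), smul_sub,
      smul_add]
  rw [shuf_congr hsplit, shuf_sub, shuf_add, h2, ← shuf_add, ← shuf_sub]
  refine shuf_congr fun a b ha hb _ hn => ?_
  -- The extreme terms are now recognised as the nested commutator with the bracket of `a` as first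
  -- entry.
  rw [h.nestedIns_bracket_cons _ (fun p hp => hl p (ha hp)) fun p hp => hl p (hb hp), ← hn]
  simp only [smul_add, smul_mul_assoc, mul_smul_comm, negOnePow_smul_smul, Nat.cast_add,
    Nat.cast_one]
  rw [sub_eq_add_neg, neg_add, add_comm]
  refine congrArg₂ _ (congrArg₂ _ ?_ ?_) ?_
  · rw [← Units.neg_smul, ← Int.negOnePow_succ]
    apply negOnePow_smul_eq
    simp only [parity_simps]; grind
  · rw [← Units.neg_smul, ← Int.negOnePow_succ]
    apply negOnePow_smul_eq
    simp only [parity_simps]; grind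
  · apply negOnePow_smul_eq
    simp only [parity_simps]; grind

end GeneratesBracket

end LieDerivatives

/-! ### The homotopy Lie derivatives as a left connection. -/

section LieConnection

variable {K S W : Type*} [Field K] [Ring S] [Algebra K S] [AddCommGroup W] [Module K W]
  {𝒮 : ℤ → Submodule K S} {𝒲 : ℤ → Submodule K W} [Decomposition 𝒮]
  {Λ : PInfinityAlgebra 𝒮} {ρ : S →ₐ[K] Module.End K W} {D : ℕ → Module.End K W}

variable (𝒮) in
/-- The multilinear maps `L_k(u_1, …, u_{k-1}) = -(-1)^k [⋯[D_k, ρ u_1], ⋯, ρ u_{k-1}]`. -/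
def lieMap (ρ : S →ₐ[K] Module.End K W) (D : ℕ → Module.End K W) (n : ℕ) :
    MultilinearMap K (fun _ : Fin n => S) (Module.End K W) :=
  gradedExt 𝒮 fun d => (((n : ℤ).negOnePow : ℤ) : K) •
    (nestedMap 1 (D n) d).compLinearMap fun _ => ρ.toLinearMap

theorem negOnePow_cast_smul {M : Type*} [AddCommGroup M] [Module K M] (n : ℕ) (x : M) :
    ((((n : ℤ).negOnePow : ℤ) : K)) • x = (-1 : ℤ) ^ n • x := by
  rw [Int.cast_smul_eq_zsmul, Int.negOnePow_def, zpow_natCast]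
  simp

theorem lieMap_apply {n : ℕ} {d : Fin n → ℤ} {u : Fin n → S} (hu : ∀ i, u i ∈ 𝒮 (d i)) :
    lieMap 𝒮 ρ D n u = (-1 : ℤ) ^ n • nestedComm 1 (D n) d fun i => ρ (u i) := by
  rw [lieMap, gradedExt_apply 𝒮 _ d u hu, ← negOnePow_cast_smul (K := K)]
  rfl

theorem lieMap_ofFn {n : ℕ} {d : Fin n → ℤ} {u : Fin n → S} (hu : ∀ i, u i ∈ 𝒮 (d i)) :
    lieMap 𝒮 ρ D n u =
      (n : ℤ).negOnePow • nestedIns ρ D n (List.ofFn fun i => (d i, u i)) := by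
  rw [lieMap_apply hu, nestedComm_eq_ncl, nestedIns, List.map_ofFn, ← negOnePow_cast_smul (K := K),
    Int.cast_smul_eq_zsmul, ← Units.smul_def]
  rfl

theorem fev_lieMap {l : List (ℤ × S)} (hl : ∀ p ∈ l, p ∈ homog 𝒮) :
    fev (lieMap 𝒮 ρ D) l = (l.length : ℤ).negOnePow • nestedIns ρ D l.length l := by
  obtain ⟨w, hw⟩ := exists_eq_ofFn l rfl
  generalize l.length = n at w hw
  subst hw
  rw [forall_ofFn_mem] at hl
  rw [fev_ofFn, lieMap_ofFn (d := fun i => (w i).1) hl]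

/-- The connection with components `lieMap`. -/
def lieConnection [SetLike.GradedMonoid 𝒮] (h : GeneratesBracket 𝒲 Λ ρ D) :
    LeftConnection Λ.toLRInfinityAlgebra 𝒲 where
  conn := lieMap 𝒮 ρ D
  conn_degree n d u hu := by
    rw [lieMap_ofFn hu, Units.smul_def]
    refine zsmul_mem ?_ _
    have := ncl_mem_endDeg (h.degree n) (l := (List.ofFn fun i => (d i, u i)).map
      fun x => (x.1, ρ x.2)) fun x hx => by
        obtain ⟨y, hy, rfl⟩ := List.mem_map.mp hx
        obtain ⟨i, rfl⟩ := (List.mem_ofFn' _ _).mp hy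
        exact h.map_mem (hu i)
    rwa [ldeg_map, ldeg_ofFn] at this
  conn_symm n := by
    rw [gradedSymm_iff]
    intro pre x y post hp
    have hp' : ∀ p ∈ pre ++ y :: x :: post, p ∈ homog 𝒮 := fun p hm => hp p (by
      simp only [List.mem_append, List.mem_cons] at hm ⊢; tauto)
    have hlen : (pre ++ y :: x :: post).length = (pre ++ x :: y :: post).length := by simp
    rw [lev_eq_ite (lieMap 𝒮 ρ D), lev_eq_ite (lieMap 𝒮 ρ D), hlen]
    split_ifs
    · rw [fev_lieMap hp, fev_lieMap hp', (h.isMultiDer _).symm pre x y post hp, hlen, smul_comm]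
    · rw [smul_zero]
  conn_linear n p d v hv i b a ha := by
    -- The ground field is concentrated in degree `0`, so for `b ≠ 0` the scalar is zero and for `b
    -- = 0` this is `K`-linearity.
    rcases eq_or_ne b 0 with rfl | hb
    · have := ((LinearMap.applyₗ p).compMultilinearMap (lieMap 𝒮 ρ D n)).map_update_smul v i a (v i)
      rw [Function.update_eq_self] at this
      rw [this, mul_zero, Int.negOnePow_zero, one_smul]
    · have h0 : a = 0 := by simpa [groundGrading, hb] using ha
      rw [h0, zero_smul, zero_smul, smul_zero]
      exact MultilinearMap.map_coord_zero _ i (Function.update_self _ _ _)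
  conn_leibniz n d u hu b a ha p := by
    have hσ : Λ.toLRInfinityAlgebra.anchor n u a = 0 := rfl
    rcases eq_or_ne b 0 with rfl | hb
    · rw [hσ, zero_smul, add_zero, map_smul, mul_zero, Int.negOnePow_zero, one_smul]
    · have h0 : a = 0 := by simpa [groundGrading, hb] using ha
      rw [hσ, h0, zero_smul, zero_smul, map_zero, smul_zero, add_zero]

variable [SetLike.GradedMonoid 𝒮] (h : GeneratesBracket 𝒲 Λ ρ D) {n : ℕ} {d : Fin n → ℤ}
  {u : Fin n → S}

theorem lieConnection_conn (hu : ∀ i, u i ∈ 𝒮 (d i)) (w : W) :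
    (lieConnection h).conn n u w =
      (-1 : ℤ) ^ n • nestedComm 1 (D n) d (fun i => ρ (u i)) w := by
  have : (lieConnection h).conn n u = _ := lieMap_apply hu
  rw [this]
  rfl

/-- The summands of the curvature, written over splittings, are those of `ncl_halfSquare` evaluated
at `w`; the factor `(-1) ^ n` occurs there too and squares to one. -/
theorem lieConnection_curvature [CharZero K] (hu : ∀ i, u i ∈ 𝒮 (d i)) (w : W) :
    (lieConnection h).curvature d u w =
      (-1 : ℤ) ^ n • nestedComm 2 (halfSquare D n) d (fun i => ρ (u i)) w := by
  have hl : ∀ p ∈ List.ofFn fun i => (d i, u i), p ∈ homog 𝒮 := forall_ofFn_mem.mpr hu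
  have h1 : (shuf (List.ofFn fun i => (d i, u i)) fun a b =>
      fev (lieMap 𝒮 ρ D) ((1 + ldeg a, fev Λ.bracket a) :: b) w +
        (ldeg a).negOnePow • fev (lieMap 𝒮 ρ D) a (fev (lieMap 𝒮 ρ D) b w)) =
      (lieConnection h).curvature d u w := by
    rw [← sum_unshuffleSign, LeftConnection.curvature]
    refine Finset.sum_congr rfl fun I _ => ?_
    rw [fev_ofFn_cons, fev_ofFn, fev_ofFn, fev_ofFn, ldeg_sub]
    rfl
  have h2 := h.ncl_halfSquare hl
  rw [List.length_ofFn, List.map_ofFn] at h2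
  have h3 := nestedComm_eq_ncl 2 (halfSquare D n) d fun i => ρ (u i)
  rw [← h1, h3]
  change _ = (-1 : ℤ) ^ n • ncl 2 (halfSquare D n) (List.ofFn ((fun x : ℤ × S => (x.1, ρ x.2)) ∘
    fun i => (d i, u i))) w
  rw [h2, ← negOnePow_cast_smul (K := K), Int.cast_smul_eq_zsmul, ← Units.smul_def,
    LinearMap.smul_apply, negOnePow_smul_smul, ← two_mul, Int.negOnePow_two_mul, one_smul]
  have h4 := map_shuf (LinearMap.applyₗ (R := K) (M₂ := W) w) (List.ofFn fun i => (d i, u i))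
    fun a b => ((b.length + 1 : ℕ) : ℤ).negOnePow •
          nestedIns ρ D (b.length + 1) ((1 + ldeg a, fev Λ.bracket a) :: b) +
        (ldeg a).negOnePow • ((a.length : ℤ).negOnePow • nestedIns ρ D a.length a *
          (b.length : ℤ).negOnePow • nestedIns ρ D b.length b)
  refine Eq.trans (shuf_congr fun a b ha hb _ _ => ?_) h4.symm
  have ha' : ∀ p ∈ a, p ∈ homog 𝒮 := fun p hp => hl p (ha hp)
  have hb' : ∀ p ∈ b, p ∈ homog 𝒮 := fun p hp => hl p (hb hp)
  rw [← fev_lieMap ha', ← fev_lieMap hb', fev_lieMap (List.forall_mem_cons.mpr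
    ⟨show (1 + ldeg a, fev Λ.bracket a) ∈ homog 𝒮 from Λ.fev_mem _ ha', hb'⟩), List.length_cons]
  rfl

/-- One further commutator with `ρ v` turns the `n` nested commutators of `D n` into the bracket
with `v` as last entry; the formula is this commutator written out. -/
theorem lieConnection_map (hu : ∀ i, u i ∈ 𝒮 (d i)) {c : ℤ} {v : S} (hv : v ∈ 𝒮 c) (w : W) :
    (lieConnection h).conn n u (ρ v w) = ρ (Λ.bracket (n + 1) (Fin.snoc u v)) w +
      (c * (∑ i, d i + 1)).negOnePow • ρ v ((lieConnection h).conn n u w) := by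
  have hl : ∀ p ∈ List.ofFn fun i => (d i, u i), p ∈ homog 𝒮 := forall_ofFn_mem.mpr hu
  have h1 : (lieConnection h).conn n u = _ := lieMap_ofFn (d := d) hu
  have h2 := h.nested (m := n) (l := (List.ofFn fun i => (d i, u i)) ++ [(c, v)]) (by simp)
    (List.forall_mem_append.mpr ⟨hl, by simpa using hv⟩)
  rw [GeneratesBracket.nestedIns_append, List.map_cons, ncl_cons, List.map_nil, fev_ofFn_snoc] at h2
  have h3 := congrArg (fun T : Module.End K W => (n : ℤ).negOnePow • T) h2
  simp only [ncl, smul_sub, negOnePow_smul_smul, ← two_mul, Int.negOnePow_two_mul, one_smul] at h3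
  rw [h1, ← h3, LinearMap.sub_apply]
  simp only [LinearMap.smul_apply, Module.End.mul_apply, Units.smul_def, map_zsmul]
  simp only [← Units.smul_def, negOnePow_smul_smul, ldeg_ofFn]
  rw [eq_comm, sub_add_eq_add_sub, add_sub_assoc, add_eq_left, sub_eq_zero]
  apply negOnePow_smul_eq
  simp only [parity_simps]; grind

/-- This is the Leibniz rule of nested commutators in their first entry. -/
theorem lieConnection_mul (hu : ∀ i, u i ∈ 𝒮 (d i)) {b c : ℤ} {v v' : S} (hv : v ∈ 𝒮 b)
    (hv' : v' ∈ 𝒮 c) (w : W) :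
    (lieConnection h).conn (n + 1) (Fin.cons (v * v') u) w =
      b.negOnePow • ρ v ((lieConnection h).conn (n + 1) (Fin.cons v' u) w) +
        (c * ∑ i, d i).negOnePow • (lieConnection h).conn (n + 1) (Fin.cons v u) (ρ v' w) := by
  have hl : ∀ p ∈ List.ofFn fun i => (d i, u i), p ∈ homog 𝒮 := forall_ofFn_mem.mpr hu
  have h1 : ∀ {k : ℤ} {x : S}, x ∈ 𝒮 k → (lieConnection h).conn (n + 1) (Fin.cons x u) =
      ((n + 1 : ℕ) : ℤ).negOnePow •
        nestedIns ρ D (n + 1) ((k, x) :: List.ofFn fun i => (d i, u i)) := by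
    intro k x hx
    have h2 := fev_lieMap (ρ := ρ) (D := D) (l := (k, x) :: List.ofFn fun i => (d i, u i))
      (List.forall_mem_cons.mpr ⟨hx, hl⟩)
    rw [fev_ofFn_cons, List.length_cons, List.length_ofFn] at h2
    exact h2
  rw [h1 (SetLike.mul_mem_graded hv hv'), h1 hv, h1 hv',
    (h.isMultiDer _).leib b v c v' _ hv hv' hl, one_mul, ldeg_ofFn]
  simp only [smul_add, LinearMap.add_apply, LinearMap.smul_apply, Module.End.mul_apply,
    Units.smul_def, map_zsmul]
  simp only [← Units.smul_def, smul_comm (((n + 1 : ℕ) : ℤ).negOnePow)]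

end LieConnection

/-! ### Application to the symmetric algebra and the symmetric forms. -/

section Main

variable {K A L P : Type*} [Field K] [Ring A] [Algebra K A]
  [AddCommGroup L] [Module K L] [Module A L]
  [AddCommGroup P] [Module K P] [Module A P] [IsScalarTower K A P]
  {𝒜 : ℤ → Submodule K A} {ℒ : ℤ → Submodule K L} {ℳ : ℤ → Submodule K P}

theorem ins_ofScalar [GradedAlgebra 𝒜] [Decomposition ℒ] [Decomposition ℳ]
    [SetLike.GradedSMul 𝒜 ℒ] [SetLike.GradedSMul 𝒜 ℳ] (hA : GradedComm 𝒜) (a : A) :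
    ins 𝒜 ℒ ℳ hA (SymAlg.ofScalar 𝒜 ℒ a) = scalarOp 𝒜 ℒ ℳ hA a := by
  have h : SymAlg.ofScalar 𝒜 ℒ a =
      RingQuot.mkAlgHom K (SymRel 𝒜 ℒ) (TensorAlgebra.ι K (a, 0)) := rfl
  rw [h, ins, RingQuot.liftAlgHom_mkAlgHom_apply, TensorAlgebra.lift_ι_apply]
  simp

theorem ins_ofVector [GradedAlgebra 𝒜] [Decomposition ℒ] [Decomposition ℳ]
    [SetLike.GradedSMul 𝒜 ℒ] [SetLike.GradedSMul 𝒜 ℳ] (hA : GradedComm 𝒜) (ξ : L) :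
    ins 𝒜 ℒ ℳ hA (SymAlg.ofVector 𝒜 ℒ ξ) = vectorOp 𝒜 ℒ ℳ ξ := by
  have h : SymAlg.ofVector 𝒜 ℒ ξ =
      RingQuot.mkAlgHom K (SymRel 𝒜 ℒ) (TensorAlgebra.ι K (0, ξ)) := rfl
  rw [h, ins, RingQuot.liftAlgHom_mkAlgHom_apply, TensorAlgebra.lift_ι_apply]
  simp

theorem extends_iff [GradedAlgebra 𝒜] [Decomposition ℒ] [SetLike.GradedSMul 𝒜 ℒ]
    [Decomposition (SymAlg.grading 𝒜 ℒ)] {X : LRInfinityAlgebra 𝒜 ℒ}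
    {Λ : PInfinityAlgebra (SymAlg.grading 𝒜 ℒ)} : Extends X Λ ↔
      IsExtension X (SymAlg.ofScalar 𝒜 ℒ) (SymAlg.ofVector 𝒜 ℒ) (SymAlg.grading 𝒜 ℒ)
        (fev Λ.bracket) :=
  ⟨fun h => Λ.isExtension SymAlg.isSymAlg h.vector h.scalar h.scalar_scalar,
    fun h => ⟨h.vector, h.scalar SymAlg.isSymAlg, h.bracket_eq_zero SymAlg.isSymAlg⟩⟩

/-- All that the construction of the Lie derivatives has to know about forms and tensors is
collected here. -/
theorem IsExtension.generatesBracket {S : Type*} [Ring S] [Algebra K S] {sc : A →ₐ[K] S}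
    {vc : L →ₗ[K] S} {𝒮 : ℤ → Submodule K S} [GradedAlgebra 𝒜] [Decomposition ℒ] [Decomposition ℳ]
    [SetLike.GradedSMul 𝒜 ℒ] [SetLike.GradedSMul 𝒜 ℳ] (hA : GradedComm 𝒜)
    (hS : IsSymAlg 𝒜 ℒ sc vc 𝒮) {X : LRInfinityAlgebra 𝒜 ℒ} {Λ : PInfinityAlgebra 𝒮}
    (hΛ : IsExtension X sc vc 𝒮 (fev Λ.bracket)) {ρ : S →ₐ[K] Module.End K (SymForms 𝒜 ℒ ℳ)}
    (hsc : ∀ a, ρ (sc a) = scalarOp 𝒜 ℒ ℳ hA a) (hvc : ∀ ξ, ρ (vc ξ) = vectorOp 𝒜 ℒ ℳ ξ)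
    (N : LeftConnection X ℳ)
    (hD : ∀ m, ∀ Ω ∈ SymForms 𝒜 ℒ ℳ, N.ceOp m Ω ∈ SymForms 𝒜 ℒ ℳ) :
    GeneratesBracket (SymForms.grading 𝒜 ℒ ℳ) Λ ρ (N.ce hD) where
  comm hx hy := hS.mul_comm_of_mem hA hx hy
  map_mem hu := hS.map_mem_endDeg hA hsc hvc hu
  degree n := N.ce_mem_endDeg hD n
  nested hm hl := N.ncl_ce_eq hA hS hsc hvc hΛ hD hm hl

end Main

end SHLR

theorem mainTheorem2 {K A L P : Type*} [Field K] [CharZero K]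
    [Ring A] [Algebra K A] (𝒜 : ℤ → Submodule K A) [GradedAlgebra 𝒜] (hA : SHLR.GradedComm 𝒜)
    [AddCommGroup L] [Module K L] [Module A L] [IsScalarTower K A L]
    (ℒ : ℤ → Submodule K L) [DirectSum.Decomposition ℒ] [SetLike.GradedSMul 𝒜 ℒ]
    [AddCommGroup P] [Module K P] [Module A P] [IsScalarTower K A P]
    (ℳ : ℤ → Submodule K P) [DirectSum.Decomposition ℳ] [SetLike.GradedSMul 𝒜 ℳ]
    (X : SHLR.LRInfinityAlgebra 𝒜 ℒ) (N : SHLR.LeftConnection X ℳ) :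
    -- `X` has a unique extension to a `P_∞[1]` structure `Λ` on `S = S_A^• L`
    (∃! Λ : SHLR.PInfinityAlgebra (SHLR.SymAlg.grading 𝒜 ℒ), SHLR.Extends X Λ) ∧
    ∀ Λ : SHLR.PInfinityAlgebra (SHLR.SymAlg.grading 𝒜 ℒ), SHLR.Extends X Λ →
      -- the operators `D_k` are well defined on symmetric forms
      ∃ hD : ∀ m, ∀ Ω ∈ SHLR.SymForms 𝒜 ℒ ℳ, N.ceOp m Ω ∈ SHLR.SymForms 𝒜 ℒ ℳ,
      -- the homotopy Lie derivatives form a left `(K, S)`-connection in `Sym_A(L, P)`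
      ∃ Lie : SHLR.LeftConnection Λ.toLRInfinityAlgebra (SHLR.SymForms.grading 𝒜 ℒ ℳ),
        (∀ (n : ℕ) (d : Fin n → ℤ) (u : Fin n → SHLR.SymAlg 𝒜 ℒ),
          (∀ i, u i ∈ SHLR.SymAlg.grading 𝒜 ℒ (d i)) → ∀ Ω : SHLR.SymForms 𝒜 ℒ ℳ,
            Lie.conn n u Ω = (-1 : ℤ) ^ n •
              SHLR.nestedComm 1 (N.ce hD n) d (fun i => SHLR.ins 𝒜 ℒ ℳ hA (u i)) Ω) ∧
        -- the curvature
        (∀ (n : ℕ) (d : Fin n → ℤ) (u : Fin n → SHLR.SymAlg 𝒜 ℒ),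
          (∀ i, u i ∈ SHLR.SymAlg.grading 𝒜 ℒ (d i)) → ∀ Ω : SHLR.SymForms 𝒜 ℒ ℳ,
            Lie.curvature d u Ω = (-1 : ℤ) ^ n •
              SHLR.nestedComm 2 (SHLR.halfSquare (N.ce hD) n) d
                (fun i => SHLR.ins 𝒜 ℒ ℳ hA (u i)) Ω) ∧
        -- the Lie derivatives of `i_v Ω`
        (∀ (n : ℕ) (d : Fin n → ℤ) (u : Fin n → SHLR.SymAlg 𝒜 ℒ),
          (∀ i, u i ∈ SHLR.SymAlg.grading 𝒜 ℒ (d i)) →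
          ∀ (c : ℤ), ∀ v ∈ SHLR.SymAlg.grading 𝒜 ℒ c, ∀ Ω : SHLR.SymForms 𝒜 ℒ ℳ,
            Lie.conn n u (SHLR.ins 𝒜 ℒ ℳ hA v Ω) =
              SHLR.ins 𝒜 ℒ ℳ hA (Λ.bracket (n + 1) (Fin.snoc u v)) Ω +
                (c * (∑ i, d i + 1)).negOnePow • SHLR.ins 𝒜 ℒ ℳ hA v (Lie.conn n u Ω)) ∧
        -- the Lie derivatives along `v w, u_2, …, u_{k-1}`
        (∀ (n : ℕ) (d : Fin n → ℤ) (u : Fin n → SHLR.SymAlg 𝒜 ℒ),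
          (∀ i, u i ∈ SHLR.SymAlg.grading 𝒜 ℒ (d i)) →
          ∀ (b c : ℤ), ∀ v ∈ SHLR.SymAlg.grading 𝒜 ℒ b, ∀ w ∈ SHLR.SymAlg.grading 𝒜 ℒ c,
          ∀ Ω : SHLR.SymForms 𝒜 ℒ ℳ,
            Lie.conn (n + 1) (Fin.cons (v * w) u) Ω =
              b.negOnePow • SHLR.ins 𝒜 ℒ ℳ hA v (Lie.conn (n + 1) (Fin.cons w u) Ω) +
                (c * ∑ i, d i).negOnePow •
                  Lie.conn (n + 1) (Fin.cons v u) (SHLR.ins 𝒜 ℒ ℳ hA w Ω)) := by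
  have hS := SHLR.SymAlg.isSymAlg (𝒜 := 𝒜) (ℒ := ℒ)
  have := hS.gradedMonoid
  -- The decomposition of the symmetric algebra is not given in advance; it is what allows maps on
  -- tensors to be defined on homogeneous entries.
  obtain ⟨hdec⟩ := hS.exists_decomposition
  have hD : ∀ m, ∀ Ω ∈ SHLR.SymForms 𝒜 ℒ ℳ, N.ceOp m Ω ∈ SHLR.SymForms 𝒜 ℒ ℳ :=
    fun m _ hΩ => N.ceOp_mem_symForms m hΩ
  refine ⟨?_, fun Λ hΛ => ⟨hD, ?_⟩⟩
  · obtain ⟨Λ, hΛ⟩ := hS.exists_isExtension X hA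
    exact ⟨Λ, SHLR.extends_iff.mpr hΛ, fun Λ' hΛ' =>
      SHLR.IsExtension.eq hS (SHLR.extends_iff.mp hΛ') hΛ⟩
  · have hG := (SHLR.extends_iff.mp hΛ).generatesBracket hA hS
      (SHLR.ins_ofScalar (ℳ := ℳ) hA) (SHLR.ins_ofVector hA) N hD
    exact ⟨SHLR.lieConnection hG, fun _ _ _ hu => SHLR.lieConnection_conn hG hu,
      fun _ _ _ hu => SHLR.lieConnection_curvature hG hu,
      fun _ _ _ hu _ _ hv => SHLR.lieConnection_map hG hu hv,
      fun _ _ _ hu _ _ _ hv _ hv' => SHLR.lieConnection_mul hG hu hv hv'⟩
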